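/- **Setting.** Let $\vec r(t,x,y)\in\mathbb R^3$ be a smooth moving surface on an open set of $(t,x,y)$, with $|\vec r_x|=1$ and $\vec r_x\wedge\vec r_y\neq0$. Let $e^\parallel=\vec r_x$, let $e^\perp$ be the unit normal in the direction of $\vec r_x\wedge \vec r_y$, and ${*e^\parallel}=e^\perp\wedge e^\parallel$. Put $q_1=\vec r_x\cdot\vec r_y$, $dA=|\vec r_x\wedge\vec r_y|\,dx\,dy$, $D_\parallel=D_x$, $D_{*\parallel}=|\vec r_x\wedge\vec r_y|^{-1}(D_y-q_1D_x)$. The geodesic curvature, normal curvature and relative torsion of the $x$-lines are $\alpha={*e^\parallel}\cdot e^\parallel_x$, $\beta=e^\perp\cdot e^\parallel_x$, $\gamma=e^\perp\cdot{*e^\parallel_x}$; those of the $y$-lines are $\mu={*e^\parallel}\cdot e^\parallel_y$, $\rho=e^\perp\cdot e^\parallel_y$, $\sigma=e^\perp\cdot{*e^\parallel_y}$. Let $k_{11}=e^\parallel\cdot D_\parallel e^\perp$, $k_{12}=e^\parallel\cdot D_{*\parallel}e^\perp$, $k_{22}={*e^\parallel}\cdot D_{*\parallel}e^\perp$, let $H=\frac12(k_{11}+k_{22})$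 be the mean curvature, $\mathcal D_1=D_\parallel-ik_{12}$, $\mathcal D_2=D_{*\parallel}-ik_{22}$. The recursion operator is $$\mathcal P w=iw_x-\gamma w-(\beta-i\alpha)D_x^{-1}\mathrm{Re}((\alpha+i\beta)\bar w),$$ and $$a^{(k)}=-D_x^{-1}\mathrm{Re}\big((\alpha-i\beta)\mathcal P^k(\rho-i\mu)\big),\qquad b^{(k)}+ic^{(k)}=-\mathcal P^k(\rho-i\mu),$$ where $D_x^{-1}$ denotes a smooth antiderivative in $x$, and the same antiderivative $-a^{(k)}$ is used when forming $\mathcal P^{k+1}(\rho-i\mu)$ from $\mathcal P^{k}(\rho-i\mu)$. The $n$-th flow ($n=1,2,\dots$) is $$\vec r_t=a^{(n-1)}e^\parallel+b^{(n-1)}{*e^\parallel}+c^{(n-1)}e^\perp,\qquad|\vec r_x|=1 .$$ **Theorem.** *(1)* For every $n\ge1$ and every surface with $|\vec r_x|=1$, the velocity field $V=a^{(n-1)}e^\parallel+b^{(n-1)}{*e^\parallel}+c^{(n-1)}e^\perp$ satisfies $\vec r_x\cdot V_x=0$, and $\partial_t|\vec r_x|=0$ under the $n$-th flow: the surface is non-stretching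 in the $x$-direction. Transverse directions are not constrained: for every $n$ there is a solution of the $n$-th flow such that at every point $\partial_t|\xi\vec r_x+\eta\vec r_y|\ne0$ for all $\xi,\eta\in\mathbb R$, $\eta\neq0$. Under the $n$-th flow the area element evolves by $(dA)_t=\varepsilon^{(n)}dA+\mathcal L_{X}dA$, where $X=a^{(n-1)}e^\parallel+b^{(n-1)}{*e^\parallel}$ is the tangential part of the flow and the expansion factor is $$\varepsilon^{(n)}=2Hc^{(n-1)}=-2H\,\mathrm{Im}\big(\mathcal P^{n-1}(\rho-i\mu)\big).$$ *(2)* Let $\psi$ be a smooth function with $\gamma=-\psi_x$. Under the $n$-th flow $$\alpha_t+i\beta_t=D_x\big(a^{(n-1)}(\alpha+i\beta)\big)-\mathcal D_1{}^2\mathcal P^{n-1}(\rho-i\mu)-(\beta-i\alpha)\,\mathrm{Im}\big(\mathcal D_2\mathcal P^{n-1}(\rho-i\mu)\big),$$ $$\psi_t=a^{(n-1)}\psi_x+a^{(n)}+\mathrm{Im}\big(\mathcal D_2\mathcal P^{n-1}(\rho-i\mu)\big),$$ where $a^{(n)}$ is a suitable choice of the antiderivative $-D_x^{-1}\mathrm{Re}((\alpha-i\beta)\mathcal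 P^n(\rho-i\mu))$. If also $a^{(0)}=\sigma+\psi_y$ (so that the rotation rate in $y$ of the parallel frame defined by $\psi$ is the antiderivative $a^{(0)}=D_x^{-1}(\beta\mu-\alpha\rho)$), then $\mathcal P(\rho-i\mu)=\alpha_y+\beta\psi_y+i(\beta_y-\alpha\psi_y)$. *(3)* The system in (2) is integrable in the sense that it has the following infinite set of nontrivial constants of motion. Let $t$ range over an open set of times and $(x,y)$ over $\mathbb R^2$, assume $\gamma=-\psi_x$ and $a^{(0)}=\sigma+\psi_y$, and let all $a^{(k)}$ be defined by the skew-symmetric inverse $D_x^{-1}=\frac12\big(\int_{-\infty}^x-\int_x^\infty\big)$, that is, $a^{(k)}|_{x=+\infty}=-a^{(k)}|_{x=-\infty}$. Assume that, locally uniformly in $t$, the function $u=e^{-i\psi}(\alpha+i\beta)$ is either rapidly decreasing in $(x,y)$ with all its $x,y$-derivatives (then $C=\mathbb R\times\mathbb R$), or $L$-periodic in $y$ and rapidly decreasing in $x$, uniformly in $y$, with all its $x,y$-derivatives (then $C=\mathbb R\times(0,L]$). Under every flow $n\ge1$ the equation for $\psi_t$ holds with this $a^{(n)}$ up to adding a function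 of $t$ alone to its right-hand side (a rigid rotation of the parallel frame), and for every $k\ge2$ the integral $\iint_C a^{(k)}\,dx\,dy$, taken as the iterated integral $\int\big(\int a^{(k)}dy\big)dx$, converges (both successive integrals absolutely) and is a constant of motion: $$\frac{d}{dt}\iint_C a^{(k)}\,dx\,dy=0 .$$ Moreover $$\iint_C a^{(2)}dxdy=\tfrac12\iint_C\alpha\beta_y-\beta\alpha_y-\psi_y(\alpha^2+\beta^2)\,dxdy,$$ $$\iint_C a^{(3)}dxdy=-\iint_C\alpha_x\alpha_y+\beta_x\beta_y+\psi_x\psi_y(\alpha^2+\beta^2)+\psi_x(\alpha_y\beta-\beta_y\alpha)+\psi_y(\alpha_x\beta-\beta_x\alpha)-\tfrac12\nu_0(\alpha^2+\beta^2)\,dxdy,$$ with $\nu_0=D_x^{-1}(\alpha\alpha_y+\beta\beta_y)=-a^{(1)}$. These constants of motion are nontrivial: for every $k\ge2$ there is a surface satisfying these conditions with $\iint_C a^{(k)}dxdy\neq0$. -/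

import Mathlib

open Set Filter Topology MeasureTheory
open scoped ContDiff

namespace SurfaceFlow

/-- Euclidean three-space. -/
abbrev E3 : Type := EuclideanSpace ℝ (Fin 3)

/-- The cross product (written as a wedge of vectors) on Euclidean three-space. -/
noncomputable def cross (v w : E3) : E3 :=
  !₂[v 1 * w 2 - v 2 * w 1, v 2 * w 0 - v 0 * w 2, v 0 * w 1 - v 1 * w 0]

section Calculus

variable {F : Type*} [NormedAddCommGroup F] [NormedSpace ℝ F]

/-- Partial derivatives of a field that depends on `t x y`. -/
noncomputable def dt (f : ℝ → ℝ → ℝ → F) : ℝ → ℝ → ℝ → F :=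
  fun t x y => deriv (fun s => f s x y) t

noncomputable def dx (f : ℝ → ℝ → ℝ → F) : ℝ → ℝ → ℝ → F :=
  fun t x y => deriv (fun s => f t s y) x

noncomputable def dy (f : ℝ → ℝ → ℝ → F) : ℝ → ℝ → ℝ → F :=
  fun t x y => deriv (fun s => f t x s) y

/-- Smoothness of a field on a set of points `(t, x, y)`. -/
def SmoothOn (Ω : Set (ℝ × ℝ × ℝ)) (f : ℝ → ℝ → ℝ → F) : Prop :=
  ContDiffOn ℝ ∞ (fun p : ℝ × ℝ × ℝ => f p.1 p.2.1 p.2.2) Ω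

end Calculus

/-! The adapted frame of a moving surface `r t x y` whose `x`-lines have unit speed. -/

/-- Unit tangent of the `x`-lines. -/
noncomputable def eTan (r : ℝ → ℝ → ℝ → E3) : ℝ → ℝ → ℝ → E3 := dx r

/-- The (unnormalized) surface normal `r_x ∧ r_y`. -/
noncomputable def nrm (r : ℝ → ℝ → ℝ → E3) : ℝ → ℝ → ℝ → E3 :=
  fun t x y => cross (dx r t x y) (dy r t x y)

/-- The density of the area element `dA = |r_x ∧ r_y| dx dy`. -/
noncomputable def area (r : ℝ → ℝ → ℝ → E3) : ℝ → ℝ → ℝ → ℝ :=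
  fun t x y => ‖nrm r t x y‖

/-- Unit surface normal. -/
noncomputable def eNor (r : ℝ → ℝ → ℝ → E3) : ℝ → ℝ → ℝ → E3 :=
  fun t x y => (area r t x y)⁻¹ • nrm r t x y

/-- Unit tangent vector orthogonal to the `x`-lines. -/
noncomputable def eStar (r : ℝ → ℝ → ℝ → E3) : ℝ → ℝ → ℝ → E3 :=
  fun t x y => cross (eNor r t x y) (eTan r t x y)

/-- Geodesic curvature, normal curvature, relative torsion of the `x`-lines. -/
noncomputable def alpha (r : ℝ → ℝ → ℝ → E3) : ℝ → ℝ → ℝ → ℝ :=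
  fun t x y => inner ℝ (eStar r t x y) (dx (eTan r) t x y)

noncomputable def beta (r : ℝ → ℝ → ℝ → E3) : ℝ → ℝ → ℝ → ℝ :=
  fun t x y => inner ℝ (eNor r t x y) (dx (eTan r) t x y)

noncomputable def gam (r : ℝ → ℝ → ℝ → E3) : ℝ → ℝ → ℝ → ℝ :=
  fun t x y => inner ℝ (eNor r t x y) (dx (eStar r) t x y)

/-- Geodesic curvature, normal curvature, relative torsion of the `y`-lines. -/
noncomputable def mu (r : ℝ → ℝ → ℝ → E3) : ℝ → ℝ → ℝ → ℝ :=
  fun t x y => inner ℝ (eStar r t x y) (dy (eTan r) t x y)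

noncomputable def rho (r : ℝ → ℝ → ℝ → E3) : ℝ → ℝ → ℝ → ℝ :=
  fun t x y => inner ℝ (eNor r t x y) (dy (eTan r) t x y)

noncomputable def sigma (r : ℝ → ℝ → ℝ → E3) : ℝ → ℝ → ℝ → ℝ :=
  fun t x y => inner ℝ (eNor r t x y) (dy (eStar r) t x y)

/-- `q₁ = r_x · r_y`, so that `r_y = q₁ e∥ + |r_x ∧ r_y| *e∥`. -/
noncomputable def q1 (r : ℝ → ℝ → ℝ → E3) : ℝ → ℝ → ℝ → ℝ :=
  fun t x y => inner ℝ (dx r t x y) (dy r t x y)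

/-- Derivative on the surface in the direction `*e∥`; the one in the direction `e∥` is `dx`. -/
noncomputable def dStar {F : Type*} [NormedAddCommGroup F] [NormedSpace ℝ F]
    (r : ℝ → ℝ → ℝ → E3) (f : ℝ → ℝ → ℝ → F) : ℝ → ℝ → ℝ → F :=
  fun t x y => (area r t x y)⁻¹ • (dy f t x y - q1 r t x y • dx f t x y)

/-- Extrinsic curvature scalars and mean curvature. -/
noncomputable def k11 (r : ℝ → ℝ → ℝ → E3) : ℝ → ℝ → ℝ → ℝ :=
  fun t x y => inner ℝ (eTan r t x y) (dx (eNor r) t x y)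

noncomputable def k12 (r : ℝ → ℝ → ℝ → E3) : ℝ → ℝ → ℝ → ℝ :=
  fun t x y => inner ℝ (eTan r t x y) (dStar r (eNor r) t x y)

noncomputable def k22 (r : ℝ → ℝ → ℝ → E3) : ℝ → ℝ → ℝ → ℝ :=
  fun t x y => inner ℝ (eStar r t x y) (dStar r (eNor r) t x y)

noncomputable def meanCurv (r : ℝ → ℝ → ℝ → E3) : ℝ → ℝ → ℝ → ℝ :=
  fun t x y => (k11 r t x y + k22 r t x y) / 2

/-- `α + iβ` and `β - iα`. -/
noncomputable def kap (r : ℝ → ℝ → ℝ → E3) : ℝ → ℝ → ℝ → ℂ :=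
  fun t x y => (alpha r t x y : ℂ) + Complex.I * (beta r t x y : ℂ)

noncomputable def kapPerp (r : ℝ → ℝ → ℝ → E3) : ℝ → ℝ → ℝ → ℂ :=
  fun t x y => (beta r t x y : ℂ) - Complex.I * (alpha r t x y : ℂ)

/-- The operators `𝒟₁ = D∥ - i k₁₂` and `𝒟₂ = D_{*∥} - i k₂₂`. -/
noncomputable def D1 (r : ℝ → ℝ → ℝ → E3) (z : ℝ → ℝ → ℝ → ℂ) : ℝ → ℝ → ℝ → ℂ :=
  fun t x y => dx z t x y - Complex.I * (k12 r t x y : ℂ) * z t x y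

noncomputable def D2 (r : ℝ → ℝ → ℝ → E3) (z : ℝ → ℝ → ℝ → ℂ) : ℝ → ℝ → ℝ → ℂ :=
  fun t x y => dStar r z t x y - Complex.I * (k22 r t x y : ℂ) * z t x y

/-- The recursion operator `𝒫 w = i w_x - γ w - (β - iα) D_x⁻¹ Re((α + iβ) w̄)`, where the
antiderivative `θ = D_x⁻¹ Re((α + iβ) w̄)` is an argument. -/
noncomputable def recOp (r : ℝ → ℝ → ℝ → E3) (θ : ℝ → ℝ → ℝ → ℝ) (w : ℝ → ℝ → ℝ → ℂ) :
    ℝ → ℝ → ℝ → ℂ :=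
  fun t x y => Complex.I * dx w t x y - (gam r t x y : ℂ) * w t x y
    - kapPerp r t x y * (θ t x y : ℂ)

/-- `hier r a k = 𝒫^k (ρ - iμ)`, where `a k = - D_x⁻¹ Re((α - iβ) 𝒫^k (ρ - iμ))` are the
antiderivatives used; note that `Re((α - iβ) w) = Re((α + iβ) w̄)`. -/
noncomputable def hier (r : ℝ → ℝ → ℝ → E3) (a : ℕ → ℝ → ℝ → ℝ → ℝ) : ℕ → ℝ → ℝ → ℝ → ℂ
  | 0 => fun t x y => (rho r t x y : ℂ) - Complex.I * (mu r t x y : ℂ)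
  | k + 1 => recOp r (fun t x y => - a k t x y) (hier r a k)

/-- `Re((α - iβ) w)`. -/
noncomputable def pairing (r : ℝ → ℝ → ℝ → E3) (w : ℝ → ℝ → ℝ → ℂ) : ℝ → ℝ → ℝ → ℝ :=
  fun t x y => (((alpha r t x y : ℂ) - Complex.I * (beta r t x y : ℂ)) * w t x y).re

/-- A smooth moving regular surface whose `x`-lines are parametrized by arclength. -/
structure IsSurface (Ω : Set (ℝ × ℝ × ℝ)) (r : ℝ → ℝ → ℝ → E3) : Prop where
  isOpen : IsOpen Ω
  smooth : SmoothOn Ω r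
  unit : ∀ t x y, (t, x, y) ∈ Ω → ‖dx r t x y‖ = 1
  regular : ∀ t x y, (t, x, y) ∈ Ω → nrm r t x y ≠ 0

/-- `θ` is a smooth antiderivative in `x` of `f`, that is `θ = D_x⁻¹ f` for some choice of the
integration function, which may depend on `t` and `y`. -/
structure IsAntiderivX (Ω : Set (ℝ × ℝ × ℝ)) (θ f : ℝ → ℝ → ℝ → ℝ) : Prop where
  smooth : SmoothOn Ω θ
  eq : ∀ t x y, (t, x, y) ∈ Ω → dx θ t x y = f t x y

/-- For `k < N`, `a k` is a choice of `- D_x⁻¹ Re((α - iβ) 𝒫^k (ρ - iμ))`. -/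
def IsHierarchy (Ω : Set (ℝ × ℝ × ℝ)) (r : ℝ → ℝ → ℝ → E3) (a : ℕ → ℝ → ℝ → ℝ → ℝ)
    (N : ℕ) : Prop :=
  ∀ k < N, IsAntiderivX Ω (a k) (fun t x y => - pairing r (hier r a k) t x y)

/-- The coefficients `b^{(k)} + i c^{(k)} = - 𝒫^k (ρ - iμ)`. -/
noncomputable def coefB (r : ℝ → ℝ → ℝ → E3) (a : ℕ → ℝ → ℝ → ℝ → ℝ) (k : ℕ) :
    ℝ → ℝ → ℝ → ℝ :=
  fun t x y => - (hier r a k t x y).re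

noncomputable def coefC (r : ℝ → ℝ → ℝ → E3) (a : ℕ → ℝ → ℝ → ℝ → ℝ) (k : ℕ) :
    ℝ → ℝ → ℝ → ℝ :=
  fun t x y => - (hier r a k t x y).im

/-- The tangential part `a^{(k)} e∥ + b^{(k)} *e∥`. -/
noncomputable def tangential (r : ℝ → ℝ → ℝ → E3) (a : ℕ → ℝ → ℝ → ℝ → ℝ) (k : ℕ) :
    ℝ → ℝ → ℝ → E3 :=
  fun t x y => a k t x y • eTan r t x y + coefB r a k t x y • eStar r t x y

/-- The velocity `a^{(k)} e∥ + b^{(k)} *e∥ + c^{(k)} e⊥`. -/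
noncomputable def velocity (r : ℝ → ℝ → ℝ → E3) (a : ℕ → ℝ → ℝ → ℝ → ℝ) (k : ℕ) :
    ℝ → ℝ → ℝ → E3 :=
  fun t x y => tangential r a k t x y + coefC r a k t x y • eNor r t x y

/-- The `n`-th surface flow of the hierarchy, `n ≥ 1`. -/
structure IsFlow (n : ℕ) (Ω : Set (ℝ × ℝ × ℝ)) (r : ℝ → ℝ → ℝ → E3)
    (a : ℕ → ℝ → ℝ → ℝ → ℝ) : Prop where
  surface : IsSurface Ω r
  hierarchy : IsHierarchy Ω r a n
  flow : ∀ t x y, (t, x, y) ∈ Ω → dt r t x y = velocity r a (n - 1) t x y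

/-- The coordinate components `X = X¹ ∂_x + X² ∂_y` of the tangential part of the flow. -/
noncomputable def tanX (r : ℝ → ℝ → ℝ → E3) (a : ℕ → ℝ → ℝ → ℝ → ℝ) (k : ℕ) :
    ℝ → ℝ → ℝ → ℝ :=
  fun t x y => a k t x y - coefB r a k t x y * q1 r t x y / area r t x y

noncomputable def tanY (r : ℝ → ℝ → ℝ → E3) (a : ℕ → ℝ → ℝ → ℝ → ℝ) (k : ℕ) :
    ℝ → ℝ → ℝ → ℝ :=
  fun t x y => coefB r a k t x y / area r t x y

/-- The factor `ε^{(n)} = 2 H c^{(n-1)} = - 2 H Im(𝒫^{n-1}(ρ - iμ))`. -/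
noncomputable def expansion (r : ℝ → ℝ → ℝ → E3) (a : ℕ → ℝ → ℝ → ℝ → ℝ) (n : ℕ) :
    ℝ → ℝ → ℝ → ℝ :=
  fun t x y => - (2 * meanCurv r t x y * (hier r a (n - 1) t x y).im)

/-- `ψ` is an angle with `γ = - ψ_x`: the vectors `Re` and `Im` of `e^{-iψ}(*e∥ + i e⊥)` then form
with `e∥` a parallel frame along the `x`-lines. -/
structure IsAngle (Ω : Set (ℝ × ℝ × ℝ)) (r : ℝ → ℝ → ℝ → E3) (ψ : ℝ → ℝ → ℝ → ℝ) :
    Prop where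
  smooth : SmoothOn Ω ψ
  eq : ∀ t x y, (t, x, y) ∈ Ω → gam r t x y = - dx ψ t x y

/-- The rotation rate in `y` of the parallel frame given by `ψ`, which is `σ + ψ_y`, is the
antiderivative `a^{(0)} = D_x⁻¹(βμ - αρ)` that enters the hierarchy. -/
def IsAdapted (Ω : Set (ℝ × ℝ × ℝ)) (r : ℝ → ℝ → ℝ → E3) (a : ℕ → ℝ → ℝ → ℝ → ℝ)
    (ψ : ℝ → ℝ → ℝ → ℝ) : Prop :=
  ∀ t x y, (t, x, y) ∈ Ω → a 0 t x y = sigma r t x y + dy ψ t x y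

/-- The covariant `u = e^{-iψ}(α + iβ)`, the components of `e∥_x` in the parallel frame. -/
noncomputable def covU (r : ℝ → ℝ → ℝ → E3) (ψ : ℝ → ℝ → ℝ → ℝ) : ℝ → ℝ → ℝ → ℂ :=
  fun t x y => Complex.exp (- (Complex.I * (ψ t x y : ℂ))) * kap r t x y

/-- The boundary conditions for `u`, locally uniform in time, in two cases: rapid decay of all
derivatives on the plane, or (for `y` in a circle of length `L`) `L`-periodicity in `y` and rapid
decay of all derivatives in `x`. The set `Y` is the range of integration for `y`. -/
def BoundaryCond (T : Set ℝ) (Y : Set ℝ) (u : ℝ → ℝ → ℝ → ℂ) : Prop :=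
  (Y = univ ∧ ∀ K ⊆ T, IsCompact K → ∀ N j l : ℕ, ∃ C : ℝ, ∀ t ∈ K, ∀ x y : ℝ,
      (1 + |x| + |y|) ^ N * ‖dx^[j] (dy^[l] u) t x y‖ ≤ C) ∨
  (∃ L : ℝ, 0 < L ∧ Y = Ioc 0 L ∧ (∀ t ∈ T, ∀ x y : ℝ, u t x (y + L) = u t x y) ∧
    ∀ K ⊆ T, IsCompact K → ∀ N j l : ℕ, ∃ C : ℝ, ∀ t ∈ K, ∀ x y : ℝ,
      (1 + |x|) ^ N * ‖dx^[j] (dy^[l] u) t x y‖ ≤ C)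

/-- Global data over the times `T`, with `x ∈ ℝ` and `y ∈ Y`. The antiderivatives `a^{(k)}` are those
given by the skew-symmetric inverse `D_x⁻¹ = ½ (∫_{-∞}^x - ∫_x^∞)`: their limits at `x = ∞` and
`x = -∞` are opposite. -/
structure IsGlobal (T : Set ℝ) (Y : Set ℝ) (r : ℝ → ℝ → ℝ → E3)
    (a : ℕ → ℝ → ℝ → ℝ → ℝ) (ψ : ℝ → ℝ → ℝ → ℝ) : Prop where
  surface : IsSurface (T ×ˢ univ) r
  hierarchy : ∀ N, IsHierarchy (T ×ˢ univ) r a N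
  skew : ∀ k, ∀ t ∈ T, ∀ y : ℝ, ∃ l : ℝ,
    Tendsto (fun x => a k t x y) atTop (𝓝 l) ∧ Tendsto (fun x => a k t x y) atBot (𝓝 (-l))
  angle : IsAngle (T ×ˢ univ) r ψ
  adapted : IsAdapted (T ×ˢ univ) r a ψ
  boundary : BoundaryCond T Y (covU r ψ)

/-- The integral of a density over the coordinate domain of `(x, y)`, with `y` integrated first. -/
noncomputable def total (Y : Set ℝ) (f : ℝ → ℝ → ℝ → ℝ) (t : ℝ) : ℝ :=
  ∫ x : ℝ, ∫ y in Y, f t x y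

/-- Absolute convergence of the two successive integrals in `total`. -/
def Converges (Y : Set ℝ) (f : ℝ → ℝ → ℝ → ℝ) (t : ℝ) : Prop :=
  (∀ x : ℝ, IntegrableOn (fun y => f t x y) Y) ∧ Integrable (fun x : ℝ => ∫ y in Y, f t x y)

/-- `½ (α β_y - β α_y - ψ_y (α² + β²))`. -/
noncomputable def density2 (r : ℝ → ℝ → ℝ → E3) (ψ : ℝ → ℝ → ℝ → ℝ) : ℝ → ℝ → ℝ → ℝ :=
  fun t x y => 1 / 2 * (alpha r t x y * dy (beta r) t x y - beta r t x y * dy (alpha r) t x y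
    - dy ψ t x y * (alpha r t x y ^ 2 + beta r t x y ^ 2))

/-- `-(α_x α_y + β_x β_y + ψ_x ψ_y (α² + β²) + ψ_x (α_y β - β_y α) + ψ_y (α_x β - β_x α))
- ½ a^{(1)} (α² + β²)`. -/
noncomputable def density3 (r : ℝ → ℝ → ℝ → E3) (a : ℕ → ℝ → ℝ → ℝ → ℝ)
    (ψ : ℝ → ℝ → ℝ → ℝ) : ℝ → ℝ → ℝ → ℝ :=
  fun t x y =>
    - (dx (alpha r) t x y * dy (alpha r) t x y + dx (beta r) t x y * dy (beta r) t x y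
      + dx ψ t x y * dy ψ t x y * (alpha r t x y ^ 2 + beta r t x y ^ 2)
      + dx ψ t x y * (dy (alpha r) t x y * beta r t x y - dy (beta r) t x y * alpha r t x y)
      + dy ψ t x y * (dx (alpha r) t x y * beta r t x y - dx (beta r) t x y * alpha r t x y))
    - 1 / 2 * a 1 t x y * (alpha r t x y ^ 2 + beta r t x y ^ 2)

end SurfaceFlow

namespace SurfaceFlow

/-! ### Calculus of fields -/

/-! Local part. In the orthonormal frame `(e∥, *e∥, e⊥)` the derivative in each direction `i` has
components `K_i = frK i` (the derivative of `e∥`) and `G_i = frG i` (the rotation of the normal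
plane). Commuting second derivatives give `∂_j K_i - ∂_i K_j = -i G_j K_i + i G_i K_j` and `∂_j G_i
- ∂_i G_j = Im(K̄_i K_j)` (`pd_frK_sub`, `pd_frG_sub'`). The hierarchy starts with `-i K_y`, and its
velocity field has `V_x` orthogonal to `e∥` precisely because of the choice of `a`. Since `(e∥)_t =
V_x`, the `n`-th flow has `K_t = i 𝒫^n(ρ - iμ)` (`frK_t'`): one step of the recursion is one
differentiation of the velocity. Transport of `r_y` gives `G_t` and the area law. The `(x,t)`
structure equations are then the evolution equations of `α + iβ` and `ψ`, and the `(x,y)` equation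
identifies `𝒫(ρ - iμ)`.

Passage to the parallel frame. Rotation by `ψ` removes `γ`. With `u = e^{-iψ}(α + iβ)` and `W_k =
e^{-iψ} 𝒫^k(ρ - iμ)` one has `W_{k+1} = i(∂_x W_k - a_k u)`, `∂_x a_k = -Re(ū W_k)` and `W_1 = u_y`;
the flow becomes `u_t = W_{n+1} - i c u`, where `c` is the rotation rate of the frame minus `a_n`.
Here `c_x = 0`, and `c_y` is independent of `x` with opposite limits at `±∞`, hence zero
(`IsGlobal.dy_excess`).

Conservation. A derivation with `δu = Q_0`, for a second hierarchy `(Q, q)` over `u`, acts on all of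
`(W, a)` by explicit finite sums (`LaxHier.derivation_eq`). For the flow this reads `∂_t a_k = ∂_y
a_{k+n} - Σ_{1≤i<k} Im(W̄_i W_{k+n-i})`. The first term integrates to zero in `y`. Modulo
`x`-derivatives of `Re(W̄_i W_j) + a_i a_j`, whose limits at `±∞` agree by skewness, `Im(W̄_i W_j)`
depends on `i + j` only; being antisymmetric it integrates to zero in `x` (`SkewHier.integral_ip`).

Convergence. `a_k` is only bounded in `x`, but `∫ a_k dy` decays. To see this, `Re(ū W_k)` is
written as `F_x + G_y` (`SkewHier.exact_rp`): the same derivation formula, applied to the phase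
rotation `δu = -iu` and to the local hierarchy starting with `-iu`, shows that `k + 1` products, all
equal modulo `x`-derivatives, add up to a `y`-derivative, and one of them is `-Re(ū W_k)`. Then `∫
(a_k + F) dy` is constant in `x` and skew, so it vanishes.

Examples. A plane in polar coordinates with moving origin stretches every transverse direction. A
one-soliton filament rotated about its axis has `W_k = (iA_k + B_k(-i/2 - tanh x)) u` and `a_k = -2
B_k sech² x`; a linear recursion read modulo `5` shows `B_k ≠ 0` for `k ≥ 2`. -/

/-- The three coordinate directions. -/
inductive Dir
  | t | x | y

section FieldCalculus

variable {F G : Type*} [NormedAddCommGroup F] [NormedSpace ℝ F]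
  [NormedAddCommGroup G] [NormedSpace ℝ G] {Ω : Set (ℝ × ℝ × ℝ)} {t x y : ℝ} {i j : Dir}

/-- The partial derivative in a coordinate direction. -/
noncomputable def pd : Dir → (ℝ → ℝ → ℝ → F) → ℝ → ℝ → ℝ → F
  | .t => dt
  | .x => dx
  | .y => dy

/-- The coordinate vector of a direction. -/
def Dir.vec : Dir → ℝ × ℝ × ℝ
  | .t => (1, 0, 0)
  | .x => (0, 1, 0)
  | .y => (0, 0, 1)

/-- `f` has the partial derivative `f'` in the direction `i`. -/
def HasPd (i : Dir) (f : ℝ → ℝ → ℝ → F) (f' : F) (t x y : ℝ) : Prop :=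
  match i with
  | .t => HasDerivAt (fun s => f s x y) f' t
  | .x => HasDerivAt (fun s => f t s y) f' x
  | .y => HasDerivAt (fun s => f t x s) f' y

theorem HasPd.pd_eq {f : ℝ → ℝ → ℝ → F} {f' : F} (h : HasPd i f f' t x y) :
    pd i f t x y = f' := by
  cases i <;> exact HasDerivAt.deriv h

theorem HasPd.of_hasFDerivAt {f : ℝ → ℝ → ℝ → F} {L : ℝ × ℝ × ℝ →L[ℝ] F}
    (h : HasFDerivAt (fun p : ℝ × ℝ × ℝ => f p.1 p.2.1 p.2.2) L (t, x, y)) :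
    HasPd i f (L i.vec) t x y := by
  cases i
  · exact h.comp_hasDerivAt (f := fun s => (s, x, y)) t
      ((hasDerivAt_id t).prodMk ((hasDerivAt_const t x).prodMk (hasDerivAt_const t y)))
  · exact h.comp_hasDerivAt (f := fun s => (t, s, y)) x
      ((hasDerivAt_const x t).prodMk ((hasDerivAt_id x).prodMk (hasDerivAt_const x y)))
  · exact h.comp_hasDerivAt (f := fun s => (t, x, s)) y
      ((hasDerivAt_const y t).prodMk ((hasDerivAt_const y x).prodMk (hasDerivAt_id y)))

theorem SmoothOn.hasFDerivAt {f : ℝ → ℝ → ℝ → F} (hf : SmoothOn Ω f) (hΩ : IsOpen Ω)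
    (hp : (t, x, y) ∈ Ω) :
    HasFDerivAt (fun p : ℝ × ℝ × ℝ => f p.1 p.2.1 p.2.2)
      (fderiv ℝ (fun p : ℝ × ℝ × ℝ => f p.1 p.2.1 p.2.2) (t, x, y)) (t, x, y) :=
  ((ContDiffOn.contDiffAt hf (hΩ.mem_nhds hp)).differentiableAt (by simp)).hasFDerivAt

theorem SmoothOn.pd_eq {f : ℝ → ℝ → ℝ → F} (hf : SmoothOn Ω f) (hΩ : IsOpen Ω)
    (hp : (t, x, y) ∈ Ω) (i : Dir) :
    pd i f t x y = fderiv ℝ (fun p : ℝ × ℝ × ℝ => f p.1 p.2.1 p.2.2) (t, x, y) i.vec :=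
  (HasPd.of_hasFDerivAt (hf.hasFDerivAt hΩ hp)).pd_eq

theorem SmoothOn.hasPd {f : ℝ → ℝ → ℝ → F} (hf : SmoothOn Ω f) (hΩ : IsOpen Ω)
    (hp : (t, x, y) ∈ Ω) (i : Dir) : HasPd i f (pd i f t x y) t x y := by
  rw [hf.pd_eq hΩ hp]
  exact HasPd.of_hasFDerivAt (hf.hasFDerivAt hΩ hp)

theorem SmoothOn.congr {f g : ℝ → ℝ → ℝ → F} (hf : SmoothOn Ω f)
    (h : ∀ t x y, (t, x, y) ∈ Ω → g t x y = f t x y) : SmoothOn Ω g :=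
  ContDiffOn.congr hf fun p hp => h p.1 p.2.1 p.2.2 hp

theorem SmoothOn.pd {f : ℝ → ℝ → ℝ → F} (hf : SmoothOn Ω f) (hΩ : IsOpen Ω) (i : Dir) :
    SmoothOn Ω (SurfaceFlow.pd i f) := by
  have h : ContDiffOn ℝ ∞
      (fun p => fderiv ℝ (fun p : ℝ × ℝ × ℝ => f p.1 p.2.1 p.2.2) p i.vec) Ω :=
    (ContDiffOn.fderiv_of_isOpen hf hΩ (m := ∞) (by simp)).clm_apply contDiffOn_const
  exact ContDiffOn.congr h fun p hp => hf.pd_eq hΩ (t := p.1) (x := p.2.1) (y := p.2.2) hp i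

/-- Openness keeps a short piece of each coordinate line inside `Ω`, so identities known only on `Ω`
may be differentiated. -/
theorem pd_congr {f g : ℝ → ℝ → ℝ → F} (hΩ : IsOpen Ω)
    (h : ∀ t x y, (t, x, y) ∈ Ω → f t x y = g t x y) (hp : (t, x, y) ∈ Ω) (i : Dir) :
    pd i f t x y = pd i g t x y := by
  have hc : ∀ c : ℝ → ℝ × ℝ × ℝ, Continuous c → ∀ s, c s ∈ Ω →
      (fun s => f (c s).1 (c s).2.1 (c s).2.2) =ᶠ[𝓝 s]
        fun s => g (c s).1 (c s).2.1 (c s).2.2 := fun c hc s hs => by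
    filter_upwards [hc.continuousAt.preimage_mem_nhds (hΩ.mem_nhds hs)] with s' hs'
    exact h _ _ _ hs'
  cases i
  · exact (hc (fun s => (s, x, y)) (by fun_prop) t hp).deriv_eq
  · exact (hc (fun s => (t, s, y)) (by fun_prop) x hp).deriv_eq
  · exact (hc (fun s => (t, x, s)) (by fun_prop) y hp).deriv_eq

/-- Both sides are values of the second Fréchet derivative on a pair of coordinate vectors, and that
derivative is symmetric. All compatibility conditions below come from this. -/
theorem SmoothOn.pd_comm {f : ℝ → ℝ → ℝ → F} (hf : SmoothOn Ω f) (hΩ : IsOpen Ω)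
    (hp : (t, x, y) ∈ Ω) (i j : Dir) :
    SurfaceFlow.pd i (SurfaceFlow.pd j f) t x y = SurfaceFlow.pd j (SurfaceFlow.pd i f) t x y := by
  set g : ℝ × ℝ × ℝ → F := fun p => f p.1 p.2.1 p.2.2 with hg
  have hcd : ContDiffAt ℝ ∞ g (t, x, y) := ContDiffOn.contDiffAt hf (hΩ.mem_nhds hp)
  have hd : DifferentiableAt ℝ (fderiv ℝ g) (t, x, y) :=
    (hcd.fderiv_right (m := 1) (by norm_cast)).differentiableAt (by simp)
  have key : ∀ i j : Dir, SurfaceFlow.pd i (SurfaceFlow.pd j f) t x y =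
      fderiv ℝ (fderiv ℝ g) (t, x, y) i.vec j.vec := fun i j => by
    rw [(hf.pd hΩ j).pd_eq hΩ hp i]
    have : (fun p : ℝ × ℝ × ℝ => SurfaceFlow.pd j f p.1 p.2.1 p.2.2) =ᶠ[𝓝 (t, x, y)]
        fun p => fderiv ℝ g p j.vec := by
      filter_upwards [hΩ.mem_nhds hp] with p hp'
      exact hf.pd_eq hΩ (t := p.1) (x := p.2.1) (y := p.2.2) hp' j
    rw [this.fderiv_eq, fderiv_clm_apply hd (differentiableAt_const _)]
    simp
  rw [key, key]
  exact (hcd.isSymmSndFDerivAt (by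
    simpa using WithTop.coe_le_coe.2 (le_top (a := (2 : ℕ∞))))).eq _ _

/-! #### Rules for smoothness and partial derivatives -/

theorem SmoothOn.const (c : F) : SmoothOn Ω (fun _ _ _ => c) := contDiffOn_const

theorem SmoothOn.add {f g : ℝ → ℝ → ℝ → F} (hf : SmoothOn Ω f) (hg : SmoothOn Ω g) :
    SmoothOn Ω (fun t x y => f t x y + g t x y) := ContDiffOn.add hf hg

theorem SmoothOn.sub {f g : ℝ → ℝ → ℝ → F} (hf : SmoothOn Ω f) (hg : SmoothOn Ω g) :
    SmoothOn Ω (fun t x y => f t x y - g t x y) := ContDiffOn.sub hf hg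

theorem SmoothOn.neg {f : ℝ → ℝ → ℝ → F} (hf : SmoothOn Ω f) :
    SmoothOn Ω (fun t x y => - f t x y) := ContDiffOn.neg hf

theorem SmoothOn.mul {𝔸 : Type*} [NormedRing 𝔸] [NormedAlgebra ℝ 𝔸] {f g : ℝ → ℝ → ℝ → 𝔸}
    (hf : SmoothOn Ω f) (hg : SmoothOn Ω g) :
    SmoothOn Ω (fun t x y => f t x y * g t x y) := ContDiffOn.mul hf hg

theorem SmoothOn.smul {f : ℝ → ℝ → ℝ → ℝ} {g : ℝ → ℝ → ℝ → F}
    (hf : SmoothOn Ω f) (hg : SmoothOn Ω g) :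
    SmoothOn Ω (fun t x y => f t x y • g t x y) := ContDiffOn.smul hf hg

theorem SmoothOn.inner {f g : ℝ → ℝ → ℝ → E3} (hf : SmoothOn Ω f) (hg : SmoothOn Ω g) :
    SmoothOn Ω (fun t x y => inner ℝ (f t x y) (g t x y)) := ContDiffOn.inner ℝ hf hg

theorem SmoothOn.inv {f : ℝ → ℝ → ℝ → ℝ} (hf : SmoothOn Ω f)
    (h0 : ∀ t x y, (t, x, y) ∈ Ω → f t x y ≠ 0) :
    SmoothOn Ω (fun t x y => (f t x y)⁻¹) :=
  ContDiffOn.inv hf fun p hp => h0 p.1 p.2.1 p.2.2 hp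

theorem SmoothOn.clm {f : ℝ → ℝ → ℝ → F} (hf : SmoothOn Ω f) (L : F →L[ℝ] G) :
    SmoothOn Ω (fun t x y => L (f t x y)) := L.contDiff.comp_contDiffOn hf

theorem SmoothOn.ofReal {f : ℝ → ℝ → ℝ → ℝ} (hf : SmoothOn Ω f) :
    SmoothOn Ω (fun t x y => (f t x y : ℂ)) := hf.clm Complex.ofRealCLM

theorem SmoothOn.conj {f : ℝ → ℝ → ℝ → ℂ} (hf : SmoothOn Ω f) :
    SmoothOn Ω (fun t x y => (starRingEnd ℂ) (f t x y)) :=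
  hf.clm (Complex.conjCLE : ℂ →L[ℝ] ℂ)

theorem SmoothOn.re {f : ℝ → ℝ → ℝ → ℂ} (hf : SmoothOn Ω f) :
    SmoothOn Ω (fun t x y => (f t x y).re) := hf.clm Complex.reCLM

theorem SmoothOn.cexp {f : ℝ → ℝ → ℝ → ℂ} (hf : SmoothOn Ω f) :
    SmoothOn Ω (fun t x y => Complex.exp (f t x y)) := ContDiffOn.cexp hf

theorem HasPd.const (c : F) : HasPd i (fun _ _ _ => c) 0 t x y := by
  cases i <;> exact hasDerivAt_const _ _

theorem HasPd.add {f g : ℝ → ℝ → ℝ → F} {f' g' : F} (hf : HasPd i f f' t x y)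
    (hg : HasPd i g g' t x y) :
    HasPd i (fun t x y => f t x y + g t x y) (f' + g') t x y := by
  cases i <;> exact HasDerivAt.add hf hg

theorem HasPd.sub {f g : ℝ → ℝ → ℝ → F} {f' g' : F} (hf : HasPd i f f' t x y)
    (hg : HasPd i g g' t x y) :
    HasPd i (fun t x y => f t x y - g t x y) (f' - g') t x y := by
  cases i <;> exact HasDerivAt.sub hf hg

theorem HasPd.neg {f : ℝ → ℝ → ℝ → F} {f' : F} (hf : HasPd i f f' t x y) :
    HasPd i (fun t x y => - f t x y) (- f') t x y := by
  cases i <;> exact HasDerivAt.neg hf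

theorem HasPd.mul {𝔸 : Type*} [NormedRing 𝔸] [NormedAlgebra ℝ 𝔸] {f g : ℝ → ℝ → ℝ → 𝔸}
    {f' g' : 𝔸} (hf : HasPd i f f' t x y) (hg : HasPd i g g' t x y) :
    HasPd i (fun t x y => f t x y * g t x y) (f' * g t x y + f t x y * g') t x y := by
  cases i <;> exact HasDerivAt.mul hf hg

theorem HasPd.smul {f : ℝ → ℝ → ℝ → ℝ} {g : ℝ → ℝ → ℝ → F} {f' : ℝ} {g' : F}
    (hf : HasPd i f f' t x y) (hg : HasPd i g g' t x y) :
    HasPd i (fun t x y => f t x y • g t x y) (f t x y • g' + f' • g t x y) t x y := by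
  cases i <;> exact HasDerivAt.smul hf hg

theorem HasPd.inner {f g : ℝ → ℝ → ℝ → E3} {f' g' : E3} (hf : HasPd i f f' t x y)
    (hg : HasPd i g g' t x y) :
    HasPd i (fun t x y => inner ℝ (f t x y) (g t x y))
      (inner ℝ (f t x y) g' + inner ℝ f' (g t x y)) t x y := by
  cases i <;> exact HasDerivAt.inner ℝ hf hg

theorem HasPd.clm {f : ℝ → ℝ → ℝ → F} {f' : F} (hf : HasPd i f f' t x y) (L : F →L[ℝ] G) :
    HasPd i (fun t x y => L (f t x y)) (L f') t x y := by
  cases i <;> exact L.hasFDerivAt.comp_hasDerivAt _ hf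

theorem HasPd.ofReal {f : ℝ → ℝ → ℝ → ℝ} {f' : ℝ} (hf : HasPd i f f' t x y) :
    HasPd i (fun t x y => (f t x y : ℂ)) (f' : ℂ) t x y := hf.clm Complex.ofRealCLM

theorem HasPd.conj {f : ℝ → ℝ → ℝ → ℂ} {f' : ℂ} (hf : HasPd i f f' t x y) :
    HasPd i (fun t x y => (starRingEnd ℂ) (f t x y)) ((starRingEnd ℂ) f') t x y :=
  hf.clm (Complex.conjCLE : ℂ →L[ℝ] ℂ)

theorem HasPd.re {f : ℝ → ℝ → ℝ → ℂ} {f' : ℂ} (hf : HasPd i f f' t x y) :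
    HasPd i (fun t x y => (f t x y).re) f'.re t x y := hf.clm Complex.reCLM

theorem HasPd.im {f : ℝ → ℝ → ℝ → ℂ} {f' : ℂ} (hf : HasPd i f f' t x y) :
    HasPd i (fun t x y => (f t x y).im) f'.im t x y := hf.clm Complex.imCLM

theorem HasPd.cexp {f : ℝ → ℝ → ℝ → ℂ} {f' : ℂ} (hf : HasPd i f f' t x y) :
    HasPd i (fun t x y => Complex.exp (f t x y)) (Complex.exp (f t x y) * f') t x y := by
  cases i <;> exact HasDerivAt.cexp hf

theorem HasPd.sum {ι : Type*} {s : Finset ι} {f : ι → ℝ → ℝ → ℝ → F} {f' : ι → F}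
    (hf : ∀ k ∈ s, HasPd i (f k) (f' k) t x y) :
    HasPd i (fun t x y => ∑ k ∈ s, f k t x y) (∑ k ∈ s, f' k) t x y := by
  cases i <;> exact HasDerivAt.fun_sum hf

end FieldCalculus

end SurfaceFlow

namespace SurfaceFlow

/-! ### The adapted frame -/

theorem inner_E3 (v w : E3) : inner ℝ v w = v 0 * w 0 + v 1 * w 1 + v 2 * w 2 := by
  simp only [PiLp.inner_apply, Fin.sum_univ_three, RCLike.inner_apply, conj_trivial]
  ring

theorem inner_cross_left (v w : E3) : inner ℝ (cross v w) v = 0 := by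
  simp [inner_E3, cross]; ring

theorem inner_cross_right (v w : E3) : inner ℝ (cross v w) w = 0 := by
  simp [inner_E3, cross]; ring

theorem inner_cross_cross (v w : E3) :
    inner ℝ (cross v w) (cross v w) =
      inner ℝ v v * inner ℝ w w - inner ℝ v w * inner ℝ v w := by
  simp only [inner_E3]
  simp [cross]; ring

theorem cross_cross_self (v w : E3) :
    cross (cross v w) v = inner ℝ v v • w - inner ℝ v w • v := by
  simp only [inner_E3]
  ext i
  fin_cases i <;> simp [cross] <;> ring

theorem cross_smul_left (c : ℝ) (v w : E3) : cross (c • v) w = c • cross v w := by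
  ext i
  fin_cases i <;> simp [cross] <;> ring

/-- The expansion of inner products in an orthonormal frame. -/
theorem inner_eq_of_frame {e s n : E3} (hee : inner ℝ e e = 1) (hss : inner ℝ s s = 1)
    (hnn : inner ℝ n n = 1) (hes : inner ℝ e s = 0) (hen : inner ℝ e n = 0)
    (hsn : inner ℝ s n = 0) (v w : E3) :
    inner ℝ v w = inner ℝ e v * inner ℝ e w + inner ℝ s v * inner ℝ s w
      + inner ℝ n v * inner ℝ n w := by
  have hse : inner ℝ s e = 0 := by rw [real_inner_comm]; exact hes
  have hne : inner ℝ n e = 0 := by rw [real_inner_comm]; exact hen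
  have hns : inner ℝ n s = 0 := by rw [real_inner_comm]; exact hsn
  have hu : ∀ {v : E3}, inner ℝ v v = 1 → ‖v‖ = 1 := fun {v} hv => by
    rw [@norm_eq_sqrt_real_inner, hv, Real.sqrt_one]
  have ho : Orthonormal ℝ ![e, s, n] := by
    rw [orthonormal_iff_ite]
    intro i j
    fin_cases i <;> fin_cases j <;>
      simp [hes, hen, hsn, hse, hne, hns, hu hee, hu hss, hu hnn]
  have hsp : ⊤ ≤ Submodule.span ℝ (Set.range ![e, s, n]) := by
    rw [ho.linearIndependent.span_eq_top_of_card_eq_finrank' (by simp)]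
  have h := (OrthonormalBasis.mk ho hsp).sum_inner_mul_inner v w
  rw [← h]
  simp only [OrthonormalBasis.coe_mk, Fin.sum_univ_three]
  simp [real_inner_comm]

theorem SmoothOn.cross {Ω : Set (ℝ × ℝ × ℝ)} {f g : ℝ → ℝ → ℝ → E3} (hf : SmoothOn Ω f)
    (hg : SmoothOn Ω g) : SmoothOn Ω (fun t x y => cross (f t x y) (g t x y)) := by
  have hf' := contDiffOn_euclidean.1 hf
  have hg' := contDiffOn_euclidean.1 hg
  refine contDiffOn_euclidean.2 fun i => ?_
  fin_cases i <;> simp only [SurfaceFlow.cross] <;>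
    exact ((hf' _).mul (hg' _)).sub ((hf' _).mul (hg' _))

variable {Ω : Set (ℝ × ℝ × ℝ)} {r : ℝ → ℝ → ℝ → E3} {t x y : ℝ}

/-- The components of the derivative of the frame in the direction `i`. -/
noncomputable def frA (i : Dir) (r : ℝ → ℝ → ℝ → E3) : ℝ → ℝ → ℝ → ℝ :=
  fun t x y => inner ℝ (eStar r t x y) (pd i (eTan r) t x y)

noncomputable def frB (i : Dir) (r : ℝ → ℝ → ℝ → E3) : ℝ → ℝ → ℝ → ℝ :=
  fun t x y => inner ℝ (eNor r t x y) (pd i (eTan r) t x y)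

noncomputable def frG (i : Dir) (r : ℝ → ℝ → ℝ → E3) : ℝ → ℝ → ℝ → ℝ :=
  fun t x y => inner ℝ (eNor r t x y) (pd i (eStar r) t x y)

namespace IsSurface

theorem smooth_eTan (hS : IsSurface Ω r) : SmoothOn Ω (eTan r) := hS.smooth.pd hS.isOpen .x

theorem smooth_nrm (hS : IsSurface Ω r) : SmoothOn Ω (nrm r) :=
  (hS.smooth.pd hS.isOpen .x).cross (hS.smooth.pd hS.isOpen .y)

theorem smooth_area (hS : IsSurface Ω r) : SmoothOn Ω (area r) :=
  ContDiffOn.norm ℝ hS.smooth_nrm fun p hp => hS.regular p.1 p.2.1 p.2.2 hp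

theorem area_pos (hS : IsSurface Ω r) (hp : (t, x, y) ∈ Ω) : 0 < area r t x y :=
  norm_pos_iff.2 (hS.regular t x y hp)

theorem smooth_inv_area (hS : IsSurface Ω r) : SmoothOn Ω (fun t x y => (area r t x y)⁻¹) :=
  hS.smooth_area.inv fun _ _ _ hp => (hS.area_pos hp).ne'

theorem smooth_eNor (hS : IsSurface Ω r) : SmoothOn Ω (eNor r) :=
  hS.smooth_inv_area.smul hS.smooth_nrm

theorem smooth_eStar (hS : IsSurface Ω r) : SmoothOn Ω (eStar r) :=
  hS.smooth_eNor.cross hS.smooth_eTan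

theorem smooth_q1 (hS : IsSurface Ω r) : SmoothOn Ω (q1 r) :=
  (hS.smooth.pd hS.isOpen .x).inner (hS.smooth.pd hS.isOpen .y)

theorem smooth_frA (hS : IsSurface Ω r) (i : Dir) : SmoothOn Ω (frA i r) :=
  hS.smooth_eStar.inner (hS.smooth_eTan.pd hS.isOpen i)

theorem smooth_frB (hS : IsSurface Ω r) (i : Dir) : SmoothOn Ω (frB i r) :=
  hS.smooth_eNor.inner (hS.smooth_eTan.pd hS.isOpen i)

theorem smooth_frG (hS : IsSurface Ω r) (i : Dir) : SmoothOn Ω (frG i r) :=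
  hS.smooth_eNor.inner (hS.smooth_eStar.pd hS.isOpen i)

/-! ### Orthonormality of the frame and the components of its derivatives. -/

theorem inner_tan_tan (hS : IsSurface Ω r) (hp : (t, x, y) ∈ Ω) :
    inner ℝ (eTan r t x y) (eTan r t x y) = 1 := by
  rw [real_inner_self_eq_norm_sq, eTan, hS.unit t x y hp, one_pow]

theorem inner_nor_nor (hS : IsSurface Ω r) (hp : (t, x, y) ∈ Ω) :
    inner ℝ (eNor r t x y) (eNor r t x y) = 1 := by
  have h := (hS.area_pos hp).ne'
  rw [eNor, real_inner_smul_left, real_inner_smul_right, real_inner_self_eq_norm_sq]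
  change (area r t x y)⁻¹ * ((area r t x y)⁻¹ * area r t x y ^ 2) = 1
  field_simp

theorem inner_tan_nor (t x y : ℝ) : inner ℝ (eTan r t x y) (eNor r t x y) = 0 := by
  rw [eNor, real_inner_smul_right, real_inner_comm, nrm, eTan, inner_cross_left, mul_zero]

theorem inner_tan_star (t x y : ℝ) : inner ℝ (eTan r t x y) (eStar r t x y) = 0 := by
  rw [real_inner_comm, eStar, inner_cross_right]

theorem inner_star_nor (t x y : ℝ) : inner ℝ (eStar r t x y) (eNor r t x y) = 0 := by
  rw [eStar, inner_cross_left]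

theorem inner_star_star (hS : IsSurface Ω r) (hp : (t, x, y) ∈ Ω) :
    inner ℝ (eStar r t x y) (eStar r t x y) = 1 := by
  rw [eStar, inner_cross_cross, hS.inner_tan_tan hp, hS.inner_nor_nor hp, real_inner_comm,
    inner_tan_nor]
  norm_num

/-- The area factors cancel in `area • *e∥ = (r_x ∧ r_y) ∧ r_x`, and the double cross product equals
`r_y - (r_x · r_y) r_x` because `|r_x| = 1`. -/
theorem dy_eq (hS : IsSurface Ω r) (hp : (t, x, y) ∈ Ω) :
    dy r t x y = q1 r t x y • eTan r t x y + area r t x y • eStar r t x y := by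
  have h := (hS.area_pos hp).ne'
  have h1 := hS.inner_tan_tan hp
  rw [eTan] at h1
  rw [eStar, eNor, cross_smul_left, smul_smul, mul_inv_cancel₀ h, one_smul, nrm, eTan,
    cross_cross_self, h1, one_smul, q1]
  abel

theorem inner_eq (hS : IsSurface Ω r) (hp : (t, x, y) ∈ Ω) (v w : E3) :
    inner ℝ v w = inner ℝ (eTan r t x y) v * inner ℝ (eTan r t x y) w
      + inner ℝ (eStar r t x y) v * inner ℝ (eStar r t x y) w
      + inner ℝ (eNor r t x y) v * inner ℝ (eNor r t x y) w :=
  inner_eq_of_frame (hS.inner_tan_tan hp) (hS.inner_star_star hp) (hS.inner_nor_nor hp)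
    (inner_tan_star t x y) (inner_tan_nor t x y) (inner_star_nor t x y) v w

/-- Differentiation of a constant inner product. -/
theorem inner_pd_eq {f g : ℝ → ℝ → ℝ → E3} {c : ℝ} (hS : IsSurface Ω r) (hf : SmoothOn Ω f)
    (hg : SmoothOn Ω g) (h : ∀ t x y, (t, x, y) ∈ Ω → inner ℝ (f t x y) (g t x y) = c)
    (hp : (t, x, y) ∈ Ω) (i : Dir) :
    inner ℝ (f t x y) (pd i g t x y) = - inner ℝ (g t x y) (pd i f t x y) := by
  have h1 := ((hf.hasPd hS.isOpen hp i).inner (hg.hasPd hS.isOpen hp i)).pd_eq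
  rw [pd_congr hS.isOpen h hp i, (HasPd.const c).pd_eq, real_inner_comm (g t x y)] at h1
  linarith

theorem inner_tan_pd_tan (hS : IsSurface Ω r) (hp : (t, x, y) ∈ Ω) (i : Dir) :
    inner ℝ (eTan r t x y) (pd i (eTan r) t x y) = 0 := by
  have := hS.inner_pd_eq hS.smooth_eTan hS.smooth_eTan (fun _ _ _ => hS.inner_tan_tan) hp i
  linarith

theorem inner_star_pd_star (hS : IsSurface Ω r) (hp : (t, x, y) ∈ Ω) (i : Dir) :
    inner ℝ (eStar r t x y) (pd i (eStar r) t x y) = 0 := by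
  have := hS.inner_pd_eq hS.smooth_eStar hS.smooth_eStar (fun _ _ _ => hS.inner_star_star) hp i
  linarith

theorem inner_nor_pd_nor (hS : IsSurface Ω r) (hp : (t, x, y) ∈ Ω) (i : Dir) :
    inner ℝ (eNor r t x y) (pd i (eNor r) t x y) = 0 := by
  have := hS.inner_pd_eq hS.smooth_eNor hS.smooth_eNor (fun _ _ _ => hS.inner_nor_nor) hp i
  linarith

theorem inner_tan_pd_star (hS : IsSurface Ω r) (hp : (t, x, y) ∈ Ω) (i : Dir) :
    inner ℝ (eTan r t x y) (pd i (eStar r) t x y) = - frA i r t x y :=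
  hS.inner_pd_eq hS.smooth_eTan hS.smooth_eStar (fun _ _ _ _ => inner_tan_star _ _ _) hp i

theorem inner_tan_pd_nor (hS : IsSurface Ω r) (hp : (t, x, y) ∈ Ω) (i : Dir) :
    inner ℝ (eTan r t x y) (pd i (eNor r) t x y) = - frB i r t x y :=
  hS.inner_pd_eq hS.smooth_eTan hS.smooth_eNor (fun _ _ _ _ => inner_tan_nor _ _ _) hp i

theorem inner_star_pd_nor (hS : IsSurface Ω r) (hp : (t, x, y) ∈ Ω) (i : Dir) :
    inner ℝ (eStar r t x y) (pd i (eNor r) t x y) = - frG i r t x y :=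
  hS.inner_pd_eq hS.smooth_eStar hS.smooth_eNor (fun _ _ _ _ => inner_star_nor _ _ _) hp i

/-! #### Structure equations of the frame -/

theorem pd_frA (hS : IsSurface Ω r) (hp : (t, x, y) ∈ Ω) (i j : Dir) :
    pd j (frA i r) t x y =
      inner ℝ (eStar r t x y) (pd j (pd i (eTan r)) t x y) + frG j r t x y * frB i r t x y := by
  rw [show pd j (frA i r) t x y = _ from ((hS.smooth_eStar.hasPd hS.isOpen hp j).inner
    ((hS.smooth_eTan.pd hS.isOpen i).hasPd hS.isOpen hp j)).pd_eq,
    hS.inner_eq hp (pd j (eStar r) t x y), hS.inner_tan_pd_tan hp, hS.inner_star_pd_star hp]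
  rw [frG, frB]; ring

/-- The second derivatives of `e∥` are symmetric in `i` and `j` and cancel; what is left comes from
the motion of `*e∥`. -/
theorem pd_frA_sub (hS : IsSurface Ω r) (hp : (t, x, y) ∈ Ω) (i j : Dir) :
    pd j (frA i r) t x y - pd i (frA j r) t x y =
      frG j r t x y * frB i r t x y - frG i r t x y * frB j r t x y := by
  rw [hS.pd_frA hp, hS.pd_frA hp, hS.smooth_eTan.pd_comm hS.isOpen hp i j]
  ring

theorem pd_frB (hS : IsSurface Ω r) (hp : (t, x, y) ∈ Ω) (i j : Dir) :
    pd j (frB i r) t x y =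
      inner ℝ (eNor r t x y) (pd j (pd i (eTan r)) t x y) - frG j r t x y * frA i r t x y := by
  rw [show pd j (frB i r) t x y = _ from ((hS.smooth_eNor.hasPd hS.isOpen hp j).inner
    ((hS.smooth_eTan.pd hS.isOpen i).hasPd hS.isOpen hp j)).pd_eq,
    hS.inner_eq hp (pd j (eNor r) t x y), hS.inner_tan_pd_tan hp, hS.inner_star_pd_nor hp,
    hS.inner_nor_pd_nor hp]
  rw [frA]; ring

theorem pd_frB_sub (hS : IsSurface Ω r) (hp : (t, x, y) ∈ Ω) (i j : Dir) :
    pd j (frB i r) t x y - pd i (frB j r) t x y =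
      frG i r t x y * frA j r t x y - frG j r t x y * frA i r t x y := by
  rw [hS.pd_frB hp, hS.pd_frB hp, hS.smooth_eTan.pd_comm hS.isOpen hp i j]
  ring

theorem pd_frG_sub (hS : IsSurface Ω r) (hp : (t, x, y) ∈ Ω) (i j : Dir) :
    pd j (frG i r) t x y - pd i (frG j r) t x y =
      frA i r t x y * frB j r t x y - frA j r t x y * frB i r t x y := by
  have h : ∀ i j : Dir, pd j (frG i r) t x y =
      inner ℝ (eNor r t x y) (pd j (pd i (eStar r)) t x y) + frB j r t x y * frA i r t x y :=
    fun i j => by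
      rw [show pd j (frG i r) t x y = _ from ((hS.smooth_eNor.hasPd hS.isOpen hp j).inner
        ((hS.smooth_eStar.pd hS.isOpen i).hasPd hS.isOpen hp j)).pd_eq,
        hS.inner_eq hp (pd j (eNor r) t x y), hS.inner_tan_pd_nor hp, hS.inner_tan_pd_star hp,
        hS.inner_star_pd_star hp, hS.inner_nor_pd_nor hp]
      ring
  rw [h, h, hS.smooth_eStar.pd_comm hS.isOpen hp i j]
  ring

/-! ### Derivatives of `r_y` and the extrinsic curvature scalars. -/

theorem hasPd_dy (hS : IsSurface Ω r) (hp : (t, x, y) ∈ Ω) (i : Dir) :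
    pd i (dy r) t x y =
      (q1 r t x y • pd i (eTan r) t x y + pd i (q1 r) t x y • eTan r t x y) +
      (area r t x y • pd i (eStar r) t x y + pd i (area r) t x y • eStar r t x y) := by
  rw [pd_congr hS.isOpen (fun _ _ _ => hS.dy_eq) hp i]
  exact (((hS.smooth_q1.hasPd hS.isOpen hp i).smul (hS.smooth_eTan.hasPd hS.isOpen hp i)).add
    ((hS.smooth_area.hasPd hS.isOpen hp i).smul (hS.smooth_eStar.hasPd hS.isOpen hp i))).pd_eq

theorem inner_tan_pd_dy (hS : IsSurface Ω r) (hp : (t, x, y) ∈ Ω) (i : Dir) :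
    inner ℝ (eTan r t x y) (pd i (dy r) t x y) =
      pd i (q1 r) t x y - area r t x y * frA i r t x y := by
  rw [hS.hasPd_dy hp]
  simp only [inner_add_right, real_inner_smul_right]
  rw [hS.inner_tan_pd_tan hp, hS.inner_tan_tan hp, hS.inner_tan_pd_star hp, inner_tan_star]
  ring

theorem inner_star_pd_dy (hS : IsSurface Ω r) (hp : (t, x, y) ∈ Ω) (i : Dir) :
    inner ℝ (eStar r t x y) (pd i (dy r) t x y) =
      q1 r t x y * frA i r t x y + pd i (area r) t x y := by
  rw [hS.hasPd_dy hp]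
  simp only [inner_add_right, real_inner_smul_right]
  rw [real_inner_comm (eTan r t x y), inner_tan_star, hS.inner_star_pd_star hp,
    hS.inner_star_star hp, frA]
  ring

theorem inner_nor_pd_dy (hS : IsSurface Ω r) (hp : (t, x, y) ∈ Ω) (i : Dir) :
    inner ℝ (eNor r t x y) (pd i (dy r) t x y) =
      q1 r t x y * frB i r t x y + area r t x y * frG i r t x y := by
  rw [hS.hasPd_dy hp]
  simp only [inner_add_right, real_inner_smul_right]
  rw [real_inner_comm (eTan r t x y), inner_tan_nor, real_inner_comm (eStar r t x y),
    inner_star_nor, frB, frG]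
  ring

theorem dx_dy (hS : IsSurface Ω r) (hp : (t, x, y) ∈ Ω) :
    pd .x (dy r) t x y = pd .y (eTan r) t x y := hS.smooth.pd_comm hS.isOpen hp .x .y

/-- The vector `r_xy = (e∥)_y` is orthogonal to `e∥`, so the tangential component of the
`x`-derivative of `r_y = q₁ e∥ + |r_x ∧ r_y| *e∥` vanishes. The other two components give `mu_eq`
and `rho_eq`. -/
theorem dx_q1 (hS : IsSurface Ω r) (hp : (t, x, y) ∈ Ω) :
    dx (q1 r) t x y = area r t x y * alpha r t x y := by
  have h := hS.inner_tan_pd_dy hp .x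
  rw [hS.dx_dy hp, hS.inner_tan_pd_tan hp] at h
  change 0 = dx (q1 r) t x y - area r t x y * alpha r t x y at h
  linarith

theorem mu_eq (hS : IsSurface Ω r) (hp : (t, x, y) ∈ Ω) :
    mu r t x y = q1 r t x y * alpha r t x y + dx (area r) t x y := by
  have h := hS.inner_star_pd_dy hp .x
  rw [hS.dx_dy hp] at h
  exact h

theorem rho_eq (hS : IsSurface Ω r) (hp : (t, x, y) ∈ Ω) :
    rho r t x y = q1 r t x y * beta r t x y + area r t x y * gam r t x y := by
  have h := hS.inner_nor_pd_dy hp .x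
  rw [hS.dx_dy hp] at h
  exact h

theorem k11_eq (hS : IsSurface Ω r) (hp : (t, x, y) ∈ Ω) :
    k11 r t x y = - beta r t x y := hS.inner_tan_pd_nor hp .x

/-- Symmetry of the second fundamental form: after `rho_eq` the terms with `q₁` cancel and only the
torsion remains. Hence `𝒟₁ = D_x + iγ`, the covariant derivative in the normal plane of the
`x`-lines. -/
theorem k12_eq (hS : IsSurface Ω r) (hp : (t, x, y) ∈ Ω) :
    k12 r t x y = - gam r t x y := by
  have h := (hS.area_pos hp).ne'
  have h1 : inner ℝ (eTan r t x y) (dx (eNor r) t x y) = - beta r t x y :=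
    hS.inner_tan_pd_nor hp .x
  have h2 : inner ℝ (eTan r t x y) (dy (eNor r) t x y) = - rho r t x y :=
    hS.inner_tan_pd_nor hp .y
  rw [k12, dStar, real_inner_smul_right, inner_sub_right, real_inner_smul_right, h1, h2,
    hS.rho_eq hp]
  field_simp
  ring

theorem k22_eq (hS : IsSurface Ω r) (hp : (t, x, y) ∈ Ω) :
    k22 r t x y = (area r t x y)⁻¹ * (q1 r t x y * gam r t x y - sigma r t x y) := by
  have h1 : inner ℝ (eStar r t x y) (dx (eNor r) t x y) = - gam r t x y :=
    hS.inner_star_pd_nor hp .x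
  have h2 : inner ℝ (eStar r t x y) (dy (eNor r) t x y) = - sigma r t x y :=
    hS.inner_star_pd_nor hp .y
  rw [k22, dStar, real_inner_smul_right, inner_sub_right, real_inner_smul_right, h1, h2]
  ring

end IsSurface

end SurfaceFlow

namespace SurfaceFlow

variable {Ω : Set (ℝ × ℝ × ℝ)} {r : ℝ → ℝ → ℝ → E3} {a : ℕ → ℝ → ℝ → ℝ → ℝ} {t x y : ℝ}
  {n k : ℕ}

/-! ### The hierarchy on a surface -/

/-- The complex combination `α + iβ` for the direction `i`. -/
noncomputable def frK (i : Dir) (r : ℝ → ℝ → ℝ → E3) : ℝ → ℝ → ℝ → ℂ :=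
  fun t x y => (frA i r t x y : ℂ) + Complex.I * (frB i r t x y : ℂ)

theorem frK_re (i : Dir) : (frK i r t x y).re = frA i r t x y := by simp [frK]

theorem frK_im (i : Dir) : (frK i r t x y).im = frB i r t x y := by simp [frK]

theorem kapPerp_eq : kapPerp r t x y = - Complex.I * kap r t x y := by
  simp only [kapPerp, kap]
  linear_combination (beta r t x y : ℂ) * Complex.I_sq

theorem pairing_eq (w : ℝ → ℝ → ℝ → ℂ) :
    pairing r w t x y = ((starRingEnd ℂ) (kap r t x y) * w t x y).re := by
  simp [pairing, kap]

theorem hier_zero : hier r a 0 t x y = - Complex.I * frK .y r t x y := by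
  change (rho r t x y : ℂ) - Complex.I * (mu r t x y : ℂ) =
    - Complex.I * ((mu r t x y : ℂ) + Complex.I * (rho r t x y : ℂ))
  linear_combination (rho r t x y : ℂ) * Complex.I_sq

theorem hier_succ : hier r a (k + 1) t x y = Complex.I * dx (hier r a k) t x y
    - (gam r t x y : ℂ) * hier r a k t x y - Complex.I * kap r t x y * (a k t x y : ℂ) := by
  rw [hier, recOp, kapPerp_eq]
  push_cast
  ring

namespace IsSurface

theorem smooth_frK (hS : IsSurface Ω r) (i : Dir) : SmoothOn Ω (frK i r) :=
  (hS.smooth_frA i).ofReal.add ((SmoothOn.const _).mul (hS.smooth_frB i).ofReal)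

theorem smooth_kap (hS : IsSurface Ω r) : SmoothOn Ω (kap r) := hS.smooth_frK .x

theorem pd_frK (hS : IsSurface Ω r) (hp : (t, x, y) ∈ Ω) (i j : Dir) :
    pd j (frK i r) t x y =
      ((pd j (frA i r) t x y : ℝ) : ℂ) + Complex.I * ((pd j (frB i r) t x y : ℝ) : ℂ) := by
  rw [show pd j (frK i r) t x y = _ from
    ((((hS.smooth_frA i).hasPd hS.isOpen hp j).ofReal.add
      ((HasPd.const Complex.I).mul ((hS.smooth_frB i).hasPd hS.isOpen hp j).ofReal))).pd_eq]
  simp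

theorem pd_frK_sub (hS : IsSurface Ω r) (hp : (t, x, y) ∈ Ω) (i j : Dir) :
    pd j (frK i r) t x y - pd i (frK j r) t x y =
      - (Complex.I * frG j r t x y * frK i r t x y)
        + Complex.I * frG i r t x y * frK j r t x y := by
  rw [hS.pd_frK hp, hS.pd_frK hp]
  have h1 := congrArg (fun z : ℝ => (z : ℂ)) (hS.pd_frA_sub hp i j)
  have h2 := congrArg (fun z : ℝ => (z : ℂ)) (hS.pd_frB_sub hp i j)
  push_cast at h1 h2
  simp only [frK]
  linear_combination h1 + Complex.I * h2 +
    (frG j r t x y * frB i r t x y - frG i r t x y * frB j r t x y : ℂ) * Complex.I_sq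

theorem pd_frG_sub' (hS : IsSurface Ω r) (hp : (t, x, y) ∈ Ω) (i j : Dir) :
    pd j (frG i r) t x y - pd i (frG j r) t x y =
      ((starRingEnd ℂ) (frK i r t x y) * frK j r t x y).im := by
  rw [hS.pd_frG_sub hp]
  simp [frK]
  ring

/-- The `k`-th term involves antiderivatives of index below `k` only, so the range extends to `k =
n`, where `a n` itself need not be controlled. -/
theorem smooth_hier (hS : IsSurface Ω r) (hH : IsHierarchy Ω r a n) :
    ∀ k ≤ n, SmoothOn Ω (hier r a k) := by
  intro k
  induction k with
  | zero =>
    intro _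
    exact ((SmoothOn.const (- Complex.I)).mul (hS.smooth_frK .y)).congr fun _ _ _ _ => hier_zero
  | succ k ih =>
    intro hk
    have hw := ih (by omega)
    have ha := (hH k (by omega)).smooth.ofReal
    exact ((((SmoothOn.const Complex.I).mul (hw.pd hS.isOpen .x)).sub
      ((hS.smooth_frG .x).ofReal.mul hw)).sub
      (((SmoothOn.const Complex.I).mul hS.smooth_kap).mul ha)).congr fun _ _ _ _ => hier_succ

end IsSurface

/-- The `x`-derivative of the starting term `-i K_y` is converted into `∂_y (α + iβ)` by the `(x,y)`
structure equation. This leaves `i (σ - a₀)` times `α + iβ`, and adaptedness turns `σ - a₀` into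
`-ψ_y`. -/
theorem hier_one (hS : IsSurface Ω r) {ψ : ℝ → ℝ → ℝ → ℝ}
    (hA : IsAdapted Ω r a ψ) (hp : (t, x, y) ∈ Ω) :
    hier r a 1 t x y = dy (kap r) t x y - Complex.I * dy ψ t x y * kap r t x y := by
  have h : pd .x (hier r a 0) t x y = - Complex.I * pd .x (frK .y r) t x y := by
    rw [pd_congr hS.isOpen (fun _ _ _ _ => hier_zero) hp,
      ((HasPd.const (- Complex.I)).mul ((hS.smooth_frK .y).hasPd hS.isOpen hp .x)).pd_eq]
    ring
  have h1 := hS.pd_frK_sub hp .x .y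
  change dy (kap r) t x y - pd .x (frK .y r) t x y =
    - (Complex.I * sigma r t x y * kap r t x y) + Complex.I * gam r t x y * frK .y r t x y at h1
  change dx (hier r a 0) t x y = _ at h
  rw [hier_succ, h, hier_zero, hA t x y hp]
  push_cast
  linear_combination (-(pd .x (frK .y r) t x y)) * Complex.I_sq - h1

/-! ### Derivatives of the velocity -/

section Velocity

variable (hS : IsSurface Ω r) (hH : IsHierarchy Ω r a n) (hk : k < n)
include hS hH hk

theorem pd_velocity (hp : (t, x, y) ∈ Ω) (i : Dir) :
    pd i (velocity r a k) t x y =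
      (a k t x y • pd i (eTan r) t x y + pd i (a k) t x y • eTan r t x y) +
      (coefB r a k t x y • pd i (eStar r) t x y
        + (- (pd i (hier r a k) t x y).re) • eStar r t x y) +
      (coefC r a k t x y • pd i (eNor r) t x y
        + (- (pd i (hier r a k) t x y).im) • eNor r t x y) := by
  have hw := (hS.smooth_hier hH k hk.le).hasPd hS.isOpen hp i
  exact (((((hH k hk).smooth.hasPd hS.isOpen hp i).smul
    (hS.smooth_eTan.hasPd hS.isOpen hp i)).add
    (hw.re.neg.smul (hS.smooth_eStar.hasPd hS.isOpen hp i))).add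
    (hw.im.neg.smul (hS.smooth_eNor.hasPd hS.isOpen hp i))).pd_eq

theorem inner_tan_pd_velocity (hp : (t, x, y) ∈ Ω) (i : Dir) :
    inner ℝ (eTan r t x y) (pd i (velocity r a k) t x y) =
      pd i (a k) t x y - frA i r t x y * coefB r a k t x y
        - frB i r t x y * coefC r a k t x y := by
  rw [pd_velocity hS hH hk hp]
  simp only [inner_add_right, real_inner_smul_right]
  rw [hS.inner_tan_pd_tan hp, hS.inner_tan_tan hp, hS.inner_tan_pd_star hp,
    IsSurface.inner_tan_star, hS.inner_tan_pd_nor hp, IsSurface.inner_tan_nor]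
  ring

theorem inner_star_pd_velocity (hp : (t, x, y) ∈ Ω) (i : Dir) :
    inner ℝ (eStar r t x y) (pd i (velocity r a k) t x y) =
      - (pd i (hier r a k) t x y).re + frA i r t x y * a k t x y
        - frG i r t x y * coefC r a k t x y := by
  rw [pd_velocity hS hH hk hp]
  simp only [inner_add_right, real_inner_smul_right]
  rw [real_inner_comm (eTan r t x y), IsSurface.inner_tan_star, hS.inner_star_pd_star hp,
    hS.inner_star_star hp, hS.inner_star_pd_nor hp, IsSurface.inner_star_nor, frA]
  ring

theorem inner_nor_pd_velocity (hp : (t, x, y) ∈ Ω) (i : Dir) :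
    inner ℝ (eNor r t x y) (pd i (velocity r a k) t x y) =
      - (pd i (hier r a k) t x y).im + frB i r t x y * a k t x y
        + frG i r t x y * coefB r a k t x y := by
  rw [pd_velocity hS hH hk hp]
  simp only [inner_add_right, real_inner_smul_right]
  rw [real_inner_comm (eTan r t x y), IsSurface.inner_tan_nor, real_inner_comm (eStar r t x y),
    IsSurface.inner_star_nor, hS.inner_nor_nor hp, hS.inner_nor_pd_nor hp, frB, frG]
  ring

/-- The tangential component is `a_x - αb - βc`, and the defining equation of the antiderivative `a`
says exactly that this is zero. -/
theorem inner_tan_dx_velocity (hp : (t, x, y) ∈ Ω) :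
    inner ℝ (eTan r t x y) (dx (velocity r a k) t x y) = 0 := by
  have h := inner_tan_pd_velocity hS hH hk hp .x
  have h1 : pd .x (a k) t x y = - pairing r (hier r a k) t x y := (hH k hk).eq t x y hp
  rw [h1, pairing_eq] at h
  refine h.trans ?_
  simp [kap, coefB, coefC, frA, frB, alpha, beta, pd]

end Velocity

/-! ### Evolution under a flow -/

theorem dStar_im (w : ℝ → ℝ → ℝ → ℂ) : (D2 r w t x y).im =
    (area r t x y)⁻¹ * ((dy w t x y).im - q1 r t x y * (dx w t x y).im)
      - k22 r t x y * (w t x y).re := by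
  simp [D2, dStar]

/-- The coordinate components of the tangential part of the flow. -/
theorem IsSurface.tanX_smul_add_tanY_smul (hS : IsSurface Ω r) (k : ℕ) (hp : (t, x, y) ∈ Ω) :
    tanX r a k t x y • dx r t x y + tanY r a k t x y • dy r t x y = tangential r a k t x y := by
  have hA := (hS.area_pos hp).ne'
  rw [hS.dy_eq hp, smul_add, smul_smul, smul_smul, tanX, tanY, div_mul_cancel₀ _ hA, tangential,
    ← add_assoc, eTan, ← add_smul]
  congr 2
  ring

namespace IsFlow

variable (hF : IsFlow (n + 1) Ω r a)
include hF

theorem hierarchy_smooth (k : ℕ) (hk : k ≤ n + 1) : SmoothOn Ω (hier r a k) :=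
  hF.surface.smooth_hier hF.hierarchy k hk

theorem dt_tan (hp : (t, x, y) ∈ Ω) :
    pd .t (eTan r) t x y = dx (velocity r a n) t x y := by
  have h := hF.surface.smooth.pd_comm hF.surface.isOpen hp .t .x
  exact h.trans (pd_congr hF.surface.isOpen hF.flow hp .x)

theorem dt_dy (hp : (t, x, y) ∈ Ω) :
    pd .t (dy r) t x y = dy (velocity r a n) t x y := by
  have h := hF.surface.smooth.pd_comm hF.surface.isOpen hp .t .y
  exact h.trans (pd_congr hF.surface.isOpen hF.flow hp .y)

theorem frA_t (hp : (t, x, y) ∈ Ω) : frA .t r t x y = - (dx (hier r a n) t x y).re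
    + alpha r t x y * a n t x y - gam r t x y * coefC r a n t x y := by
  rw [frA, hF.dt_tan hp]
  exact inner_star_pd_velocity hF.surface hF.hierarchy n.lt_succ_self hp .x

theorem frB_t (hp : (t, x, y) ∈ Ω) : frB .t r t x y = - (dx (hier r a n) t x y).im
    + beta r t x y * a n t x y + gam r t x y * coefB r a n t x y := by
  rw [frB, hF.dt_tan hp]
  exact inner_nor_pd_velocity hF.surface hF.hierarchy n.lt_succ_self hp .x

theorem frK_t (hp : (t, x, y) ∈ Ω) :
    frK .t r t x y = a n t x y * kap r t x y - dx (hier r a n) t x y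
      - Complex.I * gam r t x y * hier r a n t x y := by
  apply Complex.ext
  · rw [frK_re, hF.frA_t hp]
    simp [kap, coefC]
    ring
  · rw [frK_im, hF.frB_t hp]
    simp [kap, coefB]
    ring

/-- The link between flow and hierarchy: the normal components of `V_x` form `i` times the recursion
operator applied to the term that generates `V`. So the `t`-row of the frame connection is again a
term of the hierarchy, just as the `y`-row is. -/
theorem frK_t' (hp : (t, x, y) ∈ Ω) :
    frK .t r t x y = Complex.I * hier r a (n + 1) t x y := by
  rw [hF.frK_t hp, hier_succ]
  linear_combination (a n t x y * kap r t x y - dx (hier r a n) t x y) * Complex.I_sq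

/-- The motion of `e∥` does not determine the rotation of the normal plane. It is read off from the
normal component of `(r_y)_t = V_y`, where `*e∥` enters with the nonzero factor `|r_x ∧ r_y|`. -/
theorem frG_t (hp : (t, x, y) ∈ Ω) :
    frG .t r t x y = gam r t x y * a n t x y - (D2 r (hier r a n) t x y).im := by
  have hne := (hF.surface.area_pos hp).ne'
  have h1 := hF.surface.inner_nor_pd_dy hp .t
  rw [hF.dt_dy hp] at h1
  have h2 := inner_nor_pd_velocity hF.surface hF.hierarchy n.lt_succ_self hp .y
  have h3 := hF.frB_t hp
  have h4 := h1.symm.trans h2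
  change _ = - (dy (hier r a n) t x y).im + rho r t x y * a n t x y
    + sigma r t x y * coefB r a n t x y at h4
  rw [h3, hF.surface.rho_eq hp] at h4
  rw [dStar_im, hF.surface.k22_eq hp]
  rw [coefB] at h4
  have h5 : area r t x y * frG .t r t x y = area r t x y * (gam r t x y * a n t x y
      - ((area r t x y)⁻¹ * ((dy (hier r a n) t x y).im
        - q1 r t x y * (dx (hier r a n) t x y).im)
      - (area r t x y)⁻¹ * (q1 r t x y * gam r t x y - sigma r t x y)
        * (hier r a n t x y).re)) := by
    field_simp
    linear_combination h4
  exact mul_left_cancel₀ hne h5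

theorem dt_norm_dx (hp : (t, x, y) ∈ Ω) : dt (fun t x y => ‖dx r t x y‖) t x y = 0 := by
  have h := pd_congr hF.surface.isOpen hF.surface.unit hp .t
  rw [(HasPd.const (1 : ℝ)).pd_eq] at h
  exact h

/-- The `*e∥`-component of `(r_y)_t = V_y` contains `∂_t |r_x ∧ r_y|`. The non-stretching relation
`a_x = αb + βc`, multiplied by the area density, supplies the missing part of the divergence. -/
theorem dt_area (hp : (t, x, y) ∈ Ω) :
    dt (area r) t x y = expansion r a (n + 1) t x y * area r t x y
      + (dx (fun t x y => area r t x y * tanX r a n t x y) t x y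
        + dy (fun t x y => area r t x y * tanY r a n t x y) t x y) := by
  have hS := hF.surface
  have hne := (hS.area_pos hp).ne'
  have hw := hF.hierarchy_smooth n n.le_succ
  have ha := (hF.hierarchy n n.lt_succ_self).smooth
  -- Multiplied by the area density the coordinate components lose their denominators: the two
  -- fluxes are `area * a - b q₁` and `b`.
  have hX : dx (fun t x y => area r t x y * tanX r a n t x y) t x y =
      pd .x (area r) t x y * a n t x y + area r t x y * pd .x (a n) t x y
        - (- (pd .x (hier r a n) t x y).re * q1 r t x y
          + coefB r a n t x y * pd .x (q1 r) t x y) := by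
    refine (pd_congr hS.isOpen (f := fun t x y => area r t x y * tanX r a n t x y)
      (g := fun t x y => area r t x y * a n t x y - coefB r a n t x y * q1 r t x y) (fun t x y hp => ?_) hp .x).trans ?_
    · have := (hS.area_pos hp).ne'
      rw [tanX]
      field_simp
    · exact (((hS.smooth_area.hasPd hS.isOpen hp .x).mul (ha.hasPd hS.isOpen hp .x)).sub
        ((hw.hasPd hS.isOpen hp .x).re.neg.mul (hS.smooth_q1.hasPd hS.isOpen hp .x))).pd_eq
  have hY : dy (fun t x y => area r t x y * tanY r a n t x y) t x y =
      - (pd .y (hier r a n) t x y).re := by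
    refine (pd_congr hS.isOpen (f := fun t x y => area r t x y * tanY r a n t x y)
      (g := coefB r a n) (fun t x y hp => ?_) hp .y).trans ?_
    · have := (hS.area_pos hp).ne'
      rw [tanY]
      field_simp
    · exact (hw.hasPd hS.isOpen hp .y).re.neg.pd_eq
  have h1 := hS.inner_star_pd_dy hp .t
  rw [hF.dt_dy hp] at h1
  have h2 := inner_star_pd_velocity hS hF.hierarchy n.lt_succ_self hp .y
  have h3 := hF.frA_t hp
  have h4 := h1.symm.trans h2
  have h5 := inner_tan_pd_velocity hS hF.hierarchy n.lt_succ_self hp .x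
  have h6 := inner_tan_dx_velocity hS hF.hierarchy n.lt_succ_self hp
  rw [h3] at h4
  have h7 := h6.symm.trans h5
  have h8 := hS.dx_q1 hp
  have h9 := hS.mu_eq hp
  rw [hX, hY]
  simp only [expansion, meanCurv, hS.k11_eq hp, hS.k22_eq hp, Nat.add_sub_cancel]
  change q1 r t x y * (-(dx (hier r a n) t x y).re + alpha r t x y * a n t x y
    - gam r t x y * coefC r a n t x y) + dt (area r) t x y =
    -(dy (hier r a n) t x y).re + mu r t x y * a n t x y
    - sigma r t x y * coefC r a n t x y at h4
  change 0 = dx (a n) t x y - alpha r t x y * coefB r a n t x y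
    - beta r t x y * coefC r a n t x y at h7
  change dt (area r) t x y = - (2 * ((- beta r t x y + (area r t x y)⁻¹
    * (q1 r t x y * gam r t x y - sigma r t x y)) / 2) * (hier r a n t x y).im) * area r t x y
    + (dx (area r) t x y * a n t x y + area r t x y * dx (a n) t x y
        - (- (dx (hier r a n) t x y).re * q1 r t x y
          + coefB r a n t x y * dx (q1 r) t x y) + - (dy (hier r a n) t x y).re)
  rw [h8]
  have hc : coefC r a n t x y = - (hier r a n t x y).im := rfl
  rw [h9, hc] at h4
  rw [hc] at h7
  field_simp
  linear_combination h4 + area r t x y * h7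

/-- This is the `(x,t)` structure equation for `K`, with `K_t = a(α + iβ) - 𝒟₁w` and the formula for
`G_t` inserted; the terms in `γa` cancel. -/
theorem dt_kap (hp : (t, x, y) ∈ Ω) :
    ((dt (alpha r) t x y : ℝ) : ℂ) + Complex.I * ((dt (beta r) t x y : ℝ) : ℂ) =
      dx (fun t x y => (a n t x y : ℂ) * kap r t x y) t x y
      - D1 r (D1 r (hier r a n)) t x y
      - kapPerp r t x y * ((D2 r (hier r a n) t x y).im : ℂ) := by
  have hS := hF.surface
  have hw := hF.hierarchy_smooth n n.le_succ
  have ha := (hF.hierarchy n n.lt_succ_self).smooth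
  have hD1 : ∀ t x y, (t, x, y) ∈ Ω → D1 r (hier r a n) t x y =
      dx (hier r a n) t x y + Complex.I * gam r t x y * hier r a n t x y :=
    fun t x y hp => by
      rw [D1, hS.k12_eq hp]
      push_cast
      ring
  have hsD1 : SmoothOn Ω (D1 r (hier r a n)) :=
    ((hw.pd hS.isOpen .x).add (((SmoothOn.const Complex.I).mul
      (hS.smooth_frG .x).ofReal).mul hw)).congr hD1
  have hsak : SmoothOn Ω (fun t x y => (a n t x y : ℂ) * kap r t x y) :=
    ha.ofReal.mul hS.smooth_kap
  have h1 : pd .x (frK .t r) t x y =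
      dx (fun t x y => (a n t x y : ℂ) * kap r t x y) t x y - dx (D1 r (hier r a n)) t x y := by
    rw [pd_congr hS.isOpen (g := fun t x y => (a n t x y : ℂ) * kap r t x y
      - D1 r (hier r a n) t x y) (fun t x y hp => ?_) hp]
    · exact ((hsak.hasPd hS.isOpen hp .x).sub (hsD1.hasPd hS.isOpen hp .x)).pd_eq
    · rw [hF.frK_t hp, hD1 t x y hp]
      ring
  have h2 := hS.pd_frK_sub hp .x .t
  rw [hS.pd_frK hp .x .t, h1, hF.frG_t hp, hF.frK_t hp] at h2
  change ((dt (alpha r) t x y : ℝ) : ℂ) + Complex.I * ((dt (beta r) t x y : ℝ) : ℂ) - _ =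
    - (Complex.I * ((gam r t x y * a n t x y - (D2 r (hier r a n) t x y).im : ℝ) : ℂ)
      * kap r t x y) + Complex.I * gam r t x y * _ at h2
  have h3 : D1 r (D1 r (hier r a n)) t x y =
      dx (D1 r (hier r a n)) t x y + Complex.I * gam r t x y * D1 r (hier r a n) t x y := by
    rw [D1, hS.k12_eq hp]
    push_cast
    ring
  rw [h3, hD1 t x y hp, kapPerp_eq]
  push_cast at h2
  linear_combination h2

theorem dt_psi {ψ : ℝ → ℝ → ℝ → ℝ} (hψ : IsAngle Ω r ψ) (hp : (t, x, y) ∈ Ω) :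
    dt ψ t x y = a n t x y * dx ψ t x y + (frG .t r t x y + dt ψ t x y)
      + (D2 r (hier r a n) t x y).im := by
  rw [hF.frG_t hp, hψ.eq t x y hp]
  ring

/-- The rotation rate of the parallel frame in time is itself the required antiderivative: by `γ =
-ψ_x` its `x`-derivative is the `(x,t)` curvature term, equal to `-Im(K̄_x K_t)`, and `K_t` is `i`
times the next term of the hierarchy. -/
theorem antideriv_rotation {ψ : ℝ → ℝ → ℝ → ℝ} (hψ : IsAngle Ω r ψ) :
    IsAntiderivX Ω (fun t x y => frG .t r t x y + dt ψ t x y)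
      (fun t x y => - pairing r (hier r a (n + 1)) t x y) := by
  have hS := hF.surface
  refine ⟨(hS.smooth_frG .t).add (hψ.smooth.pd hS.isOpen .t), fun t x y hp => ?_⟩
  have h1 : pd .x (fun t x y => frG .t r t x y + dt ψ t x y) t x y =
      pd .x (frG .t r) t x y + pd .x (pd .t ψ) t x y :=
    (((hS.smooth_frG .t).hasPd hS.isOpen hp .x).add
      ((hψ.smooth.pd hS.isOpen .t).hasPd hS.isOpen hp .x)).pd_eq
  have h2 : pd .t (pd .x ψ) t x y = - pd .t (frG .x r) t x y := by
    rw [pd_congr hS.isOpen (g := fun t x y => - frG .x r t x y) (fun t x y hp => ?_) hp]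
    · exact (((hS.smooth_frG .x).hasPd hS.isOpen hp .t).neg).pd_eq
    · have := hψ.eq t x y hp
      change frG .x r t x y = - pd .x ψ t x y at this
      rw [this, neg_neg]
  have h3 := hS.pd_frG_sub' hp .x .t
  rw [hF.frK_t' hp] at h3
  change pd .x (fun t x y => frG .t r t x y + dt ψ t x y) t x y = _
  rw [h1, hψ.smooth.pd_comm hS.isOpen hp, h2, pairing_eq]
  change _ = - ((starRingEnd ℂ) (frK .x r t x y) * _).re
  have h4 : ∀ z w : ℂ, (z * (Complex.I * w)).im = (z * w).re := fun z w => by simp [sub_eq_add_neg]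
  rw [h4] at h3
  linear_combination -h3

end IsFlow

end SurfaceFlow

namespace SurfaceFlow

variable {Ω : Set (ℝ × ℝ × ℝ)} {r : ℝ → ℝ → ℝ → E3} {a : ℕ → ℝ → ℝ → ℝ → ℝ}
  {ψ : ℝ → ℝ → ℝ → ℝ} {t x y : ℝ} {n k : ℕ}

/-! ### Passage to a parallel frame -/

/-- The field `f` with respect to the frame rotated by the angle `ψ`. -/
noncomputable def gauge (ψ : ℝ → ℝ → ℝ → ℝ) (f : ℝ → ℝ → ℝ → ℂ) : ℝ → ℝ → ℝ → ℂ :=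
  fun t x y => Complex.exp (- (Complex.I * (ψ t x y : ℂ))) * f t x y

/-- The rotation rate of the rotated frame in the direction `i`. -/
noncomputable def rotRate (i : Dir) (r : ℝ → ℝ → ℝ → E3) (ψ : ℝ → ℝ → ℝ → ℝ) :
    ℝ → ℝ → ℝ → ℝ :=
  fun t x y => frG i r t x y + pd i ψ t x y

theorem conj_gauge_mul_gauge (f g : ℝ → ℝ → ℝ → ℂ) :
    (starRingEnd ℂ) (gauge ψ f t x y) * gauge ψ g t x y
      = (starRingEnd ℂ) (f t x y) * g t x y := by
  have h : (starRingEnd ℂ) (Complex.exp (- (Complex.I * (ψ t x y : ℂ)))) *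
      Complex.exp (- (Complex.I * (ψ t x y : ℂ))) = 1 := by
    rw [← Complex.exp_conj, ← Complex.exp_add]
    simp
  rw [gauge, gauge, map_mul]
  linear_combination ((starRingEnd ℂ) (f t x y) * g t x y) * h

theorem SmoothOn.gauge {f : ℝ → ℝ → ℝ → ℂ} (hψ : SmoothOn Ω ψ) (hf : SmoothOn Ω f) :
    SmoothOn Ω (gauge ψ f) :=
  (((SmoothOn.const Complex.I).mul hψ.ofReal).neg.cexp).mul hf

theorem pd_gauge {f : ℝ → ℝ → ℝ → ℂ} (hΩ : IsOpen Ω) (hψ : SmoothOn Ω ψ) (hf : SmoothOn Ω f)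
    (hp : (t, x, y) ∈ Ω) (i : Dir) :
    pd i (gauge ψ f) t x y = Complex.exp (- (Complex.I * (ψ t x y : ℂ))) *
      (pd i f t x y - Complex.I * ((pd i ψ t x y : ℝ) : ℂ) * f t x y) := by
  rw [show pd i (gauge ψ f) t x y = _ from
    ((((HasPd.const Complex.I).mul (hψ.hasPd hΩ hp i).ofReal).neg.cexp).mul
      (hf.hasPd hΩ hp i)).pd_eq]
  ring

theorem pd_gauge' {f : ℝ → ℝ → ℝ → ℂ} (hΩ : IsOpen Ω) (hψ : SmoothOn Ω ψ) (hf : SmoothOn Ω f)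
    (hp : (t, x, y) ∈ Ω) (i : Dir) :
    pd i (gauge ψ f) t x y =
      gauge ψ (fun t x y => pd i f t x y - Complex.I * ((pd i ψ t x y : ℝ) : ℂ) * f t x y)
        t x y := pd_gauge hΩ hψ hf hp i

/-- Gauge covariance: rotation by `ψ` keeps the form of the structure equations, with `G_i` replaced
by `G_i + ψ_i`. For an angle the `x`-rate is zero. -/
theorem pd_gauge_frK_sub (hS : IsSurface Ω r) (hψ : SmoothOn Ω ψ) (hp : (t, x, y) ∈ Ω)
    (i j : Dir) :
    pd j (gauge ψ (frK i r)) t x y - pd i (gauge ψ (frK j r)) t x y =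
      - (Complex.I * rotRate j r ψ t x y * gauge ψ (frK i r) t x y)
        + Complex.I * rotRate i r ψ t x y * gauge ψ (frK j r) t x y := by
  rw [pd_gauge hS.isOpen hψ (hS.smooth_frK i) hp, pd_gauge hS.isOpen hψ (hS.smooth_frK j) hp]
  simp only [gauge, rotRate]
  push_cast
  linear_combination Complex.exp (- (Complex.I * (ψ t x y : ℂ))) * hS.pd_frK_sub hp i j

theorem pd_rotRate_sub (hS : IsSurface Ω r) (hψ : SmoothOn Ω ψ) (hp : (t, x, y) ∈ Ω)
    (i j : Dir) :
    pd j (rotRate i r ψ) t x y - pd i (rotRate j r ψ) t x y =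
      ((starRingEnd ℂ) (gauge ψ (frK i r) t x y) * gauge ψ (frK j r) t x y).im := by
  have h : ∀ i j : Dir, pd j (rotRate i r ψ) t x y =
      pd j (frG i r) t x y + pd j (pd i ψ) t x y := fun i j =>
    (((hS.smooth_frG i).hasPd hS.isOpen hp j).add
      ((hψ.pd hS.isOpen i).hasPd hS.isOpen hp j)).pd_eq
  rw [conj_gauge_mul_gauge, ← hS.pd_frG_sub' hp, h, h, hψ.pd_comm hS.isOpen hp i j]
  ring

theorem gauge_hier_zero : gauge ψ (hier r a 0) t x y =
    - Complex.I * gauge ψ (frK .y r) t x y := by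
  rw [gauge, gauge, hier_zero]
  ring

/-- The derivative of the phase absorbs the torsion term, since `γ = -ψ_x`; the recursion then
involves `u` and the coefficients only. -/
theorem gauge_hier_succ (hS : IsSurface Ω r) (hψ : IsAngle Ω r ψ)
    (hw : SmoothOn Ω (hier r a k)) (hp : (t, x, y) ∈ Ω) :
    gauge ψ (hier r a (k + 1)) t x y =
      Complex.I * (dx (gauge ψ (hier r a k)) t x y - a k t x y * covU r ψ t x y) := by
  have h : dx (gauge ψ (hier r a k)) t x y = _ := pd_gauge hS.isOpen hψ.smooth hw hp .x
  change _ = _ * (dx (hier r a k) t x y - Complex.I * (dx ψ t x y : ℝ) * hier r a k t x y) at h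
  have h1 : dx ψ t x y = - gam r t x y := by rw [hψ.eq t x y hp, neg_neg]
  rw [h, h1, gauge, hier_succ, covU]
  push_cast
  linear_combination (- Complex.exp (- (Complex.I * (ψ t x y : ℂ))) * gam r t x y
    * hier r a k t x y) * Complex.I_sq

theorem dx_coef (ψ : ℝ → ℝ → ℝ → ℝ) (hH : IsHierarchy Ω r a n) (hk : k < n)
    (hp : (t, x, y) ∈ Ω) : dx (a k) t x y =
      - ((starRingEnd ℂ) (covU r ψ t x y) * gauge ψ (hier r a k) t x y).re := by
  rw [(hH k hk).eq t x y hp, pairing_eq]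
  exact congrArg (fun z : ℂ => - z.re) (conj_gauge_mul_gauge (kap r) _).symm

theorem gauge_hier_one (hS : IsSurface Ω r) (hψ : IsAngle Ω r ψ) (hA : IsAdapted Ω r a ψ)
    (hp : (t, x, y) ∈ Ω) : gauge ψ (hier r a 1) t x y = dy (covU r ψ) t x y := by
  have h : dy (covU r ψ) t x y = _ := pd_gauge hS.isOpen hψ.smooth hS.smooth_kap hp .y
  rw [h, gauge, hier_one hS hA hp]
  rfl

theorem IsFlow.gauge_frK_t (hF : IsFlow (n + 1) Ω r a) (hp : (t, x, y) ∈ Ω) :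
    gauge ψ (frK .t r) t x y = Complex.I * gauge ψ (hier r a (n + 1)) t x y := by
  rw [gauge, gauge, hF.frK_t' hp]
  ring

/-- The gauged `(x,t)` structure equation, in which the `x`-rate of rotation vanishes. -/
theorem dt_covU (hF : IsFlow (n + 1) Ω r a) (hψ : IsAngle Ω r ψ) (hp : (t, x, y) ∈ Ω) :
    dt (covU r ψ) t x y = Complex.I * dx (gauge ψ (hier r a (n + 1))) t x y
      - Complex.I * rotRate .t r ψ t x y * covU r ψ t x y := by
  have hS := hF.surface
  have hw := hF.hierarchy_smooth (n + 1) le_rfl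
  have h := pd_gauge_frK_sub hS hψ.smooth hp .x .t
  have h1 : pd .x (gauge ψ (frK .t r)) t x y =
      Complex.I * pd .x (gauge ψ (hier r a (n + 1))) t x y := by
    rw [pd_congr hS.isOpen (fun t x y hp => hF.gauge_frK_t hp) hp,
      ((HasPd.const Complex.I).mul ((hψ.smooth.gauge hw).hasPd hS.isOpen hp .x)).pd_eq]
    ring
  have h2 : rotRate .x r ψ t x y = 0 := by
    change gam r t x y + dx ψ t x y = 0
    rw [hψ.eq t x y hp]
    ring
  rw [h1, h2] at h
  change dt (covU r ψ) t x y - Complex.I * dx (gauge ψ (hier r a (n + 1))) t x y =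
    - (Complex.I * rotRate .t r ψ t x y * covU r ψ t x y) + _ at h
  push_cast at h
  linear_combination h

/-- The phase drops out of a product of one conjugated and one plain factor, so densities may be
computed from `u` or from covariant derivatives of `α + iβ`. -/
theorem density2_eq (hS : IsSurface Ω r) (hψ : IsAngle Ω r ψ) (hp : (t, x, y) ∈ Ω) :
    density2 r ψ t x y =
      1 / 2 * ((starRingEnd ℂ) (covU r ψ t x y) * dy (covU r ψ) t x y).im := by
  have h : dy (covU r ψ) t x y = _ := pd_gauge' hS.isOpen hψ.smooth hS.smooth_kap hp .y
  rw [h, show covU r ψ = gauge ψ (kap r) from rfl, conj_gauge_mul_gauge,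
    show pd .y (kap r) t x y = _ from hS.pd_frK hp .x .y]
  change density2 r ψ t x y = 1 / 2 * ((starRingEnd ℂ) (kap r t x y) *
    (((dy (alpha r) t x y : ℝ) : ℂ) + Complex.I * ((dy (beta r) t x y : ℝ) : ℂ)
      - Complex.I * ((dy ψ t x y : ℝ) : ℂ) * kap r t x y)).im
  simp [density2, kap]
  ring

theorem density3_eq (hS : IsSurface Ω r) (hψ : IsAngle Ω r ψ) (hp : (t, x, y) ∈ Ω) :
    density3 r a ψ t x y =
      - ((starRingEnd ℂ) (dx (covU r ψ) t x y) * dy (covU r ψ) t x y).re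
        - 1 / 2 * a 1 t x y * ((starRingEnd ℂ) (covU r ψ t x y) * covU r ψ t x y).re := by
  have h : dy (covU r ψ) t x y = _ := pd_gauge' hS.isOpen hψ.smooth hS.smooth_kap hp .y
  have h' : dx (covU r ψ) t x y = _ := pd_gauge' hS.isOpen hψ.smooth hS.smooth_kap hp .x
  rw [h, h', show covU r ψ = gauge ψ (kap r) from rfl, conj_gauge_mul_gauge,
    conj_gauge_mul_gauge, show pd .y (kap r) t x y = _ from hS.pd_frK hp .x .y,
    show pd .x (kap r) t x y = _ from hS.pd_frK hp .x .x]
  change density3 r a ψ t x y = - ((starRingEnd ℂ)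
    (((dx (alpha r) t x y : ℝ) : ℂ) + Complex.I * ((dx (beta r) t x y : ℝ) : ℂ)
      - Complex.I * ((dx ψ t x y : ℝ) : ℂ) * kap r t x y) *
    (((dy (alpha r) t x y : ℝ) : ℂ) + Complex.I * ((dy (beta r) t x y : ℝ) : ℂ)
      - Complex.I * ((dy ψ t x y : ℝ) : ℂ) * kap r t x y)).re - _
  simp [density3, kap]
  ring

end SurfaceFlow

namespace SurfaceFlow

/-! ### A flow that stretches all transverse directions -/

theorem hasDerivAt_E3 {f g h : ℝ → ℝ} {f' g' h' s : ℝ} (hf : HasDerivAt f f' s)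
    (hg : HasDerivAt g g' s) (hh : HasDerivAt h h' s) :
    HasDerivAt (fun s => (!₂[f s, g s, h s] : E3)) !₂[f', g', h'] s := by
  have h1 : HasDerivAt (fun s => ![f s, g s, h s]) ![f', g', h'] s := by
    refine hasDerivAt_pi.2 fun i => ?_
    fin_cases i
    · exact hf
    · exact hg
    · exact hh
  exact (EuclideanSpace.equiv (Fin 3) ℝ).symm.toContinuousLinearMap.hasFDerivAt.comp_hasDerivAt
    s h1

/-- A plane in polar coordinates, with the origin of the radial coordinate moving, and the plane
itself moving in the normal direction with speed `δ`. -/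
noncomputable def polarPlane (δ : ℝ) : ℝ → ℝ → ℝ → E3 :=
  fun t x y => !₂[(x + t) * Real.cos y, (x + t) * Real.sin y, δ * t]

/-- The domain of regularity of `polarPlane`. -/
def polarDomain : Set (ℝ × ℝ × ℝ) := {p | 0 < p.2.1 + p.1}

theorem isOpen_polarDomain : IsOpen polarDomain :=
  isOpen_lt continuous_const (by fun_prop)

variable (δ : ℝ)

theorem dx_polarPlane : dx (polarPlane δ) = fun _ _ y => !₂[Real.cos y, Real.sin y, 0] := by
  funext t x y
  have h : HasDerivAt (fun s : ℝ => s + t) 1 x := (hasDerivAt_id x).add_const t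
  refine (hasDerivAt_E3 (h.mul_const _) (h.mul_const _) (hasDerivAt_const _ _)).deriv.trans ?_
  simp

theorem dy_polarPlane : dy (polarPlane δ) =
    fun t x y => !₂[-((x + t) * Real.sin y), (x + t) * Real.cos y, 0] := by
  funext t x y
  refine (hasDerivAt_E3 ((Real.hasDerivAt_cos y).const_mul _)
    ((Real.hasDerivAt_sin y).const_mul _) (hasDerivAt_const _ _)).deriv.trans ?_
  simp

theorem dt_polarPlane : dt (polarPlane δ) = fun _ _ y => !₂[Real.cos y, Real.sin y, δ] := by
  funext t x y
  have h : HasDerivAt (fun s : ℝ => x + s) 1 t := (hasDerivAt_id t).const_add x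
  refine (hasDerivAt_E3 (h.mul_const _) (h.mul_const _)
    ((hasDerivAt_id t).const_mul δ)).deriv.trans ?_
  simp

theorem nrm_polarPlane : nrm (polarPlane δ) = fun t x _ => !₂[0, 0, x + t] := by
  funext t x y
  rw [nrm, dx_polarPlane, dy_polarPlane]
  ext i
  fin_cases i <;> simp [cross]
  linear_combination (x + t) * Real.cos_sq_add_sin_sq y

theorem area_polarPlane (t x y : ℝ) : area (polarPlane δ) t x y = |x + t| := by
  rw [area, nrm_polarPlane, EuclideanSpace.norm_eq]
  simp [Fin.sum_univ_three, Real.sqrt_sq_eq_abs]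

variable {t x y : ℝ}

theorem eNor_polarPlane (hp : (t, x, y) ∈ polarDomain) :
    eNor (polarPlane δ) t x y = !₂[0, 0, 1] := by
  have h : 0 < x + t := hp
  rw [eNor, area_polarPlane, nrm_polarPlane, abs_of_pos h]
  ext i
  fin_cases i <;> simp [h.ne']

theorem eStar_polarPlane (hp : (t, x, y) ∈ polarDomain) :
    eStar (polarPlane δ) t x y = !₂[-Real.sin y, Real.cos y, 0] := by
  rw [eStar, eNor_polarPlane δ hp, eTan, dx_polarPlane]
  ext i
  fin_cases i <;> simp [cross]

theorem isSurface_polarPlane : IsSurface polarDomain (polarPlane δ) where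
  isOpen := isOpen_polarDomain
  smooth := by
    refine contDiffOn_euclidean.2 fun i => ContDiff.contDiffOn ?_
    fin_cases i <;> simp [polarPlane] <;> fun_prop
  unit t x y _ := by
    rw [dx_polarPlane, EuclideanSpace.norm_eq]
    simp [Fin.sum_univ_three]
  regular t x y hp := by
    have h : 0 < area (polarPlane δ) t x y := by
      rw [area_polarPlane]
      exact abs_pos.2 (ne_of_gt hp)
    exact norm_pos_iff.1 h

theorem dx_eTan_polarPlane : dx (eTan (polarPlane δ)) t x y = 0 := by
  rw [eTan, dx_polarPlane]
  exact (hasDerivAt_const x _).deriv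

theorem alpha_polarPlane : alpha (polarPlane δ) t x y = 0 := by
  rw [alpha, dx_eTan_polarPlane, inner_zero_right]

theorem beta_polarPlane : beta (polarPlane δ) t x y = 0 := by
  rw [beta, dx_eTan_polarPlane, inner_zero_right]

theorem gam_polarPlane (hp : (t, x, y) ∈ polarDomain) : gam (polarPlane δ) t x y = 0 := by
  have h : dx (eStar (polarPlane δ)) t x y = 0 :=
    (pd_congr isOpen_polarDomain (fun t x y hp => eStar_polarPlane δ hp) hp .x).trans
      (hasDerivAt_const x _).deriv
  rw [gam, h, inner_zero_right]

theorem dy_eTan_polarPlane :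
    dy (eTan (polarPlane δ)) t x y = !₂[-Real.sin y, Real.cos y, 0] := by
  rw [eTan, dx_polarPlane]
  exact (hasDerivAt_E3 (Real.hasDerivAt_cos y) (Real.hasDerivAt_sin y)
    (hasDerivAt_const _ _)).deriv

theorem mu_polarPlane (hp : (t, x, y) ∈ polarDomain) : mu (polarPlane δ) t x y = 1 := by
  rw [mu, dy_eTan_polarPlane, eStar_polarPlane δ hp, inner_E3]
  simp
  linear_combination Real.cos_sq_add_sin_sq y

theorem rho_polarPlane (hp : (t, x, y) ∈ polarDomain) : rho (polarPlane δ) t x y = 0 := by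
  rw [rho, dy_eTan_polarPlane, eNor_polarPlane δ hp, inner_E3]
  simp

theorem kap_polarPlane : kap (polarPlane δ) t x y = 0 := by
  simp [kap, alpha_polarPlane, beta_polarPlane]

theorem hier_zero_polarPlane (a : ℕ → ℝ → ℝ → ℝ → ℝ) (hp : (t, x, y) ∈ polarDomain) :
    hier (polarPlane δ) a 0 t x y = - Complex.I := by
  simp [hier, mu_polarPlane δ hp, rho_polarPlane δ hp]

theorem hier_succ_polarPlane (a : ℕ → ℝ → ℝ → ℝ → ℝ) (k : ℕ) :
    ∀ t x y, (t, x, y) ∈ polarDomain → hier (polarPlane δ) a (k + 1) t x y = 0 := by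
  have hd : ∀ k (c : ℂ), (∀ t x y, (t, x, y) ∈ polarDomain → hier (polarPlane δ) a k t x y = c) →
      ∀ t x y, (t, x, y) ∈ polarDomain → hier (polarPlane δ) a (k + 1) t x y = 0 := by
    intro k c h t x y hp
    have h1 : dx (hier (polarPlane δ) a k) t x y = 0 :=
      (pd_congr isOpen_polarDomain h hp .x).trans (hasDerivAt_const x _).deriv
    rw [hier_succ, h1, gam_polarPlane δ hp, kap_polarPlane]
    simp
  induction k with
  | zero => exact hd 0 _ fun t x y hp => hier_zero_polarPlane δ a hp
  | succ k ih => exact hd (k + 1) 0 ih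

/-- On a plane with straight `x`-lines `α = β = 0`, so any constant is an admissible antiderivative;
the constant `1` moves the origin of the radial coordinate. The starting term is `-i`, giving unit
normal speed in the first flow, and all later terms vanish: hence the two values of `δ`. -/
theorem isFlow_polarPlane (n : ℕ) :
    IsFlow (n + 1) polarDomain (polarPlane (if n = 0 then 1 else 0)) (fun _ _ _ _ => 1) where
  surface := isSurface_polarPlane _
  hierarchy k _ := by
    refine ⟨SmoothOn.const 1, fun t x y _ => ?_⟩
    rw [pairing_eq, kap_polarPlane]
    simp [dx]
  flow t x y hp := by
    rw [dt_polarPlane]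
    rcases n with _ | n
    · simp only [velocity, tangential, coefB, coefC, Nat.zero_add, Nat.sub_self,
        hier_zero_polarPlane _ _ hp, eNor_polarPlane _ hp, eTan, dx_polarPlane]
      ext i
      fin_cases i <;> simp
    · simp only [velocity, tangential, coefB, coefC, Nat.add_sub_cancel,
        hier_succ_polarPlane _ _ n t x y hp, eTan, dx_polarPlane]
      ext i
      fin_cases i <;> simp

/-- The length is `√(ξ² + η²(x + t)²)`, strictly increasing in `t` where `x + t > 0`. -/
theorem dt_norm_polarPlane (hp : (t, x, y) ∈ polarDomain) (ξ : ℝ) {η : ℝ} (hη : η ≠ 0) :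
    dt (fun t x y => ‖ξ • dx (polarPlane δ) t x y + η • dy (polarPlane δ) t x y‖) t x y ≠ 0 := by
  have hn : (fun t x y => ‖ξ • dx (polarPlane δ) t x y + η • dy (polarPlane δ) t x y‖) =
      fun t x _ => Real.sqrt (ξ ^ 2 + η ^ 2 * (x + t) ^ 2) := by
    funext t x y
    rw [EuclideanSpace.norm_eq, dx_polarPlane, dy_polarPlane]
    congr 1
    simp [Fin.sum_univ_three]
    linear_combination (ξ ^ 2 + η ^ 2 * (x + t) ^ 2) * Real.cos_sq_add_sin_sq y
  have h0 : 0 < x + t := hp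
  have hpos : 0 < ξ ^ 2 + η ^ 2 * (x + t) ^ 2 := by positivity
  have h1 : HasDerivAt (fun s : ℝ => x + s) 1 t := (hasDerivAt_id t).const_add x
  have h2 := (((h1.pow 2).const_mul (η ^ 2)).const_add (ξ ^ 2)).sqrt hpos.ne'
  rw [hn]
  have h3 : dt (fun t x (_ : ℝ) => Real.sqrt (ξ ^ 2 + η ^ 2 * (x + t) ^ 2)) t x y = _ := h2.deriv
  rw [h3]
  have := Real.sqrt_pos.2 hpos
  have h4 : η ^ 2 * (x + t) ≠ 0 := by positivity
  simp only [Nat.cast_ofNat, Nat.add_one_sub_one, pow_one, mul_one]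
  positivity

theorem exists_flow_stretching (n : ℕ) (hn : 1 ≤ n) :
    ∃ (Ω : Set (ℝ × ℝ × ℝ)) (r : ℝ → ℝ → ℝ → E3) (a : ℕ → ℝ → ℝ → ℝ → ℝ),
      Ω.Nonempty ∧ IsFlow n Ω r a ∧ ∀ t x y, (t, x, y) ∈ Ω → ∀ ξ η : ℝ, η ≠ 0 →
        dt (fun t x y => ‖ξ • dx r t x y + η • dy r t x y‖) t x y ≠ 0 := by
  obtain ⟨m, rfl⟩ := Nat.exists_eq_add_of_le' hn
  exact ⟨polarDomain, _, _, ⟨(1, 1, 0), by norm_num [polarDomain]⟩, isFlow_polarPlane m,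
    fun t x y hp ξ η hη => dt_norm_polarPlane _ hp ξ hη⟩

end SurfaceFlow

namespace SurfaceFlow

/-! ### Algebra of the recursion -/

/-- The real inner product on `ℂ`. -/
noncomputable def rp (z w : ℂ) : ℝ := ((starRingEnd ℂ) z * w).re

/-- The symplectic product on `ℂ`. -/
noncomputable def ip (z w : ℂ) : ℝ := ((starRingEnd ℂ) z * w).im

theorem rp_eq (z w : ℂ) : rp z w = z.re * w.re + z.im * w.im := by simp [rp]

theorem ip_eq (z w : ℂ) : ip z w = z.re * w.im - z.im * w.re := by simp [ip]; ring

theorem rp_comm (z w : ℂ) : rp z w = rp w z := by simp only [rp_eq]; ring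

theorem ip_comm (z w : ℂ) : ip z w = - ip w z := by simp only [ip_eq]; ring

theorem rp_mul_sub (u z w : ℂ) :
    (rp u z : ℂ) * w - (rp u w : ℂ) * z = Complex.I * u * (ip z w : ℂ) := by
  apply Complex.ext <;> simp [rp_eq, ip_eq] <;> ring

variable {Ω : Set (ℝ × ℝ × ℝ)} {t x y : ℝ} {i : Dir} {u : ℝ → ℝ → ℝ → ℂ}

theorem SmoothOn.rp {f g : ℝ → ℝ → ℝ → ℂ} (hf : SmoothOn Ω f) (hg : SmoothOn Ω g) :
    SmoothOn Ω (fun t x y => rp (f t x y) (g t x y)) := (hf.conj.mul hg).re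

theorem HasPd.rp {f g : ℝ → ℝ → ℝ → ℂ} {f' g' : ℂ} (hf : HasPd i f f' t x y)
    (hg : HasPd i g g' t x y) :
    HasPd i (fun t x y => rp (f t x y) (g t x y))
      (rp f' (g t x y) + rp (f t x y) g') t x y := by
  simpa [SurfaceFlow.rp] using (hf.conj.mul hg).re

theorem HasPd.ip {f g : ℝ → ℝ → ℝ → ℂ} {f' g' : ℂ} (hf : HasPd i f f' t x y)
    (hg : HasPd i g g' t x y) :
    HasPd i (fun t x y => ip (f t x y) (g t x y))
      (ip f' (g t x y) + ip (f t x y) g') t x y := by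
  simpa only [SurfaceFlow.ip, Complex.add_im] using (hf.conj.mul hg).im

/-- The derivative of the pairing of two fields that evolve in `x` over the same `u`. -/
theorem hasPd_rp_add_mul {W Q : ℝ → ℝ → ℝ → ℂ} {a q : ℝ → ℝ → ℝ → ℝ} {v W' Q' : ℂ}
    (hW : HasPd i W (- Complex.I * W' + a t x y * v) t x y)
    (ha : HasPd i a (- rp v (W t x y)) t x y)
    (hQ : HasPd i Q (- Complex.I * Q' + q t x y * v) t x y)
    (hq : HasPd i q (- rp v (Q t x y)) t x y) :
    HasPd i (fun t x y => rp (W t x y) (Q t x y) + a t x y * q t x y)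
      (- ip W' (Q t x y) + ip (W t x y) Q') t x y := by
  convert (hW.rp hQ).add (ha.mul hq) using 1
  simp [rp_eq, ip_eq]
  ring

/-- Sequences of fields related by the recursion operator
`W ↦ i (W_x + u D_x⁻¹ Re (ū W))`. -/
structure LaxHier (Ω : Set (ℝ × ℝ × ℝ)) (u : ℝ → ℝ → ℝ → ℂ) (W : ℕ → ℝ → ℝ → ℝ → ℂ)
    (a : ℕ → ℝ → ℝ → ℝ → ℝ) : Prop where
  smooth : ∀ k, SmoothOn Ω (W k)
  smooth_coef : ∀ k, SmoothOn Ω (a k)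
  succ : ∀ k t x y, (t, x, y) ∈ Ω →
    W (k + 1) t x y = Complex.I * (dx (W k) t x y - a k t x y * u t x y)
  dx_coef : ∀ k t x y, (t, x, y) ∈ Ω → dx (a k) t x y = - rp (u t x y) (W k t x y)

namespace LaxHier

variable {W Q : ℕ → ℝ → ℝ → ℝ → ℂ} {a q : ℕ → ℝ → ℝ → ℝ → ℝ}

theorem shift (hW : LaxHier Ω u W a) (n : ℕ) :
    LaxHier Ω u (fun k => W (k + n)) (fun k => a (k + n)) where
  smooth k := hW.smooth _
  smooth_coef k := hW.smooth_coef _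
  succ k t x y hp := by
    have := hW.succ (k + n) t x y hp
    rwa [show k + n + 1 = k + 1 + n by ring] at this
  dx_coef k := hW.dx_coef _

theorem dx_eq (hW : LaxHier Ω u W a) (k : ℕ) (hp : (t, x, y) ∈ Ω) :
    dx (W k) t x y = - Complex.I * W (k + 1) t x y + a k t x y * u t x y := by
  rw [hW.succ k t x y hp]
  linear_combination (dx (W k) t x y - a k t x y * u t x y) * Complex.I_sq

theorem hasPd (hΩ : IsOpen Ω) (hW : LaxHier Ω u W a) (k : ℕ) (hp : (t, x, y) ∈ Ω) :
    HasPd .x (W k) (- Complex.I * W (k + 1) t x y + a k t x y * u t x y) t x y := by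
  rw [← hW.dx_eq k hp]
  exact (hW.smooth k).hasPd hΩ hp .x

theorem hasPd_coef (hΩ : IsOpen Ω) (hW : LaxHier Ω u W a) (k : ℕ) (hp : (t, x, y) ∈ Ω) :
    HasPd .x (a k) (- rp (u t x y) (W k t x y)) t x y := by
  rw [← hW.dx_coef k t x y hp]
  exact (hW.smooth_coef k).hasPd hΩ hp .x

/-- The symplectic products depend only on the sum of the indices, up to derivatives in `x`. -/
theorem hasPd_pairing (hΩ : IsOpen Ω) (hW : LaxHier Ω u W a) (hQ : LaxHier Ω u Q q) (k l : ℕ)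
    (hp : (t, x, y) ∈ Ω) :
    HasPd .x (fun t x y => rp (W k t x y) (Q l t x y) + a k t x y * q l t x y)
      (- ip (W (k + 1) t x y) (Q l t x y) + ip (W k t x y) (Q (l + 1) t x y)) t x y := by
  exact hasPd_rp_add_mul (hW.hasPd hΩ k hp) (hW.hasPd_coef hΩ k hp) (hQ.hasPd hΩ l hp)
    (hQ.hasPd_coef hΩ l hp)

theorem hasPd_ip (hΩ : IsOpen Ω) (hW : LaxHier Ω u W a) (hQ : LaxHier Ω u Q q) (k l : ℕ)
    (hp : (t, x, y) ∈ Ω) :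
    HasPd .x (fun t x y => ip (W k t x y) (Q l t x y))
      (rp (W (k + 1) t x y) (Q l t x y) - rp (W k t x y) (Q (l + 1) t x y)
        + (a k t x y * ip (u t x y) (Q l t x y) - q l t x y * ip (u t x y) (W k t x y)))
      t x y := by
  have h := (hW.hasPd hΩ k hp).ip (hQ.hasPd hΩ l hp)
  convert h using 1
  simp [rp_eq, ip_eq]
  ring

/-- The terms `i Σ (q_j W_i - a_i Q_j)`. -/
noncomputable def commW (W : ℕ → ℝ → ℝ → ℝ → ℂ) (a : ℕ → ℝ → ℝ → ℝ → ℝ)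
    (Q : ℕ → ℝ → ℝ → ℝ → ℂ) (q : ℕ → ℝ → ℝ → ℝ → ℝ) (k : ℕ) : ℝ → ℝ → ℝ → ℂ :=
  fun t x y => ∑ i ∈ Finset.range k,
    (q (k - 1 - i) t x y * W i t x y - a i t x y * Q (k - 1 - i) t x y)

/-- The terms `Σ Im (W̄_i Q_j)`. -/
noncomputable def commA (W Q : ℕ → ℝ → ℝ → ℝ → ℂ) (k : ℕ) : ℝ → ℝ → ℝ → ℝ :=
  fun t x y => ∑ i ∈ Finset.range k, ip (W i t x y) (Q (k - 1 - i) t x y)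

/-- The products `Re(W̄_i Q_{k-i})` telescope along the sum and leave the two ends; the coefficient
terms assemble into `commW`. -/
theorem hasPd_commA (hΩ : IsOpen Ω) (hW : LaxHier Ω u W a) (hQ : LaxHier Ω u Q q) (k : ℕ)
    (hp : (t, x, y) ∈ Ω) :
    HasPd .x (commA W Q k) (rp (W k t x y) (Q 0 t x y) - rp (W 0 t x y) (Q k t x y)
      - ip (u t x y) (commW W a Q q k t x y)) t x y := by
  have h := HasPd.sum (s := Finset.range k) (i := .x)
    (f := fun i t x y => ip (W i t x y) (Q (k - 1 - i) t x y))
    fun i _ => hasPd_ip hΩ hW hQ i (k - 1 - i) hp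
  convert (show HasPd .x (commA W Q k) _ t x y from h) using 1
  rw [Finset.sum_add_distrib]
  have h1 : ∑ i ∈ Finset.range k, (rp (W (i + 1) t x y) (Q (k - 1 - i) t x y)
      - rp (W i t x y) (Q (k - 1 - i + 1) t x y)) =
      rp (W k t x y) (Q 0 t x y) - rp (W 0 t x y) (Q k t x y) := by
    have h2 := Finset.sum_range_sub (fun i => rp (W i t x y) (Q (k - i) t x y)) k
    rw [Nat.sub_self, Nat.sub_zero] at h2
    rw [← h2]
    refine Finset.sum_congr rfl fun i hi => ?_
    have := Finset.mem_range.1 hi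
    rw [show k - 1 - i = k - (i + 1) by omega, show k - (i + 1) + 1 = k - i by omega]
  have h3 : ip (u t x y) (commW W a Q q k t x y) = - ∑ i ∈ Finset.range k,
      (a i t x y * ip (u t x y) (Q (k - 1 - i) t x y)
        - q (k - 1 - i) t x y * ip (u t x y) (W i t x y)) := by
    rw [commW, ip, Finset.mul_sum, Complex.im_sum, ← Finset.sum_neg_distrib]
    refine Finset.sum_congr rfl fun i _ => ?_
    simp [ip_eq]
    ring
  rw [h1, h3]
  ring

/-- The derivatives of the coefficients enter through `rp_mul_sub`, which makes each summand
proportional to `u`. The terms `a q u` cancel between the two halves, and the other terms raise the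
index by one. -/
theorem hasPd_commW (hΩ : IsOpen Ω) (hW : LaxHier Ω u W a) (hQ : LaxHier Ω u Q q) (k : ℕ)
    (hp : (t, x, y) ∈ Ω) :
    HasPd .x (commW W a Q q k) (Complex.I * u t x y * commA W Q k t x y
      - Complex.I * ∑ i ∈ Finset.range k, (q (k - 1 - i) t x y * W (i + 1) t x y
        - a i t x y * Q (k - i) t x y)) t x y := by
  have h := HasPd.sum (s := Finset.range k) (i := .x)
    (f := fun i t x y => (q (k - 1 - i) t x y * W i t x y - a i t x y * Q (k - 1 - i) t x y : ℂ))
    fun i _ => ((hQ.hasPd_coef hΩ (k - 1 - i) hp).ofReal.mul (hW.hasPd hΩ i hp)).sub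
      ((hW.hasPd_coef hΩ i hp).ofReal.mul (hQ.hasPd hΩ (k - 1 - i) hp))
  convert (show HasPd .x (commW W a Q q k) _ t x y from h) using 1
  rw [commA, Complex.ofReal_sum, Finset.mul_sum, Finset.mul_sum, ← Finset.sum_sub_distrib]
  refine Finset.sum_congr rfl fun i hi => ?_
  have := Finset.mem_range.1 hi
  rw [← rp_mul_sub, show k - 1 - i + 1 = k - i by omega]
  push_cast
  ring

/-- Compatibility of a derivation `δ` with the recursion: if `δu = Q₀` for a second hierarchy `Q`
over `u`, then `δ` is given on the whole hierarchy `W` starting with `u_y` by the two series. -/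
theorem derivation_eq (hΩ : IsOpen Ω) (hu : SmoothOn Ω u) (hW : LaxHier Ω u W a)
    (hQ : LaxHier Ω u Q q)
    (hW0 : ∀ t x y, (t, x, y) ∈ Ω → W 0 t x y = dy u t x y)
    {δW : ℕ → ℝ → ℝ → ℝ → ℂ} {δa : ℕ → ℝ → ℝ → ℝ → ℝ}
    (hδ0 : ∀ t x y, (t, x, y) ∈ Ω → δW 0 t x y = dy (Q 0) t x y)
    (hδs : ∀ k t x y, (t, x, y) ∈ Ω → δW (k + 1) t x y = Complex.I * (dx (δW k) t x y
      - δa k t x y * u t x y - a k t x y * Q 0 t x y))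
    (hδa : ∀ k t x y, (t, x, y) ∈ Ω → dx (δa k) t x y =
      - rp (Q 0 t x y) (W k t x y) - rp (u t x y) (δW k t x y))
    (hbd : ∀ k, (∀ t x y, (t, x, y) ∈ Ω → dx (δa k) t x y =
        dx (fun t x y => dy (q k) t x y - commA W Q k t x y) t x y) →
      ∀ t x y, (t, x, y) ∈ Ω → δa k t x y = dy (q k) t x y - commA W Q k t x y) (k : ℕ) :
    (∀ t x y, (t, x, y) ∈ Ω → δW k t x y =
      dy (Q k) t x y + Complex.I * commW W a Q q k t x y) ∧
    (∀ t x y, (t, x, y) ∈ Ω → δa k t x y = dy (q k) t x y - commA W Q k t x y) := by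
  -- At every level the formula for `δW k` determines the `x`-derivative of `δa k`; the integration
  -- constant is settled by the boundary hypothesis `hbd`.
  have hA : ∀ k, (∀ t x y, (t, x, y) ∈ Ω → δW k t x y =
      dy (Q k) t x y + Complex.I * commW W a Q q k t x y) →
      ∀ t x y, (t, x, y) ∈ Ω → δa k t x y = dy (q k) t x y - commA W Q k t x y := by
    intro k hk
    refine hbd k fun t x y hp => ?_
    have h1 : pd .x (pd .y (q k)) t x y =
        - (rp (dy u t x y) (Q k t x y) + rp (u t x y) (dy (Q k) t x y)) := by
      rw [(hQ.smooth_coef k).pd_comm hΩ hp,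
        pd_congr (f := pd .x (q k)) hΩ (fun t x y hp => hQ.dx_coef k t x y hp) hp]
      exact (((hu.hasPd hΩ hp .y).rp ((hQ.smooth k).hasPd hΩ hp .y)).neg).pd_eq
    have h2 : dx (fun t x y => dy (q k) t x y - commA W Q k t x y) t x y = _ :=
      ((((hQ.smooth_coef k).pd hΩ .y).hasPd hΩ hp .x).sub (hasPd_commA hΩ hW hQ k hp)).pd_eq
    rw [h2, h1, hδa k t x y hp, hk t x y hp, hW0 t x y hp, rp_comm (Q 0 t x y)]
    simp only [rp_eq, ip_eq, Complex.add_re, Complex.add_im, Complex.I_mul_re, Complex.I_mul_im]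
    ring
  induction k with
  | zero =>
    have h0 : ∀ t x y, (t, x, y) ∈ Ω → δW 0 t x y =
        dy (Q 0) t x y + Complex.I * commW W a Q q 0 t x y := fun t x y hp => by
      rw [hδ0 t x y hp, commW]
      simp
    exact ⟨h0, hA 0 h0⟩
  | succ k ih =>
    have h0 : ∀ t x y, (t, x, y) ∈ Ω → δW (k + 1) t x y =
        dy (Q (k + 1)) t x y + Complex.I * commW W a Q q (k + 1) t x y := by
      intro t x y hp
      have h1 : pd .x (pd .y (Q k)) t x y = - Complex.I * dy (Q (k + 1)) t x y
          + (dy (q k) t x y * u t x y + q k t x y * dy u t x y) := by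
        rw [(hQ.smooth k).pd_comm hΩ hp, 
          pd_congr (f := pd .x (Q k)) hΩ (fun t x y hp => hQ.dx_eq k hp) hp,
          (((HasPd.const (- Complex.I)).mul ((hQ.smooth (k + 1)).hasPd hΩ hp .y)).add
            (((hQ.smooth_coef k).hasPd hΩ hp .y).ofReal.mul (hu.hasPd hΩ hp .y))).pd_eq]
        change 0 * _ + - Complex.I * dy (Q (k + 1)) t x y
          + (dy (q k) t x y * u t x y + q k t x y * dy u t x y) = _
        ring
      have h2 : dx (δW k) t x y = _ := (pd_congr hΩ ih.1 hp .x).trans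
        ((((hQ.smooth k).pd hΩ .y).hasPd hΩ hp .x).add
          ((HasPd.const Complex.I).mul (hasPd_commW hΩ hW hQ k hp))).pd_eq
      -- The first and last products are split off the longer sum. They match the commutator terms
      -- `q_k u_y` (with `W 0 = u_y`) and `a_k δu`.
      have h3 : commW W a Q q (k + 1) t x y = q k t x y * W 0 t x y - a k t x y * Q 0 t x y
          + ∑ i ∈ Finset.range k, (q (k - 1 - i) t x y * W (i + 1) t x y
            - a i t x y * Q (k - i) t x y) := by
        rw [commW, Finset.sum_sub_distrib, Finset.sum_sub_distrib, Finset.sum_range_succ',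
          Finset.sum_range_succ (fun i => (a i t x y * Q (k + 1 - 1 - i) t x y : ℂ))]
        simp only [Nat.add_sub_cancel, Nat.sub_self, Nat.sub_zero]
        rw [Finset.sum_congr rfl fun i _ => by rw [show k - (i + 1) = k - 1 - i by omega]]
        ring
      rw [hδs k t x y hp, h2, h1, ih.2 t x y hp, h3, hW0 t x y hp]
      push_cast
      linear_combination (-(dy (Q (k + 1)) t x y) +
        Complex.I * (u t x y * commA W Q k t x y - ∑ i ∈ Finset.range k,
          (q (k - 1 - i) t x y * W (i + 1) t x y - a i t x y * Q (k - i) t x y))) * Complex.I_sq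
    exact ⟨h0, hA _ h0⟩

end LaxHier

end SurfaceFlow

namespace SurfaceFlow

/-! ### Classes of decaying fields -/

/-- A global domain: an open set `T` of times and the range `Y` of the variable `y`, with a weight
parameter `ε` and a period `p`; either `Y = ℝ`, `ε = 1`, `p = 0`, or `Y = (0, p]`, `ε = 0`. -/
structure Dom where
  T : Set ℝ
  isOpen : IsOpen T
  ε : ℝ
  p : ℝ
  Y : Set ℝ
  cases : (ε = 1 ∧ p = 0 ∧ Y = univ) ∨ (ε = 0 ∧ 0 < p ∧ Y = Ioc 0 p)

namespace Dom

variable (D : Dom)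

/-- The set of points over the times `T`. -/
def Ω : Set (ℝ × ℝ × ℝ) := D.T ×ˢ univ

theorem isOpen_Ω : IsOpen D.Ω := D.isOpen.prod isOpen_univ

variable {D} in
theorem mem {t : ℝ} (ht : t ∈ D.T) (x y : ℝ) : (t, x, y) ∈ D.Ω := ⟨ht, trivial⟩

theorem ε_nonneg : 0 ≤ D.ε := by
  rcases D.cases with h | h <;> simp [h.1]

/-- The weight in the variable `y`. -/
def wt (y : ℝ) : ℝ := 1 + D.ε * |y|

theorem one_le_wt (y : ℝ) : 1 ≤ D.wt y := by
  have := mul_nonneg D.ε_nonneg (abs_nonneg y)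
  rw [wt]
  linarith

end Dom

section Classes

variable {F G : Type*} [NormedAddCommGroup F] [NormedSpace ℝ F]
  [NormedAddCommGroup G] [NormedSpace ℝ G] {D : Dom} {μ : Set ℕ} {m : ℕ}

/-- Weighted bounds, locally uniform in time, with the powers of `1 + |x|` in `μ`. -/
def Bdd (D : Dom) (μ : Set ℕ) (f : ℝ → ℝ → ℝ → F) : Prop :=
  ∀ K ⊆ D.T, IsCompact K → ∀ M ∈ μ, ∀ N : ℕ, ∃ C : ℝ, ∀ t ∈ K, ∀ x y : ℝ,
    (1 + |x|) ^ M * D.wt y ^ N * ‖f t x y‖ ≤ C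

/-- Weighted bounds for the derivatives up to order `m`. -/
def BddOrd (D : Dom) (μ : Set ℕ) : ℕ → (ℝ → ℝ → ℝ → F) → Prop
  | 0, f => Bdd D μ f
  | m + 1, f => Bdd D μ f ∧ BddOrd D μ m (dx f) ∧ BddOrd D μ m (dy f)

/-- Smooth fields, periodic in `y` in the periodic case, with weighted bounds for all derivatives:
rapidly decreasing fields for `μ = univ`, bounded in `x` for `μ = {0}`. -/
structure Ctl (D : Dom) (μ : Set ℕ) (f : ℝ → ℝ → ℝ → F) : Prop where
  smooth : SmoothOn D.Ω f
  per : ∀ t ∈ D.T, ∀ x y, f t x (y + D.p) = f t x y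
  bdd : ∀ m, BddOrd D μ m f

theorem BddOrd.zero {f : ℝ → ℝ → ℝ → F} (hf : BddOrd D μ m f) : Bdd D μ f := by
  cases m with
  | zero => exact hf
  | succ m => exact hf.1

theorem Bdd.of_le {f : ℝ → ℝ → ℝ → F} {g : ℝ → ℝ → ℝ → G} (hf : Bdd D μ f) (c : ℝ)
    (h : ∀ t ∈ D.T, ∀ x y, ‖g t x y‖ ≤ c * ‖f t x y‖) : Bdd D μ g := by
  intro K hK hKc M hM N
  obtain ⟨C, hC⟩ := hf K hK hKc M hM N
  refine ⟨|c| * C, fun t ht x y => ?_⟩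
  have hw : 0 ≤ (1 + |x|) ^ M * D.wt y ^ N := by
    have := D.one_le_wt y
    positivity
  calc (1 + |x|) ^ M * D.wt y ^ N * ‖g t x y‖
      ≤ (1 + |x|) ^ M * D.wt y ^ N * (|c| * ‖f t x y‖) := by
        refine mul_le_mul_of_nonneg_left ((h t (hK ht) x y).trans ?_) hw
        exact mul_le_mul_of_nonneg_right (le_abs_self c) (norm_nonneg _)
    _ = |c| * ((1 + |x|) ^ M * D.wt y ^ N * ‖f t x y‖) := by ring
    _ ≤ |c| * C := mul_le_mul_of_nonneg_left (hC t ht x y) (abs_nonneg c)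

theorem Bdd.mul {𝔸 : Type*} [NormedRing 𝔸] {f g : ℝ → ℝ → ℝ → 𝔸} (hf : Bdd D μ f)
    (hg : Bdd D {0} g) : Bdd D μ (fun t x y => f t x y * g t x y) := by
  intro K hK hKc M hM N
  obtain ⟨C, hC⟩ := hf K hK hKc M hM N
  obtain ⟨C', hC'⟩ := hg K hK hKc 0 rfl 0
  refine ⟨C * C', fun t ht x y => ?_⟩
  have h1 := hC t ht x y
  have h2 := hC' t ht x y
  have hw : 0 ≤ (1 + |x|) ^ M * D.wt y ^ N := by
    have := D.one_le_wt y
    positivity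
  simp only [pow_zero, one_mul] at h2
  calc (1 + |x|) ^ M * D.wt y ^ N * ‖f t x y * g t x y‖
      ≤ (1 + |x|) ^ M * D.wt y ^ N * (‖f t x y‖ * ‖g t x y‖) :=
        mul_le_mul_of_nonneg_left (norm_mul_le _ _) hw
    _ = ((1 + |x|) ^ M * D.wt y ^ N * ‖f t x y‖) * ‖g t x y‖ := by ring
    _ ≤ C * C' := mul_le_mul h1 h2 (norm_nonneg _) ((by positivity : (0 : ℝ) ≤ _).trans h1)

theorem Bdd.add {f g : ℝ → ℝ → ℝ → F} (hf : Bdd D μ f) (hg : Bdd D μ g) :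
    Bdd D μ (fun t x y => f t x y + g t x y) := by
  intro K hK hKc M hM N
  obtain ⟨C, hC⟩ := hf K hK hKc M hM N
  obtain ⟨C', hC'⟩ := hg K hK hKc M hM N
  refine ⟨C + C', fun t ht x y => ?_⟩
  have hw : 0 ≤ (1 + |x|) ^ M * D.wt y ^ N := by
    have := D.one_le_wt y
    positivity
  calc (1 + |x|) ^ M * D.wt y ^ N * ‖f t x y + g t x y‖
      ≤ (1 + |x|) ^ M * D.wt y ^ N * (‖f t x y‖ + ‖g t x y‖) :=
        mul_le_mul_of_nonneg_left (norm_add_le _ _) hw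
    _ ≤ C + C' := by
        rw [mul_add]
        exact add_le_add (hC t ht x y) (hC' t ht x y)

theorem Bdd.mono {μ' : Set ℕ} {f : ℝ → ℝ → ℝ → F} (hf : Bdd D μ f) (h : μ' ⊆ μ) :
    Bdd D μ' f := fun K hK hKc M hM N => hf K hK hKc M (h hM) N

theorem BddOrd.mono {μ' : Set ℕ} {f : ℝ → ℝ → ℝ → F} (hf : BddOrd D μ m f) (h : μ' ⊆ μ) :
    BddOrd D μ' m f := by
  induction m generalizing f with
  | zero => exact Bdd.mono hf h
  | succ m ih => exact ⟨hf.1.mono h, ih hf.2.1, ih hf.2.2⟩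

theorem Dom.pd_congr {f g : ℝ → ℝ → ℝ → F} (h : ∀ t ∈ D.T, ∀ x y, f t x y = g t x y)
    {t : ℝ} (ht : t ∈ D.T) (x y : ℝ) (i : Dir) : pd i f t x y = pd i g t x y :=
  SurfaceFlow.pd_congr D.isOpen_Ω (fun t x y hp => h t hp.1 x y) (D.mem ht x y) i

theorem BddOrd.congr {f g : ℝ → ℝ → ℝ → F} (hf : BddOrd D μ m f)
    (h : ∀ t ∈ D.T, ∀ x y, g t x y = f t x y) : BddOrd D μ m g := by
  have h0 : ∀ {f g : ℝ → ℝ → ℝ → F}, Bdd D μ f → (∀ t ∈ D.T, ∀ x y, g t x y = f t x y) →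
      Bdd D μ g := fun hf h => hf.of_le 1 fun t ht x y => by rw [h t ht, one_mul]
  induction m generalizing f g with
  | zero => exact h0 hf h
  | succ m ih =>
    exact ⟨h0 hf.1 h, ih hf.2.1 fun t ht x y => D.pd_congr h ht x y .x,
      ih hf.2.2 fun t ht x y => D.pd_congr h ht x y .y⟩

namespace Ctl

theorem congr {f g : ℝ → ℝ → ℝ → F} (hf : Ctl D μ f)
    (h : ∀ t ∈ D.T, ∀ x y, g t x y = f t x y) : Ctl D μ g where
  smooth := hf.smooth.congr fun t x y hp => h t hp.1 x y
  per t ht x y := by rw [h t ht, h t ht, hf.per t ht]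
  bdd m := (hf.bdd m).congr h

theorem mono {f : ℝ → ℝ → ℝ → F} (hf : Ctl D univ f) : Ctl D μ f where
  smooth := hf.smooth
  per := hf.per
  bdd m := (hf.bdd m).mono (subset_univ _)

theorem dx {f : ℝ → ℝ → ℝ → F} (hf : Ctl D μ f) : Ctl D μ (dx f) where
  smooth := hf.smooth.pd D.isOpen_Ω .x
  per t ht x y := by
    simp only [SurfaceFlow.dx]
    congr 1
    funext s
    exact hf.per t ht s y
  bdd m := (hf.bdd (m + 1)).2.1

theorem dy {f : ℝ → ℝ → ℝ → F} (hf : Ctl D μ f) : Ctl D μ (dy f) where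
  smooth := hf.smooth.pd D.isOpen_Ω .y
  per t ht x y := by
    simp only [SurfaceFlow.dy]
    rw [← deriv_comp_add_const]
    congr 1
    funext s
    exact hf.per t ht x s
  bdd m := (hf.bdd (m + 1)).2.2

theorem clm {f : ℝ → ℝ → ℝ → F} (hf : Ctl D μ f) (L : F →L[ℝ] G) :
    Ctl D μ (fun t x y => L (f t x y)) where
  smooth := hf.smooth.clm L
  per t ht x y := by rw [hf.per t ht]
  bdd m := by
    induction m generalizing f with
    | zero => exact (hf.bdd 0).zero.of_le ‖L‖ fun t _ x y => L.le_opNorm _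
    | succ m ih =>
      exact ⟨(hf.bdd 0).zero.of_le ‖L‖ fun t _ x y => L.le_opNorm _,
        (ih hf.dx).congr fun t ht x y =>
          ((hf.smooth.hasPd D.isOpen_Ω (D.mem ht x y) .x).clm L).pd_eq,
        (ih hf.dy).congr fun t ht x y =>
          ((hf.smooth.hasPd D.isOpen_Ω (D.mem ht x y) .y).clm L).pd_eq⟩

theorem add {f g : ℝ → ℝ → ℝ → F} (hf : Ctl D μ f) (hg : Ctl D μ g) :
    Ctl D μ (fun t x y => f t x y + g t x y) where
  smooth := hf.smooth.add hg.smooth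
  per t ht x y := by rw [hf.per t ht, hg.per t ht]
  bdd m := by
    induction m generalizing f g with
    | zero => exact (hf.bdd 0).zero.add (hg.bdd 0).zero
    | succ m ih =>
      exact ⟨(hf.bdd 0).zero.add (hg.bdd 0).zero,
        (ih hf.dx hg.dx).congr fun t ht x y =>
          ((hf.smooth.hasPd D.isOpen_Ω (D.mem ht x y) .x).add
            (hg.smooth.hasPd D.isOpen_Ω (D.mem ht x y) .x)).pd_eq,
        (ih hf.dy hg.dy).congr fun t ht x y =>
          ((hf.smooth.hasPd D.isOpen_Ω (D.mem ht x y) .y).add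
            (hg.smooth.hasPd D.isOpen_Ω (D.mem ht x y) .y)).pd_eq⟩

theorem neg {f : ℝ → ℝ → ℝ → F} (hf : Ctl D μ f) : Ctl D μ (fun t x y => - f t x y) := by
  simpa using hf.clm (-ContinuousLinearMap.id ℝ F)

theorem sub {f g : ℝ → ℝ → ℝ → F} (hf : Ctl D μ f) (hg : Ctl D μ g) :
    Ctl D μ (fun t x y => f t x y - g t x y) := by
  simpa only [sub_eq_add_neg] using hf.add hg.neg

theorem mul {𝔸 : Type*} [NormedRing 𝔸] [NormedAlgebra ℝ 𝔸] {f g : ℝ → ℝ → ℝ → 𝔸}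
    (hf : Ctl D μ f) (hg : Ctl D {0} g) : Ctl D μ (fun t x y => f t x y * g t x y) where
  smooth := hf.smooth.mul hg.smooth
  per t ht x y := by rw [hf.per t ht, hg.per t ht]
  bdd m := by
    -- The Leibniz rule produces a sum of products that are known only up to order `m` inside the
    -- induction, so additivity is needed order by order.
    have hadd : ∀ {m} {f g : ℝ → ℝ → ℝ → 𝔸}, BddOrd D μ m f → BddOrd D μ m g →
        SmoothOn D.Ω f → SmoothOn D.Ω g → BddOrd D μ m (fun t x y => f t x y + g t x y) := by
      intro m
      induction m with
      | zero => exact fun hf hg _ _ => Bdd.add hf hg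
      | succ m ih =>
        intro f g hf hg hfs hgs
        exact ⟨hf.1.add hg.1,
          (ih hf.2.1 hg.2.1 (hfs.pd D.isOpen_Ω .x) (hgs.pd D.isOpen_Ω .x)).congr
            fun t ht x y => ((hfs.hasPd D.isOpen_Ω (D.mem ht x y) .x).add
              (hgs.hasPd D.isOpen_Ω (D.mem ht x y) .x)).pd_eq,
          (ih hf.2.2 hg.2.2 (hfs.pd D.isOpen_Ω .y) (hgs.pd D.isOpen_Ω .y)).congr
            fun t ht x y => ((hfs.hasPd D.isOpen_Ω (D.mem ht x y) .y).add
              (hgs.hasPd D.isOpen_Ω (D.mem ht x y) .y)).pd_eq⟩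
    induction m generalizing f g with
    | zero => exact (hf.bdd 0).zero.mul (hg.bdd 0).zero
    | succ m ih =>
      exact ⟨(hf.bdd 0).zero.mul (hg.bdd 0).zero,
        (hadd (ih hf.dx hg) (ih hf hg.dx) (hf.dx.smooth.mul hg.smooth)
          (hf.smooth.mul hg.dx.smooth)).congr fun t ht x y =>
            ((hf.smooth.hasPd D.isOpen_Ω (D.mem ht x y) .x).mul
            (hg.smooth.hasPd D.isOpen_Ω (D.mem ht x y) .x)).pd_eq,
        (hadd (ih hf.dy hg) (ih hf hg.dy) (hf.dy.smooth.mul hg.smooth)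
          (hf.smooth.mul hg.dy.smooth)).congr fun t ht x y =>
            ((hf.smooth.hasPd D.isOpen_Ω (D.mem ht x y) .y).mul
            (hg.smooth.hasPd D.isOpen_Ω (D.mem ht x y) .y)).pd_eq⟩

theorem zero : Ctl D μ (fun _ _ _ => (0 : F)) where
  smooth := SmoothOn.const 0
  per _ _ _ _ := rfl
  bdd m := by
    have h0 : Bdd D μ (fun _ _ _ => (0 : F)) := fun _ _ _ _ _ _ => ⟨0, by simp⟩
    induction m with
    | zero => exact h0
    | succ m ih =>
      exact ⟨h0, ih.congr fun t _ x y =>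
        (HasPd.const (i := .x) (t := t) (x := x) (y := y) (0 : F)).pd_eq,
        ih.congr fun t _ x y =>
        (HasPd.const (i := .y) (t := t) (x := x) (y := y) (0 : F)).pd_eq⟩

theorem sum {ι : Type*} {s : Finset ι} {f : ι → ℝ → ℝ → ℝ → F}
    (hf : ∀ i ∈ s, Ctl D μ (f i)) : Ctl D μ (fun t x y => ∑ i ∈ s, f i t x y) := by
  classical
  induction s using Finset.induction_on with
  | empty => simpa using zero
  | insert i s hi ih =>
    simp only [Finset.sum_insert hi]
    exact (hf i (Finset.mem_insert_self i s)).add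
      (ih fun j hj => hf j (Finset.mem_insert_of_mem hj))

theorem const_mul {𝔸 : Type*} [NormedRing 𝔸] [NormedAlgebra ℝ 𝔸] {f : ℝ → ℝ → ℝ → 𝔸}
    (hf : Ctl D μ f) (c : 𝔸) : Ctl D μ (fun t x y => c * f t x y) :=
  hf.clm (ContinuousLinearMap.mul ℝ 𝔸 c)

theorem ofReal {f : ℝ → ℝ → ℝ → ℝ} (hf : Ctl D μ f) : Ctl D μ (fun t x y => (f t x y : ℂ)) :=
  hf.clm Complex.ofRealCLM

theorem conj {f : ℝ → ℝ → ℝ → ℂ} (hf : Ctl D μ f) :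
    Ctl D μ (fun t x y => (starRingEnd ℂ) (f t x y)) :=
  hf.clm (Complex.conjCLE : ℂ →L[ℝ] ℂ)

theorem rp {f g : ℝ → ℝ → ℝ → ℂ} (hf : Ctl D μ f) (hg : Ctl D {0} g) :
    Ctl D μ (fun t x y => rp (f t x y) (g t x y)) := (hf.conj.mul hg).clm Complex.reCLM

theorem ip {f g : ℝ → ℝ → ℝ → ℂ} (hf : Ctl D μ f) (hg : Ctl D {0} g) :
    Ctl D μ (fun t x y => ip (f t x y) (g t x y)) := (hf.conj.mul hg).clm Complex.imCLM

end Ctl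

/-- A rapidly decreasing field from bounds for its ordered derivatives. -/
theorem Ctl.of_iterate {f : ℝ → ℝ → ℝ → F} (hs : SmoothOn D.Ω f)
    (hper : ∀ t ∈ D.T, ∀ x y, f t x (y + D.p) = f t x y)
    (h : ∀ j l, Bdd D μ (SurfaceFlow.dx^[j] (SurfaceFlow.dy^[l] f))) : Ctl D μ f where
  smooth := hs
  per := hper
  bdd m := by
    have hsl : ∀ l, SmoothOn D.Ω (SurfaceFlow.dy^[l] f) := fun l => by
      induction l with
      | zero => exact hs
      | succ l ih => rw [Function.iterate_succ_apply']; exact ih.pd D.isOpen_Ω .y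
    have hsj : ∀ j l, SmoothOn D.Ω (SurfaceFlow.dx^[j] (SurfaceFlow.dy^[l] f)) := fun j l => by
      induction j with
      | zero => exact hsl l
      | succ j ih => rw [Function.iterate_succ_apply']; exact ih.pd D.isOpen_Ω .x
    -- A `y`-derivative taken last is moved inside all `x`-derivatives, which restores the ordered
    -- form in which the bounds are given.
    have hc : ∀ j l, ∀ t ∈ D.T, ∀ x y,
        SurfaceFlow.dy (SurfaceFlow.dx^[j] (SurfaceFlow.dy^[l] f)) t x y =
          SurfaceFlow.dx^[j] (SurfaceFlow.dy^[l + 1] f) t x y := by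
      intro j l
      induction j with
      | zero => intro t _ x y; rw [Function.iterate_succ_apply']; rfl
      | succ j ih =>
        intro t ht x y
        rw [Function.iterate_succ_apply', Function.iterate_succ_apply']
        exact ((hsj j l).pd_comm D.isOpen_Ω (D.mem ht x y) .y .x).trans
          (D.pd_congr ih ht x y .x)
    have key : ∀ m j l, BddOrd D μ m (SurfaceFlow.dx^[j] (SurfaceFlow.dy^[l] f)) := by
      intro m
      induction m with
      | zero => exact h
      | succ m ih =>
        intro j l
        refine ⟨h j l, ?_, (ih j (l + 1)).congr fun t ht x y => hc j l t ht x y⟩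
        have := ih (j + 1) l
        rwa [Function.iterate_succ_apply'] at this
    exact key m 0 0

end Classes

end SurfaceFlow

namespace SurfaceFlow

/-! ### Functions with opposite limits -/

/-- The limits at `∞` and `-∞` are opposite. -/
def Skew (g : ℝ → ℝ) : Prop :=
  ∃ l : ℝ, Tendsto g atTop (𝓝 l) ∧ Tendsto g atBot (𝓝 (-l))

theorem Skew.add {f g : ℝ → ℝ} (hf : Skew f) (hg : Skew g) : Skew (fun x => f x + g x) := by
  obtain ⟨l, h1, h2⟩ := hf
  obtain ⟨m, h3, h4⟩ := hg
  exact ⟨l + m, h1.add h3, by rw [neg_add]; exact h2.add h4⟩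

theorem Skew.neg {f : ℝ → ℝ} (hf : Skew f) : Skew (fun x => - f x) := by
  obtain ⟨l, h1, h2⟩ := hf
  exact ⟨-l, h1.neg, h2.neg⟩

theorem Skew.sub {f g : ℝ → ℝ} (hf : Skew f) (hg : Skew g) : Skew (fun x => f x - g x) := by
  simpa only [sub_eq_add_neg] using hf.add hg.neg

theorem Skew.of_zero {f : ℝ → ℝ} (h1 : Tendsto f atTop (𝓝 0)) (h2 : Tendsto f atBot (𝓝 0)) :
    Skew f := ⟨0, h1, by rwa [neg_zero]⟩

theorem Skew.const_eq_zero {c : ℝ} (h : Skew (fun _ => c)) : c = 0 := by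
  obtain ⟨l, h1, h2⟩ := h
  have h3 := tendsto_nhds_unique h1 tendsto_const_nhds
  have h4 := tendsto_nhds_unique h2 tendsto_const_nhds
  linarith

theorem eq_of_hasDerivAt_zero {f : ℝ → ℝ} (hf : ∀ x, HasDerivAt f 0 x) (x x' : ℝ) :
    f x = f x' :=
  is_const_of_deriv_eq_zero (fun x => (hf x).differentiableAt) (fun x => (hf x).deriv) x x'

theorem Skew.eq_zero {f : ℝ → ℝ} (h : Skew f) (hf : ∀ x, HasDerivAt f 0 x) (x : ℝ) :
    f x = 0 := by
  have h1 : f = fun _ => f x := funext fun x' => eq_of_hasDerivAt_zero hf x' x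
  rw [h1] at h
  exact h.const_eq_zero

/-! ### Functions whose derivative is dominated by `C (1 + x²)⁻¹`. -/

section Arctan

variable {f f' : ℝ → ℝ} {C : ℝ}

/-- The bound on `f'` makes both `C arctan + f` and `C arctan - f` monotone. This replaces
integration: limits at infinity and explicit tail bounds follow from those of the arctangent. -/
theorem abs_sub_le_arctan (hf : ∀ x, HasDerivAt f (f' x) x)
    (hb : ∀ x, |f' x| ≤ C * (1 + x ^ 2)⁻¹) {x x' : ℝ} (h : x ≤ x') :
    |f x' - f x| ≤ C * (Real.arctan x' - Real.arctan x) := by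
  have ha : ∀ x, HasDerivAt (fun x => C * Real.arctan x) (C * (1 + x ^ 2)⁻¹) x := fun x => by
    simpa using (Real.hasDerivAt_arctan x).const_mul C
  have h1 : Monotone (fun x => C * Real.arctan x + f x) :=
    monotone_of_hasDerivAt_nonneg (fun x => (ha x).add (hf x)) fun x => by
      have := abs_le.1 (hb x)
      simp only [Pi.zero_apply]
      linarith
  have h2 : Monotone (fun x => C * Real.arctan x - f x) :=
    monotone_of_hasDerivAt_nonneg (fun x => (ha x).sub (hf x)) fun x => by
      have := abs_le.1 (hb x)
      simp only [Pi.zero_apply]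
      linarith
  have h3 := h1 h
  have h4 := h2 h
  simp only at h3 h4
  rw [abs_le]
  constructor <;> linarith

theorem exists_tendsto_atTop (hf : ∀ x, HasDerivAt f (f' x) x)
    (hb : ∀ x, |f' x| ≤ C * (1 + x ^ 2)⁻¹) : ∃ l, Tendsto f atTop (𝓝 l) := by
  have hc : Cauchy (map f atTop) := by
    have h0 : Tendsto (fun x => C * Real.arctan x) atTop (𝓝 (C * (Real.pi / 2))) :=
      (tendsto_nhds_of_tendsto_nhdsWithin Real.tendsto_arctan_atTop).const_mul C
    have h1 := Metric.cauchy_iff.1 h0.cauchy_map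
    refine Metric.cauchy_iff.2 ⟨inferInstance, fun δ hδ => ?_⟩
    obtain ⟨s, hs, hs'⟩ := h1.2 δ hδ
    refine ⟨f '' ((fun x => C * Real.arctan x) ⁻¹' s), image_mem_map (mem_map.1 hs), ?_⟩
    have key : ∀ x x', x ≤ x' → C * Real.arctan x ∈ s → C * Real.arctan x' ∈ s →
        dist (f x) (f x') < δ := fun x x' h hx hx' => by
      have h2 := hs' _ hx' _ hx
      rw [Real.dist_eq] at h2
      rw [dist_comm, Real.dist_eq]
      refine (abs_sub_le_arctan hf hb h).trans_lt ((le_abs_self _).trans_lt ?_)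
      rwa [mul_sub]
    rintro _ ⟨x, hx, rfl⟩ _ ⟨x', hx', rfl⟩
    rcases le_total x x' with h | h
    · exact key x x' h hx hx'
    · rw [dist_comm]
      exact key x' x h hx' hx
  exact cauchy_map_iff_exists_tendsto.1 hc

theorem exists_tendsto_atBot (hf : ∀ x, HasDerivAt f (f' x) x)
    (hb : ∀ x, |f' x| ≤ C * (1 + x ^ 2)⁻¹) : ∃ l, Tendsto f atBot (𝓝 l) := by
  have h1 : ∀ x, HasDerivAt (fun x => f (-x)) (- f' (-x)) x := fun x => by
    have := (hf (-x)).scomp x (hasDerivAt_neg x)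
    rwa [neg_one_smul] at this
  obtain ⟨l, hl⟩ := exists_tendsto_atTop h1 fun x => by
    rw [abs_neg]
    simpa using hb (-x)
  refine ⟨l, ?_⟩
  simpa [Function.comp_def] using hl.comp tendsto_neg_atBot_atTop

theorem abs_sub_le_of_tendsto_atTop (hf : ∀ x, HasDerivAt f (f' x) x)
    (hb : ∀ x, |f' x| ≤ C * (1 + x ^ 2)⁻¹) {l : ℝ} (hl : Tendsto f atTop (𝓝 l)) (x : ℝ) :
    |l - f x| ≤ C * (Real.pi / 2 - Real.arctan x) := by
  refine le_of_tendsto_of_tendsto (hl.sub_const _).abs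
    (((tendsto_nhds_of_tendsto_nhdsWithin Real.tendsto_arctan_atTop).sub_const _).const_mul C) ?_
  filter_upwards [eventually_ge_atTop x] with x' hx'
  exact abs_sub_le_arctan hf hb hx'

theorem abs_sub_le_of_tendsto_atBot (hf : ∀ x, HasDerivAt f (f' x) x)
    (hb : ∀ x, |f' x| ≤ C * (1 + x ^ 2)⁻¹) {l : ℝ} (hl : Tendsto f atBot (𝓝 l)) (x : ℝ) :
    |f x - l| ≤ C * (Real.arctan x + Real.pi / 2) := by
  have h := ((tendsto_nhds_of_tendsto_nhdsWithin Real.tendsto_arctan_atBot).const_sub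
    (Real.arctan x)).const_mul C
  rw [sub_neg_eq_add] at h
  refine le_of_tendsto_of_tendsto (hl.const_sub _).abs h ?_
  filter_upwards [eventually_le_atBot x] with x' hx'
  exact abs_sub_le_arctan hf hb hx'

/-- The distances from `f x` to its limits `l` and `-l` add up to at most `Cπ`, and the unknown `l`
cancels on adding the two estimates. -/
theorem Skew.abs_le (h : Skew f) (hf : ∀ x, HasDerivAt f (f' x) x)
    (hb : ∀ x, |f' x| ≤ C * (1 + x ^ 2)⁻¹) (x : ℝ) : |f x| ≤ C * Real.pi := by
  obtain ⟨l, h1, h2⟩ := h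
  have h3 := abs_sub_le_of_tendsto_atTop hf hb h1 x
  have h4 := abs_sub_le_of_tendsto_atBot hf hb h2 x
  have h5 := Real.pi_pos
  have hC : 0 ≤ C := by
    have := (abs_nonneg _).trans (hb 0)
    simpa using this
  rw [abs_le'] at h3 h4 ⊢
  constructor <;> nlinarith

end Arctan

/-- The derivative in a parameter of functions with opposite limits has opposite limits. -/
theorem Skew.deriv_param {U : Set ℝ} (hU : IsOpen U) {f g g' : ℝ → ℝ → ℝ}
    (hf : ∀ τ ∈ U, Skew (f τ)) (hfg : ∀ τ ∈ U, ∀ x, HasDerivAt (fun s => f s x) (g τ x) τ)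
    (hg : ∀ τ ∈ U, ∀ x, HasDerivAt (g τ) (g' τ x) x)
    (hb : ∀ K ⊆ U, IsCompact K → ∃ C, ∀ τ ∈ K, ∀ x, |g' τ x| ≤ C * (1 + x ^ 2)⁻¹)
    {τ : ℝ} (hτ : τ ∈ U) : Skew (g τ) := by
  have hb1 : ∀ τ ∈ U, ∃ C, ∀ x, |g' τ x| ≤ C * (1 + x ^ 2)⁻¹ := fun τ hτ => by
    obtain ⟨C, hC⟩ := hb {τ} (by simpa using hτ) isCompact_singleton
    exact ⟨C, hC τ rfl⟩
  have hp : ∀ τ : ℝ, ∃ l : ℝ, τ ∈ U → Tendsto (g τ) atTop (𝓝 l) := fun τ => by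
    by_cases h : τ ∈ U
    · obtain ⟨C, hC⟩ := hb1 τ h
      obtain ⟨l, hl⟩ := exists_tendsto_atTop (hg τ h) hC
      exact ⟨l, fun _ => hl⟩
    · exact ⟨0, fun h' => absurd h' h⟩
  have hm : ∀ τ : ℝ, ∃ l : ℝ, τ ∈ U → Tendsto (g τ) atBot (𝓝 l) := fun τ => by
    by_cases h : τ ∈ U
    · obtain ⟨C, hC⟩ := hb1 τ h
      obtain ⟨l, hl⟩ := exists_tendsto_atBot (hg τ h) hC
      exact ⟨l, fun _ => hl⟩
    · exact ⟨0, fun h' => absurd h' h⟩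
  choose P hP using hp
  choose M hM using hm
  -- Skewness of `f τ` says that `f τ X + f τ (-X)` tends to zero. The arctangent tails give locally
  -- uniform convergence of its `τ`-derivatives, so their limit is the derivative of the zero
  -- function.
  have hunif : TendstoLocallyUniformlyOn (fun (X : ℝ) τ => g τ X + g τ (-X))
      (fun τ => P τ + M τ) atTop U := by
    rw [tendstoLocallyUniformlyOn_iff_forall_isCompact hU]
    intro K hK hKc
    obtain ⟨C, hC⟩ := hb K hK hKc
    rw [Metric.tendstoUniformlyOn_iff]
    intro δ hδ
    have h0 : Tendsto (fun X => 2 * C * (Real.pi / 2 - Real.arctan X)) atTop (𝓝 0) := by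
      have := ((tendsto_nhds_of_tendsto_nhdsWithin Real.tendsto_arctan_atTop).const_sub
        (Real.pi / 2)).const_mul (2 * C)
      simpa using this
    filter_upwards [h0.eventually (gt_mem_nhds hδ)] with X hX τ hτ
    have h1 := abs_sub_le_of_tendsto_atTop (hg τ (hK hτ)) (hC τ hτ) (hP τ (hK hτ)) X
    have h2 := abs_sub_le_of_tendsto_atBot (hg τ (hK hτ)) (hC τ hτ) (hM τ (hK hτ)) (-X)
    rw [Real.arctan_neg] at h2
    rw [Real.dist_eq]
    rw [abs_le'] at h1 h2
    refine lt_of_le_of_lt ?_ hX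
    rw [abs_le']
    constructor <;> linarith
  have hlim : HasDerivAt (fun _ : ℝ => (0 : ℝ)) (P τ + M τ) τ := by
    refine hasDerivAt_of_tendstoLocallyUniformlyOn hU (f := fun (X : ℝ) τ => f τ X + f τ (-X))
      hunif (Eventually.of_forall fun X τ hτ => (hfg τ hτ X).add (hfg τ hτ (-X)))
      (fun τ hτ => ?_) hτ
    obtain ⟨l, h1, h2⟩ := hf τ hτ
    simpa using h1.add (h2.comp tendsto_neg_atTop_atBot)
  have h0 : P τ + M τ = 0 := hlim.unique (hasDerivAt_const τ 0)
  exact ⟨P τ, hP τ hτ, by rw [← eq_neg_of_add_eq_zero_right h0]; exact hM τ hτ⟩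

/-! ### Bounds for the classes of fields -/

section Bounds

variable {F : Type*} [NormedAddCommGroup F] [NormedSpace ℝ F] {D : Dom}

theorem Bdd.le_mul {f : ℝ → ℝ → ℝ → F} (hf : Bdd D univ f) {K : Set ℝ} (hK : K ⊆ D.T)
    (hKc : IsCompact K) (N : ℕ) : ∃ C, 0 ≤ C ∧ ∀ t ∈ K, ∀ x y,
      D.wt y ^ N * ‖f t x y‖ ≤ C * (1 + x ^ 2)⁻¹ := by
  obtain ⟨C, hC⟩ := hf K hK hKc 2 trivial N
  refine ⟨|C|, abs_nonneg C, fun t ht x y => ?_⟩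
  have h1 : 0 < 1 + x ^ 2 := by positivity
  rw [← div_eq_mul_inv, le_div_iff₀ h1]
  refine le_trans ?_ ((hC t ht x y).trans (le_abs_self C))
  have h2 : 1 + x ^ 2 ≤ (1 + |x|) ^ 2 := by
    have := abs_nonneg x
    have := sq_abs x
    nlinarith
  have h3 : 0 ≤ D.wt y ^ N * ‖f t x y‖ := by
    have := D.one_le_wt y
    positivity
  nlinarith

theorem Bdd.le_inv {f : ℝ → ℝ → ℝ → F} (hf : Bdd D univ f) {K : Set ℝ} (hK : K ⊆ D.T)
    (hKc : IsCompact K) : ∃ C, ∀ t ∈ K, ∀ x y, ‖f t x y‖ ≤ C * (1 + x ^ 2)⁻¹ := by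
  obtain ⟨C, _, hC⟩ := hf.le_mul hK hKc 0
  exact ⟨C, fun t ht x y => by simpa using hC t ht x y⟩

theorem Bdd.le_inv_wt {f : ℝ → ℝ → ℝ → F} (hf : Bdd D {0} f) {K : Set ℝ} (hK : K ⊆ D.T)
    (hKc : IsCompact K) : ∃ C, ∀ t ∈ K, ∀ x y, ‖f t x y‖ ≤ C * (D.wt y ^ 2)⁻¹ := by
  obtain ⟨C, hC⟩ := hf K hK hKc 0 rfl 2
  refine ⟨C, fun t ht x y => ?_⟩
  have h1 := D.one_le_wt y
  have h2 : 0 < D.wt y ^ 2 := by positivity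
  rw [← div_eq_mul_inv, le_div_iff₀ h2]
  have := hC t ht x y
  simp only [pow_zero, one_mul] at this
  linarith

theorem Bdd.le_inv_inv {f : ℝ → ℝ → ℝ → F} (hf : Bdd D univ f) {K : Set ℝ} (hK : K ⊆ D.T)
    (hKc : IsCompact K) : ∃ C, ∀ t ∈ K, ∀ x y,
      ‖f t x y‖ ≤ C * ((1 + x ^ 2)⁻¹ * (D.wt y ^ 2)⁻¹) := by
  obtain ⟨C, _, hC⟩ := hf.le_mul hK hKc 2
  refine ⟨C, fun t ht x y => ?_⟩
  have h1 := D.one_le_wt y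
  have h2 : 0 < D.wt y ^ 2 := by positivity
  rw [← mul_assoc, ← div_eq_mul_inv _ (D.wt y ^ 2), le_div_iff₀ h2]
  have := hC t ht x y
  linarith

theorem Ctl.tendsto_atTop {f : ℝ → ℝ → ℝ → ℝ} (hf : Ctl D univ f) {t : ℝ} (ht : t ∈ D.T)
    (y : ℝ) : Tendsto (fun x => f t x y) atTop (𝓝 0) ∧
      Tendsto (fun x => f t x y) atBot (𝓝 0) := by
  obtain ⟨C, hC⟩ := (hf.bdd 0).zero.le_inv (K := {t}) (by simpa using ht) isCompact_singleton
  have h1 : ∀ l : Filter ℝ, Tendsto (fun x : ℝ => x ^ 2) l atTop →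
      Tendsto (fun x => f t x y) l (𝓝 0) := fun l hl => by
    refine squeeze_zero_norm (fun x => hC t rfl x y) ?_
    have h2 : Tendsto (fun x : ℝ => 1 + x ^ 2) l atTop := tendsto_atTop_add_const_left _ 1 hl
    simpa using (tendsto_inv_atTop_zero.comp h2).const_mul C
  exact ⟨h1 _ (tendsto_pow_atTop two_ne_zero),
    h1 _ (by simpa [Function.comp_def, neg_sq] using
      (tendsto_pow_atTop (α := ℝ) two_ne_zero).comp tendsto_neg_atBot_atTop)⟩

theorem Ctl.skew {f : ℝ → ℝ → ℝ → ℝ} (hf : Ctl D univ f) {t : ℝ} (ht : t ∈ D.T) (y : ℝ) :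
    Skew (fun x => f t x y) :=
  Skew.of_zero (hf.tendsto_atTop ht y).1 (hf.tendsto_atTop ht y).2

/-- The derivative in `y` of a field with opposite limits and rapidly decreasing derivative
in `x`. -/
theorem skew_dy {a : ℝ → ℝ → ℝ → ℝ} (hs : SmoothOn D.Ω a)
    (hsk : ∀ t ∈ D.T, ∀ y, Skew (fun x => a t x y)) (ha : Ctl D univ (dx a)) :
    ∀ t ∈ D.T, ∀ y, Skew (fun x => dy a t x y) := by
  intro t ht y
  refine Skew.deriv_param isOpen_univ (f := fun s x => a t x s) (g := fun s x => dy a t x s)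
    (g' := fun s x => dy (dx a) t x s) (fun s _ => hsk t ht s)
    (fun s _ x => hs.hasPd D.isOpen_Ω (D.mem ht x s) .y) (fun s _ x => ?_) (fun K _ _ => ?_)
    (mem_univ y)
  · have := (hs.pd D.isOpen_Ω .y).hasPd D.isOpen_Ω (D.mem ht x s) .x
    rwa [hs.pd_comm D.isOpen_Ω (D.mem ht x s)] at this
  · obtain ⟨C, hC⟩ := (ha.dy.bdd 0).zero.le_inv (K := {t}) (by simpa using ht)
      isCompact_singleton
    exact ⟨C, fun s _ x => hC t rfl x s⟩

/-- A field with opposite limits is controlled if its derivative in `x` is rapidly decreasing. -/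
theorem Ctl.of_dx {a : ℝ → ℝ → ℝ → ℝ} (hs : SmoothOn D.Ω a)
    (hsk : ∀ t ∈ D.T, ∀ y, Skew (fun x => a t x y)) (ha : Ctl D univ (SurfaceFlow.dx a)) :
    Ctl D {0} a where
  smooth := hs
  per t ht x y := by
    -- Periodicity is inherited from the `x`-derivative: the difference of the two translates is
    -- constant in `x` and skew.
    have h := ((hsk t ht (y + D.p)).sub (hsk t ht y)).eq_zero (fun x => ?_) x
    · linarith
    · have h1 := (hs.hasPd D.isOpen_Ω (D.mem ht x (y + D.p)) .x)
      have h2 := (hs.hasPd D.isOpen_Ω (D.mem ht x y) .x)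
      have h3 := HasDerivAt.sub h1 h2
      have h4 : SurfaceFlow.pd Dir.x a t x (y + D.p) = SurfaceFlow.pd Dir.x a t x y :=
        ha.per t ht x y
      rwa [h4, sub_self] at h3
  bdd m := by
    have h0 : ∀ {a : ℝ → ℝ → ℝ → ℝ}, SmoothOn D.Ω a →
        (∀ t ∈ D.T, ∀ y, Skew (fun x => a t x y)) → Ctl D univ (SurfaceFlow.dx a) →
        Bdd D {0} a := by
      intro a hs hsk ha K hK hKc M hM N
      obtain rfl : M = 0 := hM
      obtain ⟨C, hC0, hC⟩ := (ha.bdd 0).zero.le_mul hK hKc N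
      refine ⟨C * Real.pi, fun t ht x y => ?_⟩
      have h1 := D.one_le_wt y
      have h2 : 0 < D.wt y ^ N := by positivity
      -- The `y`-weight is put into the constant, so decay in `y` passes from the `x`-derivative to
      -- the field even though the field need not decay in `x`.
      have h3 := (hsk t (hK ht) y).abs_le (C := C / D.wt y ^ N)
        (fun x => hs.hasPd D.isOpen_Ω (D.mem (hK ht) x y) .x) (fun x => ?_) x
      · rw [pow_zero, one_mul, Real.norm_eq_abs]
        calc D.wt y ^ N * |a t x y| ≤ D.wt y ^ N * (C / D.wt y ^ N * Real.pi) :=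
              mul_le_mul_of_nonneg_left h3 h2.le
          _ = C * Real.pi := by field_simp
      · rw [div_mul_eq_mul_div, le_div_iff₀ h2, mul_comm]
        exact hC t ht x y
    induction m generalizing a with
    | zero => exact h0 hs hsk ha
    | succ m ih =>
      refine ⟨h0 hs hsk ha, (ha.bdd m).mono (subset_univ _),
        ih (hs.pd D.isOpen_Ω .y) (skew_dy hs hsk ha) ?_⟩
      exact ha.dy.congr fun t ht x y => hs.pd_comm D.isOpen_Ω (D.mem ht x y) .x .y

end Bounds

end SurfaceFlow

namespace SurfaceFlow

/-! ### Integrals of controlled fields -/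

section Integrals

variable {D : Dom} {t : ℝ} {f : ℝ → ℝ → ℝ → ℝ}

theorem Dom.integrableOn_wt (D : Dom) : IntegrableOn (fun y => (D.wt y ^ 2)⁻¹) D.Y := by
  rcases D.cases with ⟨h1, -, h3⟩ | ⟨h1, -, h3⟩
  · have hm : Continuous (fun y : ℝ => ((1 + |y|) ^ 2)⁻¹) := by
      refine Continuous.inv₀ (by fun_prop) fun y => ?_
      positivity
    simp only [Dom.wt, h1, h3, one_mul, integrableOn_univ]
    refine integrable_inv_one_add_sq.mono' hm.aestronglyMeasurable (ae_of_all _ fun y => ?_)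
    rw [Real.norm_of_nonneg (by positivity)]
    refine inv_anti₀ (by positivity) ?_
    have := abs_nonneg y
    have := sq_abs y
    nlinarith
  · simp only [Dom.wt, h1, h3, zero_mul, add_zero, one_pow, inv_one]
    exact integrableOn_const (by simp)

theorem SmoothOn.continuous_slice (hf : SmoothOn D.Ω f) (ht : t ∈ D.T) :
    Continuous (fun p : ℝ × ℝ => f t p.1 p.2) := by
  have h : Continuous (fun p : ℝ × ℝ => (t, p.1, p.2)) := by fun_prop
  exact ContinuousOn.comp_continuous hf.continuousOn h fun p => D.mem ht p.1 p.2

theorem SmoothOn.continuous_y (hf : SmoothOn D.Ω f) (ht : t ∈ D.T) (x : ℝ) :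
    Continuous (fun y => f t x y) :=
  (hf.continuous_slice ht).comp (by fun_prop : Continuous fun y : ℝ => (x, y))

theorem SmoothOn.continuous_x (hf : SmoothOn D.Ω f) (ht : t ∈ D.T) (y : ℝ) :
    Continuous (fun x => f t x y) :=
  (hf.continuous_slice ht).comp (by fun_prop : Continuous fun x : ℝ => (x, y))

theorem Ctl.le_wt_slice (hf : Ctl D {0} f) (ht : t ∈ D.T) :
    ∃ C, ∀ x y, ‖f t x y‖ ≤ C * (D.wt y ^ 2)⁻¹ := by
  obtain ⟨C, hC⟩ := (hf.bdd 0).zero.le_inv_wt (K := {t}) (by simpa using ht) isCompact_singleton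
  exact ⟨C, hC t rfl⟩

theorem Ctl.integrableOn_y (hf : Ctl D {0} f) (ht : t ∈ D.T) (x : ℝ) :
    IntegrableOn (fun y => f t x y) D.Y := by
  obtain ⟨C, hC⟩ := hf.le_wt_slice ht
  exact (D.integrableOn_wt.const_mul C).mono' (hf.smooth.continuous_y ht x).aestronglyMeasurable
    (ae_of_all _ fun y => hC x y)

/-- The boundary values vanish by decay on the line and cancel by periodicity on the circle. No
decay in `x` is needed, so fluxes such as the coefficients are allowed. -/
theorem Ctl.integral_dy (hf : Ctl D {0} f) (ht : t ∈ D.T) (x : ℝ) :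
    ∫ y in D.Y, SurfaceFlow.dy f t x y = 0 := by
  have hd : ∀ y, HasDerivAt (fun y => f t x y) (SurfaceFlow.dy f t x y) y := fun y =>
    hf.smooth.hasPd D.isOpen_Ω (D.mem ht x y) .y
  have hi := hf.dy.integrableOn_y ht x
  rcases D.cases with ⟨h1, -, h3⟩ | ⟨h1, h2, h3⟩
  · rw [h3] at hi ⊢
    rw [integrableOn_univ] at hi
    rw [setIntegral_univ]
    obtain ⟨C, hC⟩ := hf.le_wt_slice ht
    have hlim : ∀ l : Filter ℝ, Tendsto (fun y : ℝ => |y|) l atTop →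
        Tendsto (fun y => f t x y) l (𝓝 0) := fun l hl => by
      refine squeeze_zero_norm (fun y => hC x y) ?_
      have h2 : Tendsto (fun y : ℝ => (1 + |y|) ^ 2) l atTop :=
        (tendsto_pow_atTop two_ne_zero).comp (tendsto_atTop_add_const_left _ 1 hl)
      simpa [Dom.wt, h1] using (tendsto_inv_atTop_zero.comp h2).const_mul C
    rw [integral_of_hasDerivAt_of_tendsto hd hi (hlim _ tendsto_abs_atBot_atTop)
      (hlim _ tendsto_abs_atTop_atTop), sub_zero]
  · rw [h3] at hi ⊢
    rw [← intervalIntegral.integral_of_le h2.le,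
      intervalIntegral.integral_eq_sub_of_hasDerivAt (fun y _ => hd y)
        ((intervalIntegrable_iff_integrableOn_Ioc_of_le h2.le).2 hi)]
    have := hf.per t ht x 0
    rw [zero_add] at this
    rw [this, sub_self]

theorem Ctl.hasDerivAt_integral_x (hf : Ctl D {0} f) (ht : t ∈ D.T) (x : ℝ) :
    HasDerivAt (fun x => ∫ y in D.Y, f t x y) (∫ y in D.Y, SurfaceFlow.dx f t x y) x := by
  obtain ⟨C, hC⟩ := hf.dx.le_wt_slice ht
  exact (hasDerivAt_integral_of_dominated_loc_of_deriv_le (s := univ) univ_mem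
    (Eventually.of_forall fun x => (hf.smooth.continuous_y ht x).aestronglyMeasurable)
    (hf.integrableOn_y ht x) (hf.dx.smooth.continuous_y ht x).aestronglyMeasurable
    (ae_of_all _ fun y x _ => hC x y) (D.integrableOn_wt.const_mul C)
    (ae_of_all _ fun y x _ => hf.smooth.hasPd D.isOpen_Ω (D.mem ht x y) .x)).2

theorem Ctl.hasDerivAt_integral_t (hf : Ctl D {0} f) {g : ℝ → ℝ → ℝ → ℝ} (hg : Ctl D {0} g)
    (hfg : ∀ t ∈ D.T, ∀ x y, dt f t x y = g t x y) (ht : t ∈ D.T) (x : ℝ) :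
    HasDerivAt (fun t => ∫ y in D.Y, f t x y) (∫ y in D.Y, g t x y) t := by
  obtain ⟨K, hK, htK, hKT⟩ := exists_compact_subset D.isOpen ht
  obtain ⟨C, hC⟩ := (hg.bdd 0).zero.le_inv_wt hKT hK
  refine (hasDerivAt_integral_of_dominated_loc_of_deriv_le (s := interior K)
    (F := fun t y => f t x y) (F' := fun t y => g t x y)
    (isOpen_interior.mem_nhds htK) ?_ (hf.integrableOn_y ht x)
    (hg.smooth.continuous_y ht x).aestronglyMeasurable
    (ae_of_all _ fun y s hs => hC s (interior_subset hs) x y) (D.integrableOn_wt.const_mul C)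
    (ae_of_all _ fun y s hs => ?_)).2
  · filter_upwards [D.isOpen.mem_nhds ht] with s hs
    exact (hf.smooth.continuous_y hs x).aestronglyMeasurable
  · have hs' := hKT (interior_subset hs)
    rw [← hfg s hs' x y]
    exact hf.smooth.hasPd D.isOpen_Ω (D.mem hs' x y) .t

theorem Ctl.abs_integral_le (hf : Ctl D univ f) {K : Set ℝ} (hK : K ⊆ D.T)
    (hKc : IsCompact K) :
    ∃ C, ∀ t ∈ K, ∀ x, ‖∫ y in D.Y, f t x y‖ ≤ C * (1 + x ^ 2)⁻¹ := by
  obtain ⟨C, hC⟩ := (hf.bdd 0).zero.le_inv_inv hK hKc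
  refine ⟨C * ∫ y in D.Y, (D.wt y ^ 2)⁻¹, fun t ht x => ?_⟩
  calc ‖∫ y in D.Y, f t x y‖ ≤ ∫ y in D.Y, C * (1 + x ^ 2)⁻¹ * (D.wt y ^ 2)⁻¹ :=
        norm_integral_le_of_norm_le (D.integrableOn_wt.const_mul _)
          (ae_of_all _ fun y => by rw [mul_assoc]; exact hC t ht x y)
    _ = C * (∫ y in D.Y, (D.wt y ^ 2)⁻¹) * (1 + x ^ 2)⁻¹ := by
        rw [integral_const_mul]
        ring

theorem Ctl.continuous_integral (hf : Ctl D {0} f) (ht : t ∈ D.T) :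
    Continuous (fun x => ∫ y in D.Y, f t x y) :=
  continuous_iff_continuousAt.2 fun x => (hf.hasDerivAt_integral_x ht x).continuousAt

theorem Ctl.integrable_integral (hf : Ctl D univ f) (ht : t ∈ D.T) :
    Integrable (fun x => ∫ y in D.Y, f t x y) := by
  obtain ⟨C, hC⟩ := hf.abs_integral_le (K := {t}) (by simpa using ht) isCompact_singleton
  exact (integrable_inv_one_add_sq.const_mul C).mono'
    (hf.mono.continuous_integral ht).aestronglyMeasurable (ae_of_all _ fun x => hC t rfl x)

theorem Ctl.integrable_x (hf : Ctl D univ f) (ht : t ∈ D.T) (y : ℝ) :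
    Integrable (fun x => f t x y) := by
  obtain ⟨C, hC⟩ := (hf.bdd 0).zero.le_inv (K := {t}) (by simpa using ht) isCompact_singleton
  exact (integrable_inv_one_add_sq.const_mul C).mono'
    (hf.smooth.continuous_x ht y).aestronglyMeasurable (ae_of_all _ fun x => hC t rfl x y)

theorem Ctl.integral_swap (hf : Ctl D univ f) (ht : t ∈ D.T) :
    ∫ x, ∫ y in D.Y, f t x y = ∫ y in D.Y, ∫ x, f t x y := by
  obtain ⟨C, hC⟩ := (hf.bdd 0).zero.le_inv_inv (K := {t}) (by simpa using ht) isCompact_singleton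
  refine integral_integral_swap ?_
  refine ((integrable_inv_one_add_sq.mul_prod D.integrableOn_wt).const_mul C).mono'
    (hf.smooth.continuous_slice ht).aestronglyMeasurable (ae_of_all _ fun p => hC t rfl p.1 p.2)

theorem Ctl.converges (hf : Ctl D univ f) (ht : t ∈ D.T) : Converges D.Y f t :=
  ⟨fun x => hf.mono.integrableOn_y ht x, hf.integrable_integral ht⟩

/-- A field with opposite limits, whose derivative in `x` is `F_x + G_y`, has the same integral
over `y` as `F`. -/
theorem Ctl.integral_eq_of_dx {a F G : ℝ → ℝ → ℝ → ℝ} (ha : Ctl D {0} a)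
    (hsk : ∀ t ∈ D.T, ∀ y, Skew (fun x => a t x y)) (hF : Ctl D univ F) (hG : Ctl D {0} G)
    (h : ∀ t ∈ D.T, ∀ x y, SurfaceFlow.dx a t x y =
      SurfaceFlow.dx F t x y + SurfaceFlow.dy G t x y) (ht : t ∈ D.T) (x : ℝ) :
    ∫ y in D.Y, a t x y = ∫ y in D.Y, F t x y := by
  have hb := ha.sub (hF.mono (μ := {0}))
  have hbs : ∀ y, Skew (fun x => a t x y - F t x y) := fun y => (hsk t ht y).sub (hF.skew ht y)
  have h1 : ∀ x, HasDerivAt (fun x => ∫ y in D.Y, (a t x y - F t x y)) 0 x := fun x => by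
    have h2 := hb.hasDerivAt_integral_x ht x
    have h3 : ∀ y, SurfaceFlow.dx (fun t x y => a t x y - F t x y) t x y =
        SurfaceFlow.dy G t x y := fun y => by
      have : SurfaceFlow.dx (fun t x y => a t x y - F t x y) t x y = _ :=
        ((ha.smooth.hasPd D.isOpen_Ω (D.mem ht x y) .x).sub
          (hF.smooth.hasPd D.isOpen_Ω (D.mem ht x y) .x)).pd_eq
      rw [this]
      have h4 : SurfaceFlow.pd .x a t x y = _ := h t ht x y
      rw [h4]
      exact add_sub_cancel_left _ _
    simp only [h3] at h2
    rwa [hG.integral_dy ht x] at h2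
  -- The pointwise opposite limits pass through the integral over `y` by dominated convergence;
  -- together with constancy in `x` this forces the integral to vanish.
  have h2 : Skew (fun x => ∫ y in D.Y, (a t x y - F t x y)) := by
    choose l hl1 hl2 using hbs
    obtain ⟨C, hC⟩ := hb.le_wt_slice ht
    have hm : ∀ x, AEStronglyMeasurable (fun y => a t x y - F t x y) (volume.restrict D.Y) :=
      fun x => (hb.smooth.continuous_y ht x).aestronglyMeasurable
    refine ⟨∫ y in D.Y, l y, ?_, ?_⟩
    · exact tendsto_integral_filter_of_dominated_convergence _ (Eventually.of_forall hm)
        (Eventually.of_forall fun x => ae_of_all _ fun y => hC x y)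
        (D.integrableOn_wt.const_mul C) (ae_of_all _ hl1)
    · rw [← integral_neg]
      exact tendsto_integral_filter_of_dominated_convergence _ (Eventually.of_forall hm)
        (Eventually.of_forall fun x => ae_of_all _ fun y => hC x y)
        (D.integrableOn_wt.const_mul C) (ae_of_all _ hl2)
  have h3 := h2.eq_zero h1 x
  rw [integral_sub (ha.integrableOn_y ht x) (hF.mono.integrableOn_y ht x)] at h3
  linarith

/-- A conservation law for a field whose integral over `y` is rapidly decreasing. -/
theorem Ctl.hasDerivAt_total {a F G J : ℝ → ℝ → ℝ → ℝ} (ha : Ctl D {0} a) (hF : Ctl D univ F)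
    (haF : ∀ t ∈ D.T, ∀ x, ∫ y in D.Y, a t x y = ∫ y in D.Y, F t x y) (hG : Ctl D {0} G)
    (hJ : Ctl D univ J) (hJ0 : ∀ t ∈ D.T, ∀ y, ∫ x, J t x y = 0)
    (h : ∀ t ∈ D.T, ∀ x y, dt a t x y = SurfaceFlow.dy G t x y - J t x y) (ht : t ∈ D.T) :
    HasDerivAt (total D.Y a) 0 t := by
  have h1 : ∀ t ∈ D.T, ∀ x,
      HasDerivAt (fun t => ∫ y in D.Y, a t x y) (∫ y in D.Y, - J t x y) t := fun t ht x => by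
    have h2 := ha.hasDerivAt_integral_t (hG.dy.sub (hJ.mono (μ := {0}))) h ht x
    rw [integral_sub (hG.dy.integrableOn_y ht x) (hJ.mono.integrableOn_y ht x),
      hG.integral_dy ht x, zero_sub, ← integral_neg] at h2
    exact h2
  obtain ⟨K, hK, htK, hKT⟩ := exists_compact_subset D.isOpen ht
  obtain ⟨C, hC⟩ := hJ.neg.abs_integral_le hKT hK
  have h3 := (hasDerivAt_integral_of_dominated_loc_of_deriv_le (μ := volume) (s := interior K)
    (F := fun t x => ∫ y in D.Y, a t x y) (F' := fun t x => ∫ y in D.Y, - J t x y)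
    (bound := fun x => C * (1 + x ^ 2)⁻¹) (x₀ := t)
    (isOpen_interior.mem_nhds htK) ?_ ?_ ?_
    (ae_of_all _ fun x s hs => hC s (interior_subset hs) x)
    (integrable_inv_one_add_sq.const_mul C)
    (ae_of_all _ fun x s hs => h1 s (hKT (interior_subset hs)) x)).2
  -- The source `J` integrates to zero in `x` for each `y`, whereas `total` integrates over `y`
  -- first; Fubini reverses the order.
  · rw [hJ.neg.integral_swap ht] at h3
    simp only [integral_neg, hJ0 t ht, neg_zero, integral_zero] at h3
    exact h3
  · filter_upwards [D.isOpen.mem_nhds ht] with s hs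
    exact (ha.continuous_integral hs).aestronglyMeasurable
  · simp only [haF t ht]
    exact hF.integrable_integral ht
  · exact (hJ.neg.mono.continuous_integral ht).aestronglyMeasurable

end Integrals

end SurfaceFlow

namespace SurfaceFlow

/-! ### The local hierarchy -/

section LocalHierarchy

variable {D : Dom} {μ : Set ℕ} {t x y : ℝ} {u : ℝ → ℝ → ℝ → ℂ}

theorem Ctl.mul' {𝔸 : Type*} [NormedCommRing 𝔸] [NormedAlgebra ℝ 𝔸] {f g : ℝ → ℝ → ℝ → 𝔸}
    (hf : Ctl D {0} f) (hg : Ctl D μ g) : Ctl D μ (fun t x y => f t x y * g t x y) :=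
  (hg.mul hf).congr fun _ _ _ _ => mul_comm _ _

theorem Ctl.ofReal_mul {f : ℝ → ℝ → ℝ → ℝ} {g : ℝ → ℝ → ℝ → ℂ}
    (hf : Ctl D {0} f) (hg : Ctl D μ g) : Ctl D μ (fun t x y => (f t x y : ℂ) * g t x y) :=
  hf.ofReal.mul' hg

/-- The hierarchy that starts with `-iu`, with coefficients given by the quadratic relation between
its terms. -/
noncomputable def localHier (u : ℝ → ℝ → ℝ → ℂ) : ℕ → (ℝ → ℝ → ℝ → ℂ) × (ℝ → ℝ → ℝ → ℝ)
  | 0 => (fun t x y => - Complex.I * u t x y, fun _ _ _ => 0)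
  | k + 1 => (fun t x y => Complex.I *
      (dx (localHier u k).1 t x y - (localHier u k).2 t x y * u t x y),
      fun t x y => - (1 / 2) * ∑ i : Fin (k + 1),
        (rp ((localHier u i).1 t x y) ((localHier u (k - i)).1 t x y)
          + (localHier u i).2 t x y * (localHier u (k - i)).2 t x y))
decreasing_by all_goals omega

/-- The fields and coefficients of the local hierarchy. -/
noncomputable def locW (u : ℝ → ℝ → ℝ → ℂ) (k : ℕ) : ℝ → ℝ → ℝ → ℂ := (localHier u k).1

noncomputable def locA (u : ℝ → ℝ → ℝ → ℂ) (k : ℕ) : ℝ → ℝ → ℝ → ℝ := (localHier u k).2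

theorem locW_zero : locW u 0 = fun t x y => - Complex.I * u t x y := by
  rw [locW, localHier]

theorem locA_zero : locA u 0 = fun _ _ _ => 0 := by
  rw [locA, localHier]

theorem locW_succ (k : ℕ) : locW u (k + 1) = fun t x y =>
    Complex.I * (dx (locW u k) t x y - locA u k t x y * u t x y) := by
  rw [locW, localHier]
  rfl

theorem locA_succ (k : ℕ) : locA u (k + 1) = fun t x y => - (1 / 2) *
    ∑ i ∈ Finset.range (k + 1), (rp (locW u i t x y) (locW u (k - i) t x y)
      + locA u i t x y * locA u (k - i) t x y) := by
  rw [locA, localHier]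
  funext t x y
  rw [Finset.sum_range]
  rfl

/-- The terms are built from `u` by products and `x`-derivatives alone, without antiderivatives;
therefore, unlike the coefficients of the hierarchy starting with `u_y`, these coefficients decay
rapidly in `x`. -/
theorem ctl_localHier (hu : Ctl D univ u) (k : ℕ) :
    Ctl D univ (locW u k) ∧ Ctl D univ (locA u k) := by
  induction k using Nat.strong_induction_on with
  | _ k ih =>
    rcases k with _ | k
    · rw [locW_zero, locA_zero]
      exact ⟨hu.const_mul _, Ctl.zero⟩
    · rw [locW_succ, locA_succ]
      refine ⟨((ih k k.lt_succ_self).1.dx.sub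
        ((ih k k.lt_succ_self).2.mono.ofReal_mul hu)).const_mul _, (Ctl.sum fun i hi => ?_).const_mul _⟩
      have hi' := Finset.mem_range.1 hi
      exact ((ih i hi').1.rp (ih (k - i) (by omega)).1.mono).add
        ((ih i hi').2.mul (ih (k - i) (by omega)).2.mono)

theorem laxHier_local (hu : Ctl D univ u) : LaxHier D.Ω u (locW u) (locA u) := by
  have hs : ∀ k t x y, locW u (k + 1) t x y = Complex.I *
      (dx (locW u k) t x y - locA u k t x y * u t x y) := fun k t x y => by rw [locW_succ]
  refine ⟨fun k => (ctl_localHier hu k).1.smooth, fun k => (ctl_localHier hu k).2.smooth,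
    fun k t x y _ => hs k t x y, fun k => ?_⟩
  have hW : ∀ k t x y, (t, x, y) ∈ D.Ω → HasPd .x (locW u k)
      (- Complex.I * locW u (k + 1) t x y + locA u k t x y * u t x y) t x y :=
    fun k t x y hp => by
      have h := (ctl_localHier hu k).1.smooth.hasPd D.isOpen_Ω hp .x
      convert h using 1
      rw [hs]
      change _ = dx (locW u k) t x y
      linear_combination (-(dx (locW u k) t x y - locA u k t x y * u t x y)) * Complex.I_sq
  suffices h : ∀ t x y, (t, x, y) ∈ D.Ω →
      HasPd .x (locA u k) (- rp (u t x y) (locW u k t x y)) t x y from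
    fun t x y hp => (h t x y hp).pd_eq
  induction k using Nat.strong_induction_on with
  | _ k ih =>
    intro t x y hp
    rcases k with _ | k
    · rw [locW_zero, locA_zero]
      convert HasPd.const (i := .x) (t := t) (x := x) (y := y) (0 : ℝ) using 1
      simp [rp_eq]
      ring
    · have h1 : HasPd .x (fun t x y => - (1 / 2) *
          ∑ i ∈ Finset.range (k + 1), (rp (locW u i t x y) (locW u (k - i) t x y)
            + locA u i t x y * locA u (k - i) t x y)) _ t x y :=
        (HasPd.const (-(1 / 2) : ℝ)).mul (HasPd.sum (s := Finset.range (k + 1)) (i := .x)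
          (f := fun i t x y => rp (locW u i t x y) (locW u (k - i) t x y)
            + locA u i t x y * locA u (k - i) t x y)
          fun i hi => hasPd_rp_add_mul (hW i t x y hp)
            (ih i (Finset.mem_range.1 hi) t x y hp) (hW (k - i) t x y hp)
            (ih (k - i) (by omega) t x y hp))
      -- The derivative of the quadratic sum telescopes. The two ends are equal by antisymmetry, and
      -- since the bottom term is `-iu` each of them is `Re(ū V)` with `V` the term of index `k +
      -- 1`; the factor `-1/2` in the definition compensates the double count.
      have h2 : ∑ i ∈ Finset.range (k + 1),
          (-ip (locW u (i + 1) t x y) (locW u (k - i) t x y)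
            + ip (locW u i t x y) (locW u (k - i + 1) t x y)) =
          2 * rp (u t x y) (locW u (k + 1) t x y) := by
        have h3 := Finset.sum_range_sub
          (fun i => ip (locW u i t x y) (locW u (k + 1 - i) t x y)) (k + 1)
        have h4 : ∀ i ∈ Finset.range (k + 1),
            -ip (locW u (i + 1) t x y) (locW u (k - i) t x y)
              + ip (locW u i t x y) (locW u (k - i + 1) t x y) =
            - (ip (locW u (i + 1) t x y) (locW u (k + 1 - (i + 1)) t x y)
              - ip (locW u i t x y) (locW u (k + 1 - i) t x y)) := fun i hi => by
          have := Finset.mem_range.1 hi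
          rw [show k - i + 1 = k + 1 - i by omega, show k + 1 - (i + 1) = k - i by omega]
          ring
        rw [Finset.sum_congr rfl h4, Finset.sum_neg_distrib, h3, Nat.sub_self, Nat.sub_zero,
          ip_comm (locW u (k + 1) t x y), locW_zero, ip_eq, rp_eq]
        simp
        ring
      rw [locA_succ]
      convert h1 using 1
      rw [h2]
      ring

/-- Rapidly decreasing fields of the form `F_x + G_y`. -/
def ExactField (D : Dom) (f : ℝ → ℝ → ℝ → ℝ) : Prop :=
  ∃ F G, Ctl D univ F ∧ Ctl D univ G ∧ ∀ t ∈ D.T, ∀ x y, f t x y = dx F t x y + dy G t x y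

namespace ExactField

variable {f g : ℝ → ℝ → ℝ → ℝ}

theorem congr (hf : ExactField D f) (h : ∀ t ∈ D.T, ∀ x y, g t x y = f t x y) :
    ExactField D g := by
  obtain ⟨F, G, hF, hG, hFG⟩ := hf
  exact ⟨F, G, hF, hG, fun t ht x y => by rw [h t ht, hFG t ht]⟩

theorem dx (hf : Ctl D univ f) : ExactField D (dx f) :=
  ⟨f, fun _ _ _ => 0, hf, Ctl.zero, fun t _ x y => by
    have h : SurfaceFlow.dy (fun _ _ _ => (0 : ℝ)) t x y = 0 :=
      (HasPd.const (i := .y) (t := t) (x := x) (y := y) (0 : ℝ)).pd_eq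
    rw [h, add_zero]⟩

theorem dy (hf : Ctl D univ f) : ExactField D (dy f) :=
  ⟨fun _ _ _ => 0, f, Ctl.zero, hf, fun t _ x y => by
    have h : SurfaceFlow.dx (fun _ _ _ => (0 : ℝ)) t x y = 0 :=
      (HasPd.const (i := .x) (t := t) (x := x) (y := y) (0 : ℝ)).pd_eq
    rw [h, zero_add]⟩

theorem add (hf : ExactField D f) (hg : ExactField D g) :
    ExactField D (fun t x y => f t x y + g t x y) := by
  obtain ⟨F, G, hF, hG, hFG⟩ := hf
  obtain ⟨F', G', hF', hG', hFG'⟩ := hg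
  refine ⟨_, _, hF.add hF', hG.add hG', fun t ht x y => ?_⟩
  have hp := D.mem ht x y
  have h1 : SurfaceFlow.dx (fun t x y => F t x y + F' t x y) t x y = _ :=
    ((hF.smooth.hasPd D.isOpen_Ω hp .x).add (hF'.smooth.hasPd D.isOpen_Ω hp .x)).pd_eq
  have h2 : SurfaceFlow.dy (fun t x y => G t x y + G' t x y) t x y = _ :=
    ((hG.smooth.hasPd D.isOpen_Ω hp .y).add (hG'.smooth.hasPd D.isOpen_Ω hp .y)).pd_eq
  change f t x y + g t x y = _
  rw [h1, h2, hFG t ht, hFG' t ht]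
  simp only [pd]
  ring

theorem const_mul (hf : ExactField D f) (c : ℝ) : ExactField D (fun t x y => c * f t x y) := by
  obtain ⟨F, G, hF, hG, hFG⟩ := hf
  refine ⟨_, _, hF.const_mul c, hG.const_mul c, fun t ht x y => ?_⟩
  have hp := D.mem ht x y
  have h1 : SurfaceFlow.dx (fun t x y => c * F t x y) t x y = _ :=
    ((HasPd.const c).mul (hF.smooth.hasPd D.isOpen_Ω hp .x)).pd_eq
  have h2 : SurfaceFlow.dy (fun t x y => c * G t x y) t x y = _ :=
    ((HasPd.const c).mul (hG.smooth.hasPd D.isOpen_Ω hp .y)).pd_eq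
  change c * f t x y = _
  rw [h1, h2, hFG t ht]
  simp only [pd]
  ring

theorem sum {ι : Type*} {s : Finset ι} {f : ι → ℝ → ℝ → ℝ → ℝ}
    (hf : ∀ i ∈ s, ExactField D (f i)) : ExactField D (fun t x y => ∑ i ∈ s, f i t x y) := by
  classical
  induction s using Finset.induction_on with
  | empty =>
    refine (dx (f := fun _ _ _ => 0) Ctl.zero).congr fun t _ x y => ?_
    exact ((HasPd.const (i := .x) (t := t) (x := x) (y := y) (0 : ℝ)).pd_eq).symm
  | insert i s hi ih =>
    simp only [Finset.sum_insert hi]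
    exact (hf i (Finset.mem_insert_self i s)).add
      (ih fun j hj => hf j (Finset.mem_insert_of_mem hj))

end ExactField

end LocalHierarchy

/-! ### The hierarchy over a rapidly decreasing field -/

/-- The hierarchy over a rapidly decreasing field `u` that starts with `u_y`, with coefficients
given by the skew-symmetric inverse of `D_x`. -/
structure SkewHier (D : Dom) (u : ℝ → ℝ → ℝ → ℂ) (W : ℕ → ℝ → ℝ → ℝ → ℂ)
    (a : ℕ → ℝ → ℝ → ℝ → ℝ) : Prop where
  ctl : Ctl D univ u
  lax : LaxHier D.Ω u W a
  zero : ∀ t ∈ D.T, ∀ x y, W 0 t x y = dy u t x y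
  skew : ∀ k, ∀ t ∈ D.T, ∀ y, Skew (fun x => a k t x y)

namespace SkewHier

variable {D : Dom} {u : ℝ → ℝ → ℝ → ℂ} {W : ℕ → ℝ → ℝ → ℝ → ℂ} {a : ℕ → ℝ → ℝ → ℝ → ℝ}
  {t x y : ℝ} (hW : SkewHier D u W a)
include hW

theorem ctl_coef_of {k : ℕ} (h : Ctl D univ (W k)) : Ctl D {0} (a k) :=
  Ctl.of_dx (hW.lax.smooth_coef k) (hW.skew k)
    ((hW.ctl.rp h.mono).neg.congr fun t ht x y => hW.lax.dx_coef k t x y (D.mem ht x y))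

/-- Fields and coefficients are controlled alternately: a decaying field gives a coefficient with
decaying `x`-derivative, which skewness makes bounded in `x`; its product with `u` decays again. -/
theorem ctlW (k : ℕ) : Ctl D univ (W k) := by
  induction k with
  | zero => exact hW.ctl.dy.congr hW.zero
  | succ k ih =>
    exact ((ih.dx.sub ((hW.ctl_coef_of ih).ofReal_mul hW.ctl)).const_mul Complex.I).congr
      fun t ht x y => hW.lax.succ k t x y (D.mem ht x y)

theorem ctlA (k : ℕ) : Ctl D {0} (a k) := hW.ctl_coef_of (hW.ctlW k)

theorem integral_ip_succ (k l : ℕ) (ht : t ∈ D.T) (y : ℝ) :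
    ∫ x, ip (W (k + 1) t x y) (W l t x y) = ∫ x, ip (W k t x y) (W (l + 1) t x y) := by
  have hi : ∀ k l, Integrable (fun x => ip (W k t x y) (W l t x y)) := fun k l =>
    ((hW.ctlW k).ip (hW.ctlW l).mono).integrable_x ht y
  obtain ⟨c, h1, h2⟩ := hW.skew k t ht y
  obtain ⟨d, h3, h4⟩ := hW.skew l t ht y
  have hr := ((hW.ctlW k).rp (hW.ctlW l).mono).tendsto_atTop ht y
  have h5 := hr.2.add (h2.mul h4)
  -- The limits of `a_k a_l` at `∞` and `-∞` are `cd` and `(-c)(-d)`; their equality is where the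
  -- skew-symmetric inverse is used.
  rw [neg_mul_neg] at h5
  have h := integral_of_hasDerivAt_of_tendsto
    (fun x => hW.lax.hasPd_pairing D.isOpen_Ω hW.lax k l (D.mem ht x y))
    ((hi (k + 1) l).neg.add (hi k (l + 1))) h5 (hr.1.add (h1.mul h3))
  have h' := integral_add (f := fun x => -ip (W (k + 1) t x y) (W l t x y))
    (g := fun x => ip (W k t x y) (W (l + 1) t x y)) (hi (k + 1) l).neg (hi k (l + 1))
  rw [h, sub_self, integral_neg] at h'
  linarith

/-- The integral depends on `k + l` alone, hence is symmetric in the two indices; it is also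
antisymmetric. -/
theorem integral_ip (k l : ℕ) (ht : t ∈ D.T) (y : ℝ) :
    ∫ x, ip (W k t x y) (W l t x y) = 0 := by
  have h : ∀ k l, ∫ x, ip (W k t x y) (W l t x y) = ∫ x, ip (W 0 t x y) (W (k + l) t x y) := by
    intro k
    induction k with
    | zero => intro l; rw [zero_add]
    | succ k ih =>
      intro l
      rw [hW.integral_ip_succ k l ht y, ih (l + 1), show k + (l + 1) = k + 1 + l by ring]
  have h1 : ∫ x, ip (W k t x y) (W l t x y) = - ∫ x, ip (W l t x y) (W k t x y) := by
    rw [← integral_neg]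
    congr 1
    funext x
    exact ip_comm _ _
  have h2 := h l k
  rw [add_comm l k, ← h k l] at h2
  linarith

/-- The sums of products with the local hierarchy are derivatives in `y`. -/
theorem commA_local (k : ℕ) (ht : t ∈ D.T) (x y : ℝ) :
    LaxHier.commA W (locW u) k t x y = dy (locA u k) t x y := by
  have hL := laxHier_local hW.ctl
  -- The derivation is the infinitesimal phase rotation: it multiplies `u` and all `W k` by `-i` and
  -- fixes the coefficients. Its value on `u` is the bottom term of the local hierarchy, and the
  -- formula for the coefficients becomes the claim.
  have h := (LaxHier.derivation_eq D.isOpen_Ω hW.ctl.smooth hW.lax hL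
    (fun t x y hp => hW.zero t hp.1 x y) (δW := fun k t x y => - Complex.I * W k t x y)
    (δa := fun _ _ _ _ => 0) (fun t x y hp => ?_) (fun k t x y hp => ?_) (fun k t x y hp => ?_)
    (fun k hk t x y hp => ?_) k).2 t x y (D.mem ht x y)
  · linarith
  · have h1 : dy (locW u 0) t x y = 0 * u t x y + - Complex.I * dy u t x y := by
      rw [locW_zero]
      exact ((HasPd.const (- Complex.I)).mul
        (hW.ctl.smooth.hasPd D.isOpen_Ω hp .y)).pd_eq
    rw [h1, hW.zero t hp.1]
    change _ = 0 * _ + - Complex.I * dy u t x y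
    ring
  · have h1 : dx (fun t x y => - Complex.I * W k t x y) t x y = _ :=
      ((HasPd.const (- Complex.I)).mul ((hW.lax.smooth k).hasPd D.isOpen_Ω hp .x)).pd_eq
    rw [h1, locW_zero, hW.lax.succ k t x y hp]
    simp only [pd]
    push_cast
    ring
  · have h1 : dx (fun _ _ _ => (0 : ℝ)) t x y = 0 := (HasPd.const (i := .x) (t := t) (x := x) (y := y) (0 : ℝ)).pd_eq
    rw [h1, locW_zero]
    simp [rp_eq]
  · have hC : Ctl D univ (fun t x y => dy (locA u k) t x y - LaxHier.commA W (locW u) k t x y) :=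
      (ctl_localHier hW.ctl k).2.dy.sub
        (Ctl.sum fun i _ => (hW.ctlW i).ip (ctl_localHier hW.ctl _).1.mono)
    have ht' : t ∈ D.T := hp.1
    refine ((hC.skew ht' y).eq_zero (fun x => ?_) x).symm
    have h1 : dx (fun _ _ _ => (0 : ℝ)) t x y = 0 := (HasPd.const (i := .x) (t := t) (x := x) (y := y) (0 : ℝ)).pd_eq
    have h2 := hk t x y (D.mem hp.1 x y)
    rw [h1] at h2
    have h3 := hC.smooth.hasPd D.isOpen_Ω (D.mem ht' x y) .x
    have h4 : pd .x (fun t x y => dy (locA u k) t x y - LaxHier.commA W (locW u) k t x y) t x y =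
        0 := h2.symm
    rwa [h4] at h3

/-- The densities `Re (ū W_k)` are exact. -/
theorem exact_rp (k : ℕ) : ExactField D (fun t x y => rp (u t x y) (W k t x y)) := by
  have hL := laxHier_local hW.ctl
  have hB := fun k => ctl_localHier hW.ctl k
  set J : ℕ → ℝ → ℝ → ℝ → ℝ := fun i t x y => ip (W i t x y) (locW u (k - i) t x y) with hJ
  -- Neighbouring products differ by an `x`-derivative. The local coefficient in `hP` makes the
  -- differentiated quantity decay in `x` although `a i` is merely bounded there.
  have hstep : ∀ i, i < k → ExactField D (fun t x y => J (i + 1) t x y + - 1 * J i t x y) := by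
    intro i hi
    have hP : Ctl D univ (fun t x y => rp (W i t x y) (locW u (k - (i + 1)) t x y)
        + a i t x y * locA u (k - (i + 1)) t x y) :=
      ((hW.ctlW i).rp (hB _).1.mono).add ((hW.ctlA i).mul' (hB _).2)
    refine ((ExactField.dx hP).const_mul (-1)).congr fun t ht x y => ?_
    have h1 : dx (fun t x y => rp (W i t x y) (locW u (k - (i + 1)) t x y)
        + a i t x y * locA u (k - (i + 1)) t x y) t x y = _ :=
      (hW.lax.hasPd_pairing D.isOpen_Ω hL i (k - (i + 1)) (D.mem ht x y)).pd_eq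
    rw [h1]
    simp only [hJ]
    rw [show k - (i + 1) + 1 = k - i by omega]
    ring
  have hdiff : ∀ m i, i + m = k → ExactField D (fun t x y => J k t x y + - 1 * J i t x y) := by
    intro m
    induction m with
    | zero =>
      intro i hi
      rw [add_zero] at hi
      subst hi
      refine (ExactField.dx (f := fun _ _ _ => 0) Ctl.zero).congr fun t _ x y => ?_
      have : dx (fun _ _ _ => (0 : ℝ)) t x y = 0 := (HasPd.const (i := .x) (t := t) (x := x) (y := y) (0 : ℝ)).pd_eq
      rw [this]
      ring
    | succ m ih =>
      intro i hi
      refine ((ih (i + 1) (by omega)).add (hstep i (by omega))).congr fun t _ x y => ?_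
      ring
  have hsum : ExactField D (fun t x y => ∑ i ∈ Finset.range (k + 1), J i t x y) :=
    (ExactField.dy (hB (k + 1)).2).congr fun t ht x y => by
      rw [← hW.commA_local (k + 1) ht x y, LaxHier.commA]
      rfl
  have hall := (ExactField.sum (s := Finset.range (k + 1))
    (f := fun i t x y => J k t x y + - 1 * J i t x y) fun i hi =>
      hdiff (k - i) i (by have := Finset.mem_range.1 hi; omega)).add hsum
  -- All `k + 1` products are equal modulo exact fields and their sum is a `y`-derivative, so `k +
  -- 1` times the last one, which is `-Re(ū W_k)`, is exact.
  refine (hall.const_mul (-(1 / (k + 1 : ℝ)))).congr fun t _ x y => ?_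
  rw [Finset.sum_add_distrib, ← Finset.mul_sum, Finset.sum_const, Finset.card_range]
  have h1 : J k t x y = - rp (u t x y) (W k t x y) := by
    simp only [hJ, Nat.sub_self, locW_zero]
    simp [rp_eq, ip_eq]
    ring
  have h2 : (k + 1 : ℝ) ≠ 0 := by positivity
  rw [h1, nsmul_eq_mul]
  push_cast
  field_simp
  ring

/-- Exactness of `-Re(ū W_k)`, the `x`-derivative of the coefficient, replaces `a k` under the
`y`-integral by a field that decays in `x`. -/
theorem exists_integral_eq (k : ℕ) : ∃ F, Ctl D univ F ∧
    ∀ t ∈ D.T, ∀ x, ∫ y in D.Y, a k t x y = ∫ y in D.Y, F t x y := by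
  obtain ⟨F, G, hF, hG, hFG⟩ := (hW.exact_rp k).const_mul (-1)
  refine ⟨F, hF, fun t ht x => (hW.ctlA k).integral_eq_of_dx (hW.skew k) hF hG.mono
    (fun t ht x y => ?_) ht x⟩
  rw [hW.lax.dx_coef k t x y (D.mem ht x y), ← hFG t ht x y]
  ring

theorem converges (k : ℕ) (ht : t ∈ D.T) : Converges D.Y (a k) t := by
  obtain ⟨F, hF, h⟩ := hW.exists_integral_eq k
  refine ⟨fun x => (hW.ctlA k).integrableOn_y ht x, ?_⟩
  simp only [h t ht]
  exact hF.integrable_integral ht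

/-- Conservation under the evolution `u_t = W_n - i c u`. -/
theorem hasDerivAt_total {c : ℝ → ℝ → ℝ → ℝ} {n : ℕ} (hc : SmoothOn D.Ω c)
    (hcx : ∀ t ∈ D.T, ∀ x y, dx c t x y = 0) (hcy : ∀ t ∈ D.T, ∀ x y, dy c t x y = 0)
    (hu : ∀ t ∈ D.T, ∀ x y, dt u t x y = W n t x y - Complex.I * c t x y * u t x y)
    (k : ℕ) (ht : t ∈ D.T) : HasDerivAt (total D.Y (a k)) 0 t := by
  have hO := D.isOpen_Ω
  have hQ := hW.lax.shift n
  have hcomm : ∀ k, Ctl D univ (LaxHier.commA W (fun k => W (k + n)) k) := fun k =>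
    Ctl.sum fun i _ => (hW.ctlW i).ip (hW.ctlW _).mono
  have hut : ∀ t x y, (t, x, y) ∈ D.Ω →
      dt u t x y + Complex.I * c t x y * u t x y = W n t x y := fun t x y hp => by
    rw [hu t hp.1]
    ring
  have hIc : SmoothOn D.Ω (fun t x y => Complex.I * (c t x y : ℂ)) :=
    (SmoothOn.const Complex.I).mul hc.ofReal
  have hIcx : ∀ {t x y}, (t, x, y) ∈ D.Ω → HasPd .x (fun t x y => Complex.I * (c t x y : ℂ)) 0
      t x y := fun {t x y} hp => by
    have h := (HasPd.const Complex.I).mul (hc.hasPd hO hp .x).ofReal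
    rw [show pd .x c t x y = 0 from hcx t hp.1 x y] at h
    simpa using h
  have hIcy : ∀ {t x y}, (t, x, y) ∈ D.Ω → HasPd .y (fun t x y => Complex.I * (c t x y : ℂ)) 0
      t x y := fun {t x y} hp => by
    have h := (HasPd.const Complex.I).mul (hc.hasPd hO hp .y).ofReal
    rw [show pd .y c t x y = 0 from hcy t hp.1 x y] at h
    simpa using h
  -- The derivation is `∂_t` corrected by the phase rotation `ic`. As `c` is constant in space, the
  -- correction commutes with `∂_x` and `∂_y` and does not affect the coefficients; on `u` the value
  -- is `W n`, the bottom of the shifted hierarchy.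
  have key := (LaxHier.derivation_eq hO hW.ctl.smooth hW.lax hQ
    (fun t x y hp => hW.zero t hp.1 x y)
    (δW := fun k t x y => dt (W k) t x y + Complex.I * c t x y * W k t x y)
    (δa := fun k => dt (a k)) (fun t x y hp => ?_) (fun k t x y hp => ?_) (fun k t x y hp => ?_)
    (fun k hk t x y hp => ?_) k).2
  · obtain ⟨F, hF, hFa⟩ := hW.exists_integral_eq k
    exact (hW.ctlA k).hasDerivAt_total hF hFa (hW.ctlA (k + n)) (hcomm k)
      (fun t ht y => by
        simp only [LaxHier.commA]
        rw [integral_finsetSum _ fun i _ =>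
          ((hW.ctlW i).ip (hW.ctlW _).mono).integrable_x ht y]
        exact Finset.sum_eq_zero fun i _ => hW.integral_ip _ _ ht y)
      (fun t ht x y => key t x y (D.mem ht x y)) ht
  · have h1 : dt (W 0) t x y = dt (dy u) t x y :=
      pd_congr hO (fun t x y hp => hW.zero t hp.1 x y) hp .t
    have h2 : pd .t (pd .y u) t x y = _ := hW.ctl.smooth.pd_comm hO hp .t .y
    have h3 : dy (fun t x y => dt u t x y + Complex.I * c t x y * u t x y) t x y = _ :=
      (((hW.ctl.smooth.pd hO .t).hasPd hO hp .y).add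
        ((hIcy hp).mul (hW.ctl.smooth.hasPd hO hp .y))).pd_eq
    have h4 : dy (fun t x y => dt u t x y + Complex.I * c t x y * u t x y) t x y =
        dy (W n) t x y := pd_congr hO hut hp .y
    simp only [zero_add]
    rw [← h4, h3, h1, hW.zero t hp.1, show dt (dy u) t x y = _ from h2]
    simp only [pd]
    ring
  · have h1 : dt (W (k + 1)) t x y = _ := (pd_congr hO (hW.lax.succ k) hp .t).trans
      ((HasPd.const Complex.I).mul ((((hW.lax.smooth k).pd hO .x).hasPd hO hp .t).sub
        (((hW.lax.smooth_coef k).hasPd hO hp .t).ofReal.mul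
          (hW.ctl.smooth.hasPd hO hp .t)))).pd_eq
    have h2 : dx (fun t x y => dt (W k) t x y + Complex.I * c t x y * W k t x y) t x y = _ :=
      (((((hW.lax.smooth k).pd hO .t).hasPd hO hp .x)).add
        ((hIcx hp).mul ((hW.lax.smooth k).hasPd hO hp .x))).pd_eq
    have h3 := (hW.lax.smooth k).pd_comm hO hp .t .x
    simp only [zero_add]
    change pd .t (dx (W k)) t x y = _ at h3
    rw [h1, h2, ← hut t x y hp, hW.lax.succ k t x y hp]
    change 0 * _ + Complex.I * (pd .t (dx (W k)) t x y - _) + _ = _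
    rw [h3]
    simp only [pd]
    ring
  · have h1 : dx (dt (a k)) t x y = _ := ((hW.lax.smooth_coef k).pd_comm hO hp .x .t).trans
      ((pd_congr (f := pd .x (a k)) hO (hW.lax.dx_coef k) hp .t).trans
        ((hW.ctl.smooth.hasPd hO hp .t).rp ((hW.lax.smooth k).hasPd hO hp .t)).neg.pd_eq)
    simp only [zero_add]
    rw [h1, ← hut t x y hp]
    simp [rp_eq, pd]
    ring
  -- `R` is the predicted value of `∂_t a_k`, with the same `x`-derivative. Equality follows once
  -- both are skew; for `∂_t a_k` the decay of `R_x` provides the locally uniform bound required for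
  -- differentiating the limits in `t`.
  · set R : ℝ → ℝ → ℝ → ℝ := fun t x y =>
      dy (a (k + n)) t x y - LaxHier.commA W (fun k => W (k + n)) k t x y with hR
    have hsk : ∀ t ∈ D.T, ∀ y, Skew (fun x => R t x y) := fun t ht y =>
      (skew_dy (hW.lax.smooth_coef _) (hW.skew _) ((hW.ctl.rp (hW.ctlW _).mono).neg.congr
        fun t ht x y => hW.lax.dx_coef _ t x y (D.mem ht x y)) t ht y).sub
        ((hcomm k).skew ht y)
    have hRs : SmoothOn D.Ω R := (hW.ctlA (k + n)).dy.smooth.sub (hcomm k).smooth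
    have hRx : Ctl D univ (dx R) := by
      have h1 : Ctl D univ (fun t x y => dy (fun t x y => - rp (u t x y) (W (k + n) t x y)) t x y
          - dx (LaxHier.commA W (fun k => W (k + n)) k) t x y) :=
        (hW.ctl.rp (hW.ctlW (k + n)).mono).neg.dy.sub (hcomm k).dx
      refine h1.congr fun t ht x y => ?_
      have hp := D.mem ht x y
      have h2 : dx R t x y = _ := (((hW.ctlA (k + n)).dy.smooth.hasPd hO hp .x).sub
        ((hcomm k).smooth.hasPd hO hp .x)).pd_eq
      rw [h2, show pd .x (dy (a (k + n))) t x y = _ from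
        (hW.lax.smooth_coef (k + n)).pd_comm hO hp .x .y,
        pd_congr (f := pd .x (a (k + n))) hO (hW.lax.dx_coef (k + n)) hp]
      rfl
    have hta : Skew (fun x => dt (a k) t x y) := by
      refine Skew.deriv_param D.isOpen (f := fun t x => a k t x y)
        (g := fun t x => dt (a k) t x y) (g' := fun t x => dx R t x y)
        (fun t ht => hW.skew k t ht y)
        (fun t ht x => (hW.lax.smooth_coef k).hasPd hO (D.mem ht x y) .t) (fun t ht x => ?_)
        (fun K hK hKc => ?_) hp.1
      · rw [← hk t x y (D.mem ht x y)]
        exact ((hW.lax.smooth_coef k).pd hO .t).hasPd hO (D.mem ht x y) .x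
      · obtain ⟨C, hC⟩ := (hRx.bdd 0).zero.le_inv hK hKc
        exact ⟨C, fun t ht x => hC t ht x y⟩
    have h := (hta.sub (hsk t hp.1 y)).eq_zero (fun x => ?_) x
    · linarith
    · have h1 := (((hW.lax.smooth_coef k).pd hO .t).hasPd hO (D.mem hp.1 x y) .x).sub
        (hRs.hasPd hO (D.mem hp.1 x y) .x)
      rw [show pd .x (pd .t (a k)) t x y = _ from hk t x y (D.mem hp.1 x y)] at h1
      change HasPd .x _ (pd .x R t x y - pd .x R t x y) t x y at h1
      rw [sub_self] at h1
      exact h1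

end SkewHier

end SurfaceFlow

namespace SurfaceFlow

/-! ### Global surfaces -/

theorem abs_rp_le (z w : ℂ) : |rp z w| ≤ ‖z‖ * ‖w‖ := by
  refine (Complex.abs_re_le_norm _).trans ?_
  rw [norm_mul, Complex.norm_conj]

theorem abs_ip_le (z w : ℂ) : |ip z w| ≤ ‖z‖ * ‖w‖ := by
  refine (Complex.abs_im_le_norm _).trans ?_
  rw [norm_mul, Complex.norm_conj]

theorem Skew.of_le {f : ℝ → ℝ} {C : ℝ} (h : ∀ x, |f x| ≤ C * (1 + x ^ 2)⁻¹) : Skew f := by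
  have h1 : ∀ l : Filter ℝ, Tendsto (fun x : ℝ => x ^ 2) l atTop → Tendsto f l (𝓝 0) :=
    fun l hl => by
      refine squeeze_zero_norm h ?_
      have h2 : Tendsto (fun x : ℝ => 1 + x ^ 2) l atTop := tendsto_atTop_add_const_left _ 1 hl
      simpa using (tendsto_inv_atTop_zero.comp h2).const_mul C
  exact Skew.of_zero (h1 _ (tendsto_pow_atTop two_ne_zero))
    (h1 _ (by simpa [Function.comp_def, neg_sq] using
      (tendsto_pow_atTop (α := ℝ) two_ne_zero).comp tendsto_neg_atBot_atTop))

/-- The bottom term of the hierarchy is bounded in `x`. -/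
theorem LaxHier.exists_bound {D : Dom} {u : ℝ → ℝ → ℝ → ℂ} {W : ℕ → ℝ → ℝ → ℝ → ℂ}
    {a : ℕ → ℝ → ℝ → ℝ → ℝ} (hW : LaxHier D.Ω u W a) (hu : Ctl D univ u)
    (h1 : ∀ t ∈ D.T, ∀ x y, W 1 t x y = dy u t x y) (y : ℝ) {K : Set ℝ} (hK : K ⊆ D.T)
    (hKc : IsCompact K) :
    ∃ B, 0 ≤ B ∧ ∀ t ∈ K, ∀ x, ‖W 0 t x y‖ ≤ B ∧ |a 0 t x y| ≤ B := by
  -- The bottom term need not decay, so a Gronwall argument is used: `E_x = 2 Im(W̄_0 u_y)` contains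
  -- no coefficient, and `2|W_0| ≤ 1 + E` bounds the derivative of `log(1 + E)` by `|u_y|`, which is
  -- integrable in `x`.
  set E : ℝ → ℝ → ℝ → ℝ := fun t x y => rp (W 0 t x y) (W 0 t x y) + a 0 t x y * a 0 t x y with hE
  have hEn : ∀ t x y, E t x y = ‖W 0 t x y‖ ^ 2 + a 0 t x y ^ 2 := fun t x y => by
    simp only [hE, rp_eq]
    rw [← Complex.normSq_eq_norm_sq, Complex.normSq_apply]
    ring
  have hE0 : ∀ t x y, 0 < 1 + E t x y := fun t x y => by
    rw [hEn]
    positivity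
  have hEs : SmoothOn D.Ω E :=
    ((hW.smooth 0).rp (hW.smooth 0)).add ((hW.smooth_coef 0).mul (hW.smooth_coef 0))
  obtain ⟨C, hC⟩ := (hu.dy.bdd 0).zero.le_inv hK hKc
  have hd : ∀ t ∈ K, ∀ x, HasDerivAt (fun x => Real.log (1 + E t x y))
      ((- ip (W 1 t x y) (W 0 t x y) + ip (W 0 t x y) (W 1 t x y)) / (1 + E t x y)) x :=
    fun t ht x => ((hW.hasPd_pairing D.isOpen_Ω hW 0 0 (D.mem (hK ht) x y)).const_add 1).log
      (hE0 t x y).ne'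
  have hb : ∀ t ∈ K, ∀ x, |(- ip (W 1 t x y) (W 0 t x y) + ip (W 0 t x y) (W 1 t x y)) /
      (1 + E t x y)| ≤ C * (1 + x ^ 2)⁻¹ := fun t ht x => by
    refine le_trans ?_ (hC t ht x y)
    rw [abs_div, abs_of_pos (hE0 t x y), div_le_iff₀ (hE0 t x y), ip_comm (W 1 t x y), neg_neg,
      ← h1 t (hK ht), ← two_mul, abs_mul, abs_two]
    have h2 := abs_ip_le (W 0 t x y) (W 1 t x y)
    have h3 := norm_nonneg (W 1 t x y)
    rw [hEn]
    nlinarith [sq_nonneg (‖W 0 t x y‖ - 1), mul_nonneg h3 (sq_nonneg (a 0 t x y)),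
      mul_nonneg h3 (sq_nonneg (‖W 0 t x y‖ - 1))]
  have hcont : ContinuousOn (fun t => Real.log (1 + E t 0 y)) K := by
    refine ContinuousOn.log (continuousOn_const.add ?_) fun t _ => (hE0 t 0 y).ne'
    exact hEs.continuousOn.comp (f := fun t => (t, (0 : ℝ), y)) (by fun_prop)
      fun t ht => D.mem (hK ht) 0 y
  obtain ⟨M, hM⟩ := hKc.bddAbove_image hcont
  have hC0 : ∀ t ∈ K, 0 ≤ C := fun t ht => by
    have := (norm_nonneg _).trans (hC t ht 0 y)
    simpa using this
  have hlog : ∀ t ∈ K, ∀ x, Real.log (1 + E t x y) ≤ M + C * Real.pi := fun t ht x => by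
    have h2 : Real.log (1 + E t 0 y) ≤ M := hM (mem_image_of_mem _ ht)
    have h3 : |Real.log (1 + E t x y) - Real.log (1 + E t 0 y)| ≤ C * Real.pi := by
      have h4 := Real.arctan_lt_pi_div_two x
      have h5 := Real.neg_pi_div_two_lt_arctan x
      have h6 := Real.pi_pos
      rcases le_total 0 x with hx | hx
      · refine (abs_sub_le_arctan (hd t ht) (hb t ht) hx).trans
          (mul_le_mul_of_nonneg_left ?_ (hC0 t ht))
        rw [Real.arctan_zero]
        linarith
      · rw [abs_sub_comm]
        refine (abs_sub_le_arctan (hd t ht) (hb t ht) hx).trans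
          (mul_le_mul_of_nonneg_left ?_ (hC0 t ht))
        rw [Real.arctan_zero]
        linarith
    have := (abs_le.1 h3).2
    linarith
  refine ⟨Real.exp (M + C * Real.pi), (Real.exp_pos _).le, fun t ht x => ?_⟩
  have h2 : 1 + E t x y ≤ Real.exp (M + C * Real.pi) :=
    (Real.log_le_iff_le_exp (hE0 t x y)).1 (hlog t ht x)
  rw [hEn] at h2
  have h3 := sq_abs (a 0 t x y)
  constructor
  · nlinarith [sq_nonneg (‖W 0 t x y‖ - 1), sq_nonneg (a 0 t x y)]
  · nlinarith [sq_nonneg (|a 0 t x y| - 1), sq_nonneg (‖W 0 t x y‖)]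

variable {r : ℝ → ℝ → ℝ → E3} {a : ℕ → ℝ → ℝ → ℝ → ℝ} {ψ : ℝ → ℝ → ℝ → ℝ} {t x y : ℝ}

namespace IsGlobal

theorem exists_dom {T Y : Set ℝ} (hG : IsGlobal T Y r a ψ) :
    ∃ D : Dom, D.T = T ∧ D.Y = Y ∧ Ctl D univ (covU r ψ) := by
  have hT : IsOpen T := by
    have : T = (fun t : ℝ => (t, (0 : ℝ), (0 : ℝ))) ⁻¹' (T ×ˢ univ) := by ext; simp
    rw [this]
    exact hG.surface.isOpen.preimage (by fun_prop)
  have hs : SmoothOn (T ×ˢ univ) (covU r ψ) := hG.angle.smooth.gauge hG.surface.smooth_kap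
  rcases hG.boundary with ⟨hY, hb⟩ | ⟨L, hL, hY, hper, hb⟩
  · refine ⟨⟨T, hT, 1, 0, Y, Or.inl ⟨rfl, rfl, hY⟩⟩, rfl, rfl,
      Ctl.of_iterate hs (fun t _ x y => by rw [add_zero]) fun j l K hK hKc M _ N => ?_⟩
    -- The joint weight dominates `1 + |x|` and `1 + |y|` separately, so the exponent `M + N` yields
    -- the product of the two weights.
    obtain ⟨C, hC⟩ := hb K hK hKc (M + N) j l
    refine ⟨C, fun t ht x y => le_trans ?_ (hC t ht x y)⟩
    refine mul_le_mul_of_nonneg_right ?_ (norm_nonneg _)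
    have hx := abs_nonneg x
    have hy := abs_nonneg y
    rw [pow_add, Dom.wt, one_mul]
    refine mul_le_mul (pow_le_pow_left₀ (by positivity) (by linarith) M)
      (pow_le_pow_left₀ (by positivity) (by linarith) N) (by positivity) (by positivity)
  · refine ⟨⟨T, hT, 0, L, Y, Or.inr ⟨rfl, hL, hY⟩⟩, rfl, rfl,
      Ctl.of_iterate hs hper fun j l K hK hKc M _ N => ?_⟩
    obtain ⟨C, hC⟩ := hb K hK hKc M j l
    exact ⟨C, fun t ht x y => by simpa [Dom.wt] using hC t ht x y⟩

theorem laxHier {T Y : Set ℝ} (hG : IsGlobal T Y r a ψ) :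
    LaxHier (T ×ˢ univ) (covU r ψ) (fun k => gauge ψ (hier r a k)) a where
  smooth k := hG.angle.smooth.gauge (hG.surface.smooth_hier (hG.hierarchy k) k le_rfl)
  smooth_coef k := (hG.hierarchy (k + 1) k k.lt_succ_self).smooth
  succ k _ _ _ hp := gauge_hier_succ hG.surface hG.angle
    (hG.surface.smooth_hier (hG.hierarchy k) k le_rfl) hp
  dx_coef k _ _ _ hp := SurfaceFlow.dx_coef ψ (hG.hierarchy (k + 1)) k.lt_succ_self hp

variable {D : Dom}

/-- The index is shifted by one: adaptedness makes the term of index one equal to `u_y`, whereas the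
bottom term `-i e^{-iψ} K_y` has no decay by assumption. -/
theorem skewHier (hG : IsGlobal D.T D.Y r a ψ) (hu : Ctl D univ (covU r ψ)) :
    SkewHier D (covU r ψ) (fun k => gauge ψ (hier r a (k + 1))) (fun k => a (k + 1)) where
  ctl := hu
  lax := hG.laxHier.shift 1
  zero _ ht x y := gauge_hier_one hG.surface hG.angle hG.adapted (D.mem ht x y)
  skew k := hG.skew (k + 1)

/-- The rotation rate in time of the parallel frame, relative to the skew-symmetric
antiderivative. -/
noncomputable def excess (r : ℝ → ℝ → ℝ → E3) (a : ℕ → ℝ → ℝ → ℝ → ℝ) (ψ : ℝ → ℝ → ℝ → ℝ)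
    (n : ℕ) : ℝ → ℝ → ℝ → ℝ := fun t x y => rotRate .t r ψ t x y - a n t x y

/-! ### The rotation of the parallel frame along a flow. -/

section Flow

variable {m : ℕ} (hG : IsGlobal D.T D.Y r a ψ) (hF : IsFlow (m + 1) D.Ω r a)
include hG hF

theorem smooth_rotRate : SmoothOn D.Ω (rotRate .t r ψ) := (hF.antideriv_rotation hG.angle).smooth

theorem smooth_excess : SmoothOn D.Ω (excess r a ψ (m + 1)) :=
  (hG.smooth_rotRate hF).sub (hG.laxHier.smooth_coef (m + 1))

theorem dx_excess (hp : (t, x, y) ∈ D.Ω) : dx (excess r a ψ (m + 1)) t x y = 0 := by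
  have h : dx (excess r a ψ (m + 1)) t x y = _ := (((hG.smooth_rotRate hF).hasPd D.isOpen_Ω hp
    .x).sub ((hG.laxHier.smooth_coef (m + 1)).hasPd D.isOpen_Ω hp .x)).pd_eq
  rw [h]
  have h1 : pd .x (rotRate .t r ψ) t x y = _ := (hF.antideriv_rotation hG.angle).eq t x y hp
  have h2 : pd .x (a (m + 1)) t x y = _ := (hG.hierarchy (m + 2) (m + 1) (by omega)).eq t x y hp
  rw [h1, h2, sub_self]

theorem dt_covU_eq (hp : (t, x, y) ∈ D.Ω) :
    dt (covU r ψ) t x y = gauge ψ (hier r a (m + 1 + 1)) t x y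
      - Complex.I * excess r a ψ (m + 1) t x y * covU r ψ t x y := by
  rw [dt_covU hF hG.angle hp, hG.laxHier.succ (m + 1) t x y hp, excess]
  push_cast
  ring

/-- The `(y,t)` structure equation for rotation rates: the `y`-rate is `a 0` by adaptedness, and
both gauged components `K_y` and `K_t` are `i` times terms of the hierarchy. -/
theorem dy_excess_eq (hp : (t, x, y) ∈ D.Ω) :
    dy (excess r a ψ (m + 1)) t x y = dt (a 0) t x y - dy (a (m + 1)) t x y
      - ip (gauge ψ (hier r a 0) t x y) (gauge ψ (hier r a (m + 1)) t x y) := by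
  have h : dy (excess r a ψ (m + 1)) t x y = _ := (((hG.smooth_rotRate hF).hasPd D.isOpen_Ω hp
    .y).sub ((hG.laxHier.smooth_coef (m + 1)).hasPd D.isOpen_Ω hp .y)).pd_eq
  have h1 := pd_rotRate_sub hG.surface hG.angle.smooth hp .y .t
  have h2 : pd .t (rotRate .y r ψ) t x y = pd .t (a 0) t x y :=
    pd_congr D.isOpen_Ω (fun t x y hp => (hG.adapted t x y hp).symm) hp .t
  have h3 : gauge ψ (frK .y r) t x y = Complex.I * gauge ψ (hier r a 0) t x y := by
    rw [gauge_hier_zero]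
    linear_combination (gauge ψ (frK .y r) t x y) * Complex.I_sq
  rw [h2, hF.gauge_frK_t hp, h3] at h1
  have h4 : ((starRingEnd ℂ) (Complex.I * gauge ψ (hier r a 0) t x y) *
      (Complex.I * gauge ψ (hier r a (m + 1)) t x y)).im =
      ip (gauge ψ (hier r a 0) t x y) (gauge ψ (hier r a (m + 1)) t x y) := by
    simp [ip_eq]
    ring
  rw [h4] at h1
  rw [h]
  change pd .y _ t x y - pd .y _ t x y = pd .t (a 0) t x y - pd .y _ t x y - _
  linarith

theorem dy_excess (hu : Ctl D univ (covU r ψ)) (ht : t ∈ D.T) (x y : ℝ) :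
    dy (excess r a ψ (m + 1)) t x y = 0 := by
  have hO := D.isOpen_Ω
  have hH := hG.skewHier hu
  have hL : LaxHier D.Ω (covU r ψ) (fun k => gauge ψ (hier r a k)) a := hG.laxHier
  have hW := fun k => hH.ctlW k
  have hA := fun k => hH.ctlA k
  have hdA : Ctl D univ (dx (a (m + 1))) := (hH.ctl.rp (hW m).mono).neg.congr fun t ht x y =>
    hH.lax.dx_coef m t x y (D.mem ht x y)
  have hx0 : ∀ t ∈ D.T, ∀ x, HasDerivAt (fun x => dy (excess r a ψ (m + 1)) t x y) 0 x :=
    fun t ht x => by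
      have h := ((hG.smooth_excess hF).pd hO .y).hasPd hO (D.mem ht x y) .x
      rw [(hG.smooth_excess hF).pd_comm hO (D.mem ht x y),
        pd_congr (f := pd .x (excess r a ψ (m + 1))) (g := fun _ _ _ => 0) hO
          (fun t x y hp => hG.dx_excess hF hp) (D.mem ht x y), (HasPd.const (0 : ℝ)).pd_eq] at h
      exact h
  have hip : ∀ t ∈ D.T, ∀ x, HasDerivAt
      (fun x => ip (gauge ψ (hier r a 0) t x y) (gauge ψ (hier r a (m + 1)) t x y)) _ x :=
    fun t ht x => hL.hasPd_ip hO hL 0 (m + 1) (D.mem ht x y)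
  -- Solving `dy_excess_eq` for `∂_t a_0` gives its `x`-derivative in terms that decay in `x` once
  -- `W_0` and `a_0` are bounded; the constants `C1` to `C5` below belong to the five terms. So `∂_t
  -- a_0` is skew, and with it `∂_y` of the excess, which is constant in `x`.
  have hdt : ∀ t ∈ D.T, ∀ x, HasDerivAt (fun x => dt (a 0) t x y) _ x := fun t ht x => by
    have h1 := ((hx0 t ht x).add ((hA m).dy.smooth.hasPd hO (D.mem ht x y) .x)).add (hip t ht x)
    refine HasDerivAt.congr_of_eventuallyEq h1 (Eventually.of_forall fun x => ?_)
    have := hG.dy_excess_eq hF (D.mem ht x y)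
    simp only [Pi.add_apply]
    linarith
  have hbound : ∀ K ⊆ D.T, IsCompact K → ∃ B, 0 ≤ B ∧ ∀ t ∈ K, ∀ x,
      ‖gauge ψ (hier r a 0) t x y‖ ≤ B ∧ |a 0 t x y| ≤ B := fun K hK hKc =>
    hL.exists_bound hu hH.zero y hK hKc
  have hsk0 : Skew (fun x => dt (a 0) t x y) := by
    refine Skew.deriv_param D.isOpen (f := fun t x => a 0 t x y)
      (fun t ht => hG.skew 0 t ht y)
      (fun t ht x => (hL.smooth_coef 0).hasPd hO (D.mem ht x y) .t) hdt (fun K hK hKc => ?_) ht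
    obtain ⟨B, hB0, hB⟩ := hbound K hK hKc
    obtain ⟨C1, h1⟩ := (hdA.dy.bdd 0).zero.le_inv hK hKc
    obtain ⟨C2, h2⟩ := (((hW 0).rp (hW m).mono).bdd 0).zero.le_inv hK hKc
    obtain ⟨C3, h3⟩ := ((hW (m + 1)).bdd 0).zero.le_inv hK hKc
    obtain ⟨C4, h4⟩ := ((hu.ip (hW m).mono).bdd 0).zero.le_inv hK hKc
    obtain ⟨C5, h5⟩ := (((hA m).ofReal_mul hu).bdd 0).zero.le_inv hK hKc
    refine ⟨C1 + (C2 + B * C3) + (B * C4 + B * C5), fun t ht x => ?_⟩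
    have hc : pd .x (dy (a (m + 1))) t x y = dy (dx (a (m + 1))) t x y :=
      (hL.smooth_coef (m + 1)).pd_comm hO (D.mem (hK ht) x y) .x .y
    have e1 := h1 t ht x y
    have e2 := h2 t ht x y
    have e3 := (abs_rp_le (gauge ψ (hier r a 0) t x y)
      (gauge ψ (hier r a (m + 1 + 1)) t x y)).trans
      (mul_le_mul (hB t ht x).1 (h3 t ht x y) (norm_nonneg _) hB0)
    have e4 : |a 0 t x y * ip (covU r ψ t x y) (gauge ψ (hier r a (m + 1)) t x y)| ≤
        B * (C4 * (1 + x ^ 2)⁻¹) := by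
      rw [abs_mul]
      exact mul_le_mul (hB t ht x).2 (h4 t ht x y) (abs_nonneg _) hB0
    have e5 : |a (m + 1) t x y * ip (covU r ψ t x y) (gauge ψ (hier r a 0) t x y)| ≤
        B * (C5 * (1 + x ^ 2)⁻¹) := by
      have : a (m + 1) t x y * ip (covU r ψ t x y) (gauge ψ (hier r a 0) t x y) =
          ip (a (m + 1) t x y * covU r ψ t x y) (gauge ψ (hier r a 0) t x y) := by
        simp [ip_eq]
        ring
      rw [this, mul_comm B]
      exact (abs_ip_le _ _).trans (mul_le_mul (h5 t ht x y) (hB t ht x).1 (norm_nonneg _)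
        ((norm_nonneg _).trans (h5 t ht x y)))
    rw [Real.norm_eq_abs] at e1 e2
    rw [hc, zero_add]
    rw [abs_le] at e1 e2 e3 e4 e5 ⊢
    constructor <;> linarith
  have hsk1 : Skew (fun x => ip (gauge ψ (hier r a 0) t x y)
      (gauge ψ (hier r a (m + 1)) t x y)) := by
    obtain ⟨B, hB0, hB⟩ := hbound {t} (by simpa using ht) isCompact_singleton
    obtain ⟨C, hC⟩ := ((hW m).bdd 0).zero.le_inv (K := {t}) (by simpa using ht)
      isCompact_singleton
    refine Skew.of_le (C := B * C) fun x => (abs_ip_le _ _).trans ?_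
    rw [mul_assoc]
    exact mul_le_mul (hB t rfl x).1 (hC t rfl x y) (norm_nonneg _) hB0
  have hsk := (hsk0.sub (skew_dy (hL.smooth_coef (m + 1)) (hG.skew (m + 1)) hdA t ht y)).sub hsk1
  refine Skew.eq_zero (f := fun x => dy (excess r a ψ (m + 1)) t x y) ?_ (hx0 t ht) x
  simpa only [← hG.dy_excess_eq hF (D.mem ht _ y)] using hsk

theorem excess_eq (hu : Ctl D univ (covU r ψ)) (ht : t ∈ D.T) (x y : ℝ) :
    excess r a ψ (m + 1) t x y = excess r a ψ (m + 1) t 0 0 := by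
  refine (eq_of_hasDerivAt_zero (f := fun x => excess r a ψ (m + 1) t x y) (fun x => ?_) x 0).trans
    (eq_of_hasDerivAt_zero (f := fun y => excess r a ψ (m + 1) t 0 y) (fun y => ?_) y 0)
  · have h := (hG.smooth_excess hF).hasPd D.isOpen_Ω (D.mem ht x y) .x
    rwa [show pd .x _ t x y = _ from hG.dx_excess hF (D.mem ht x y)] at h
  · have h := (hG.smooth_excess hF).hasPd D.isOpen_Ω (D.mem ht 0 y) .y
    rwa [show pd .y _ t 0 y = _ from hG.dy_excess hF hu ht 0 y] at h

end Flow

theorem exists_rotation {T Y : Set ℝ} {m : ℕ} (hG : IsGlobal T Y r a ψ)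
    (hF : IsFlow (m + 1) (T ×ˢ univ) r a) : ∃ c : ℝ → ℝ, ∀ t ∈ T, ∀ x y : ℝ,
      dt ψ t x y = a m t x y * dx ψ t x y + a (m + 1) t x y
        + (D2 r (hier r a m) t x y).im + c t := by
  obtain ⟨D, rfl, rfl, hu⟩ := hG.exists_dom
  refine ⟨fun t => excess r a ψ (m + 1) t 0 0, fun t ht x y => ?_⟩
  have h : excess r a ψ (m + 1) t x y = frG .t r t x y + dt ψ t x y - a (m + 1) t x y := rfl
  have h1 := hF.dt_psi hG.angle (D.mem ht x y)
  have h2 := hG.excess_eq hF hu ht x y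
  change _ = _ + excess r a ψ (m + 1) t 0 0
  linarith

theorem hasDerivAt_total {T Y : Set ℝ} {m : ℕ} (hG : IsGlobal T Y r a ψ)
    (hF : IsFlow (m + 1) (T ×ˢ univ) r a) (k : ℕ) (ht : t ∈ T) :
    HasDerivAt (total Y (a (k + 1))) 0 t := by
  obtain ⟨D, rfl, rfl, hu⟩ := hG.exists_dom
  -- In the shifted numbering the term `𝒫^{m+2}(ρ - iμ)` that drives `u` has index `m + 1`.
  exact (hG.skewHier hu).hasDerivAt_total (n := m + 1) (hG.smooth_excess hF)
    (fun t ht x y => hG.dx_excess hF (D.mem ht x y)) (fun t ht x y => hG.dy_excess hF hu ht x y)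
    (fun t ht x y => hG.dt_covU_eq hF (D.mem ht x y)) k ht

theorem converges {T Y : Set ℝ} (hG : IsGlobal T Y r a ψ) (k : ℕ) (ht : t ∈ T) :
    Converges Y (a (k + 1)) t := by
  obtain ⟨D, rfl, rfl, hu⟩ := hG.exists_dom
  exact (hG.skewHier hu).converges k ht

end IsGlobal

/-! ### The conserved densities of orders two and three. -/

namespace SkewHier

variable {D : Dom} {u : ℝ → ℝ → ℝ → ℂ} {W : ℕ → ℝ → ℝ → ℝ → ℂ} (hW : SkewHier D u W a)
include hW

/-- The `x`-derivative of the coefficient is `Im(ū u_xy)`, because `Re(ū · iu) = 0`. Splitting it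
evenly between `∂_x Im(ū u_y)` and `∂_y Im(ū u_x)` cancels the terms `Im(ū_x u_y)`. -/
theorem integral_one_eq (ht : t ∈ D.T) (x : ℝ) :
    ∫ y in D.Y, a 1 t x y = ∫ y in D.Y, 1 / 2 * ip (u t x y) (dy u t x y) := by
  have hu := hW.ctl
  refine (hW.ctlA 1).integral_eq_of_dx (hW.skew 1)
    (F := fun t x y => 1 / 2 * ip (u t x y) (dy u t x y))
    (G := fun t x y => 1 / 2 * ip (u t x y) (dx u t x y))
    ((hu.ip hu.dy.mono).const_mul _) ((hu.ip hu.dx.mono).const_mul _).mono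
    (fun t ht x y => ?_) ht x
  have hO := D.isOpen_Ω
  have hp := D.mem ht x y
  have h1 : dx (fun t x y => 1 / 2 * ip (u t x y) (dy u t x y)) t x y = _ :=
    ((HasPd.const (1 / 2 : ℝ)).mul ((hu.smooth.hasPd hO hp .x).ip
      (hu.dy.smooth.hasPd hO hp .x))).pd_eq
  have h2 : dy (fun t x y => 1 / 2 * ip (u t x y) (dx u t x y)) t x y = _ :=
    ((HasPd.const (1 / 2 : ℝ)).mul ((hu.smooth.hasPd hO hp .y).ip
      (hu.dx.smooth.hasPd hO hp .y))).pd_eq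
  have h3 : pd .y (dx u) t x y = pd .x (dy u) t x y := hu.smooth.pd_comm hO hp .y .x
  have h4 : dx (W 0) t x y = pd .x (dy u) t x y :=
    pd_congr hO (fun t x y hp => hW.zero t hp.1 x y) hp .x
  rw [h1, h2, h3, hW.lax.dx_coef 1 t x y hp, hW.lax.succ 0 t x y hp, h4]
  simp [rp_eq, ip_eq, pd]
  ring

/-- Since `2 ∂_x a_0 = -∂_y |u|²`, the quartic part of the derivative is `¼ ∂_y |u|⁴`. Half of it
comes from differentiating `a_0` in the density and half from the `1/8` term of the flux. -/
theorem integral_two_eq (ht : t ∈ D.T) (x : ℝ) :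
    ∫ y in D.Y, a 2 t x y = ∫ y in D.Y, (- rp (dx u t x y) (dy u t x y)
      - 1 / 2 * a 0 t x y * rp (u t x y) (u t x y)) := by
  have hu := hW.ctl
  have hA := hW.ctlA 0
  refine (hW.ctlA 2).integral_eq_of_dx (hW.skew 2)
    (F := fun t x y => - rp (dx u t x y) (dy u t x y) - 1 / 2 * a 0 t x y * rp (u t x y) (u t x y))
    (G := fun t x y => rp (u t x y) (dx (dx u) t x y) + 1 / 2 * rp (dx u t x y) (dx u t x y)
      + 1 / 8 * (rp (u t x y) (u t x y) * rp (u t x y) (u t x y)))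
    ((hu.dx.rp hu.dy.mono).neg.sub ((hA.const_mul _).mul' (hu.rp hu.mono)))
    (((hu.rp hu.dx.dx.mono).add ((hu.dx.rp hu.dx.mono).const_mul _)).add
      (((hu.rp hu.mono).mul (hu.rp hu.mono).mono).const_mul _)).mono (fun t ht x y => ?_) ht x
  have hO := D.isOpen_Ω
  have hp := D.mem ht x y
  have ux := hu.smooth.hasPd hO hp .x
  have uy := hu.smooth.hasPd hO hp .y
  have h1 : dx (fun t x y => - rp (dx u t x y) (dy u t x y)
      - 1 / 2 * a 0 t x y * rp (u t x y) (u t x y)) t x y = _ :=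
    (((hu.dx.smooth.hasPd hO hp .x).rp (hu.dy.smooth.hasPd hO hp .x)).neg.sub
      (((HasPd.const (1 / 2 : ℝ)).mul (hA.smooth.hasPd hO hp .x)).mul (ux.rp ux))).pd_eq
  have h2 : dy (fun t x y => rp (u t x y) (dx (dx u) t x y)
      + 1 / 2 * rp (dx u t x y) (dx u t x y)
      + 1 / 8 * (rp (u t x y) (u t x y) * rp (u t x y) (u t x y))) t x y = _ :=
    (((uy.rp (hu.dx.dx.smooth.hasPd hO hp .y)).add ((HasPd.const (1 / 2 : ℝ)).mul
      ((hu.dx.smooth.hasPd hO hp .y).rp (hu.dx.smooth.hasPd hO hp .y)))).add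
      ((HasPd.const (1 / 8 : ℝ)).mul ((uy.rp uy).mul (uy.rp uy)))).pd_eq
  have h3 : ∀ t x y, (t, x, y) ∈ D.Ω → pd .y (dx u) t x y = pd .x (dy u) t x y :=
    fun t x y hp => hu.smooth.pd_comm hO hp .y .x
  have h4 : ∀ t x y, (t, x, y) ∈ D.Ω → dx (W 0) t x y = pd .x (dy u) t x y := fun t x y hp =>
    pd_congr hO (fun t x y hp => hW.zero t hp.1 x y) hp .x
  have h5 : pd .y (dx (dx u)) t x y = pd .x (dx (dy u)) t x y :=
    (hu.dx.smooth.pd_comm hO hp .y .x).trans (pd_congr hO h3 hp .x)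
  have h6 : dx (W 1) t x y = _ := (pd_congr hO (g := fun t x y =>
      Complex.I * (dx (dy u) t x y - a 0 t x y * u t x y)) (fun t x y hp => by
        rw [hW.lax.succ 0 t x y hp, h4 t x y hp]
        rfl) hp .x).trans
    ((HasPd.const Complex.I).mul ((hu.dy.dx.smooth.hasPd hO hp .x).sub
      ((hA.smooth.hasPd hO hp .x).ofReal.mul ux))).pd_eq
  have h7 : pd .x (a 0) t x y = - rp (u t x y) (dy u t x y) := by
    rw [← hW.zero t ht]
    exact hW.lax.dx_coef 0 t x y hp
  rw [h1, h2, h3 t x y hp, h5, hW.lax.dx_coef 2 t x y hp, hW.lax.succ 1 t x y hp, h6, h7]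
  simp [rp_eq, pd]
  ring

end SkewHier

theorem Converges.congr {Y : Set ℝ} {f g : ℝ → ℝ → ℝ → ℝ} (hf : Converges Y f t)
    (h : ∀ x y, g t x y = f t x y) : Converges Y g t := by
  simpa only [Converges, h] using hf

theorem IsGlobal.densities {T Y : Set ℝ} (hG : IsGlobal T Y r a ψ) (ht : t ∈ T) :
    Converges Y (density2 r ψ) t ∧ total Y (a 2) t = total Y (density2 r ψ) t ∧
      Converges Y (density3 r a ψ) t ∧ total Y (a 3) t = total Y (density3 r a ψ) t := by
  obtain ⟨D, rfl, rfl, hu⟩ := hG.exists_dom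
  have hH := hG.skewHier hu
  have h2 : ∀ x y, density2 r ψ t x y = 1 / 2 * ip (covU r ψ t x y) (dy (covU r ψ) t x y) :=
    fun x y => density2_eq hG.surface hG.angle (D.mem ht x y)
  have h3 : ∀ x y, density3 r a ψ t x y = - rp (dx (covU r ψ) t x y) (dy (covU r ψ) t x y)
      - 1 / 2 * a 1 t x y * rp (covU r ψ t x y) (covU r ψ t x y) :=
    fun x y => density3_eq hG.surface hG.angle (D.mem ht x y)
  have c2 : Ctl D univ (fun t x y => 1 / 2 * ip (covU r ψ t x y) (dy (covU r ψ) t x y)) :=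
    (hu.ip hu.dy.mono).const_mul _
  have c3 : Ctl D univ (fun t x y => - rp (dx (covU r ψ) t x y) (dy (covU r ψ) t x y)
      - 1 / 2 * a 1 t x y * rp (covU r ψ t x y) (covU r ψ t x y)) :=
    (hu.dx.rp hu.dy.mono).neg.sub (((hH.ctlA 0).const_mul _).mul' (hu.rp hu.mono))
  refine ⟨(c2.converges ht).congr h2, ?_, (c3.converges ht).congr h3, ?_⟩
  · simp only [total, h2]
    exact integral_congr_ae (ae_of_all _ fun x => hH.integral_one_eq ht x)
  · simp only [total, h3]
    exact integral_congr_ae (ae_of_all _ fun x => hH.integral_two_eq ht x)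

end SurfaceFlow

namespace SurfaceFlow

/-! ### Hyperbolic functions -/

/-- The hyperbolic secant. -/
noncomputable def sech (x : ℝ) : ℝ := (Real.cosh x)⁻¹

theorem sech_pos (x : ℝ) : 0 < sech x := inv_pos.2 (Real.cosh_pos x)

theorem sech_sq (x : ℝ) : sech x ^ 2 = 1 - Real.tanh x ^ 2 := by
  have h := (Real.cosh_pos x).ne'
  rw [sech, Real.tanh_eq_sinh_div_cosh]
  field_simp
  linarith [Real.cosh_sq x]

theorem sech_le_one (x : ℝ) : sech x ≤ 1 := inv_le_one_of_one_le₀ (Real.one_le_cosh x)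

theorem hasDerivAt_sech (x : ℝ) : HasDerivAt sech (- (sech x * Real.tanh x)) x := by
  have h := (Real.cosh_pos x).ne'
  refine ((Real.hasDerivAt_cosh x).inv h).congr_deriv ?_
  rw [sech, Real.tanh_eq_sinh_div_cosh]
  field_simp

theorem hasDerivAt_tanh (x : ℝ) : HasDerivAt Real.tanh (sech x ^ 2) x := by
  have h := (Real.cosh_pos x).ne'
  have h1 := (Real.hasDerivAt_sinh x).div (Real.hasDerivAt_cosh x) h
  have h2 : Real.tanh = Real.sinh / Real.cosh := funext Real.tanh_eq_sinh_div_cosh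
  rw [h2]
  refine h1.congr_deriv ?_
  rw [sech]
  field_simp
  linarith [Real.cosh_sq x]

theorem contDiff_sech : ContDiff ℝ ∞ sech :=
  Real.contDiff_cosh.inv fun x => (Real.cosh_pos x).ne'

theorem contDiff_tanh : ContDiff ℝ ∞ Real.tanh := by
  have h2 : Real.tanh = fun x => Real.sinh x / Real.cosh x := funext Real.tanh_eq_sinh_div_cosh
  rw [h2]
  exact Real.contDiff_sinh.div Real.contDiff_cosh fun x => (Real.cosh_pos x).ne'

/-- The product of a power and the hyperbolic secant is bounded. -/
theorem exists_pow_mul_sech_le (N : ℕ) : ∃ C, ∀ x : ℝ, (1 + |x|) ^ N * sech x ≤ C := by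
  refine ⟨N.factorial * (2 * Real.exp 1), fun x => ?_⟩
  have h1 := Real.pow_div_factorial_le_exp (1 + |x|) (by positivity) N
  have h2 : (0 : ℝ) < N.factorial := by positivity
  rw [div_le_iff₀ h2, Real.exp_add] at h1
  have h3 : Real.exp |x| ≤ 2 * Real.cosh x := by
    rw [← Real.cosh_abs, Real.cosh_eq]
    have := Real.exp_pos (-|x|)
    linarith
  have h4 := Real.cosh_pos x
  rw [sech, ← div_eq_mul_inv, div_le_iff₀ h4]
  refine h1.trans ?_
  have h5 := Real.exp_pos 1
  nlinarith [mul_le_mul_of_nonneg_left h3 (mul_pos h5 h2).le]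

/-! ### Frame components of vectors -/

theorem inner_cross_cross_eq (a b c d : E3) : inner ℝ (cross a b) (cross c d) =
    inner ℝ a c * inner ℝ b d - inner ℝ a d * inner ℝ b c := by
  simp only [inner_E3]
  simp [cross]
  ring

theorem inner_cross_cyclic (a b c : E3) :
    inner ℝ a (cross b c) = inner ℝ (cross a b) c := by
  simp only [inner_E3]
  simp [cross]
  ring

section Components

variable {Ω : Set (ℝ × ℝ × ℝ)} {r : ℝ → ℝ → ℝ → E3} {t x y : ℝ}

/-- The components of a vector orthogonal to the `x`-lines. -/
noncomputable def comp (r : ℝ → ℝ → ℝ → E3) (t x y : ℝ) (v : E3) : ℂ :=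
  (inner ℝ (eStar r t x y) v : ℝ) + Complex.I * (inner ℝ (eNor r t x y) v : ℝ)

theorem comp_add (v w : E3) : comp r t x y (v + w) = comp r t x y v + comp r t x y w := by
  simp only [comp, inner_add_right]
  push_cast
  ring

theorem comp_smul (c : ℝ) (v : E3) : comp r t x y (c • v) = c * comp r t x y v := by
  simp only [comp, real_inner_smul_right]
  push_cast
  ring

theorem comp_tan : comp r t x y (eTan r t x y) = 0 := by
  rw [comp, real_inner_comm, IsSurface.inner_tan_star, real_inner_comm, IsSurface.inner_tan_nor]
  simp

theorem frK_eq_comp (i : Dir) : frK i r t x y = comp r t x y (pd i (eTan r) t x y) := rfl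

variable (hS : IsSurface Ω r)
include hS

theorem IsSurface.comp_cross (hp : (t, x, y) ∈ Ω) (v : E3) :
    comp r t x y (cross (eTan r t x y) v) = Complex.I * comp r t x y v := by
  have h1 : inner ℝ (eStar r t x y) (cross (eTan r t x y) v) = - inner ℝ (eNor r t x y) v := by
    rw [eStar, inner_cross_cross_eq, hS.inner_tan_tan hp, real_inner_comm,
      IsSurface.inner_tan_nor]
    ring
  rw [comp, comp, h1, inner_cross_cyclic, ← eStar]
  push_cast
  linear_combination (inner ℝ (eNor r t x y) v : ℂ) * (-Complex.I_sq)

theorem IsSurface.pd_frK_comp (hp : (t, x, y) ∈ Ω) (i j : Dir) :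
    pd j (frK i r) t x y = comp r t x y (pd j (pd i (eTan r)) t x y)
      - Complex.I * frG j r t x y * frK i r t x y := by
  rw [hS.pd_frK hp, hS.pd_frA hp, hS.pd_frB hp, comp, frK]
  push_cast
  linear_combination (frG j r t x y * frB i r t x y : ℂ) * Complex.I_sq

theorem IsSurface.conj_kap_mul_kap (hp : (t, x, y) ∈ Ω) :
    (starRingEnd ℂ) (kap r t x y) * kap r t x y =
      (inner ℝ (dx (eTan r) t x y) (dx (eTan r) t x y) : ℝ) := by
  have h := hS.inner_eq hp (dx (eTan r) t x y) (dx (eTan r) t x y)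
  have h1 : inner ℝ (eTan r t x y) (dx (eTan r) t x y) = 0 := hS.inner_tan_pd_tan hp .x
  rw [h, h1, kap, alpha, beta]
  apply Complex.ext <;> simp
  all_goals ring

/-- The relative torsion of the orbits of a rotation. -/
theorem IsSurface.sigma_of_rotation (hp : (t, x, y) ∈ Ω) {w : E3}
    (h1 : dy (eTan r) t x y = cross w (eTan r t x y))
    (h2 : dy (dy r) t x y = cross w (dy r t x y)) (h3 : inner ℝ w (dy r t x y) = 0) :
    sigma r t x y = inner ℝ w (eTan r t x y) := by
  have hA := (hS.area_pos hp).ne'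
  -- The normal component of `r_yy` is written once through `ρ` and `σ`, once as a triple product
  -- with `w`; comparing them leaves `|r_x ∧ r_y|²` times the claim.
  have h4 := hS.inner_nor_pd_dy hp .y
  have hn : ∀ v, inner ℝ (eNor r t x y) v =
      (area r t x y)⁻¹ * inner ℝ (cross (eTan r t x y) (dy r t x y)) v := fun v => by
    rw [eNor, real_inner_smul_left]
    rfl
  have hsq : area r t x y ^ 2 = inner ℝ (dy r t x y) (dy r t x y) - q1 r t x y ^ 2 := by
    rw [area, ← real_inner_self_eq_norm_sq, nrm, inner_cross_cross]
    have := hS.inner_tan_tan hp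
    rw [eTan] at this
    rw [this, q1]
    ring
  have hq : inner ℝ (eTan r t x y) (dy r t x y) = q1 r t x y := rfl
  change inner ℝ (eNor r t x y) (dy (dy r) t x y) = q1 r t x y *
    inner ℝ (eNor r t x y) (dy (eTan r) t x y) + area r t x y * sigma r t x y at h4
  rw [hn, hn, h1, h2, inner_cross_cross_eq, inner_cross_cross_eq, hq,
    real_inner_comm w (dy r t x y), h3, hS.inner_tan_tan hp, real_inner_comm (eTan r t x y),
    hq, real_inner_comm w] at h4
  have h5 : area r t x y ^ 2 * sigma r t x y = area r t x y ^ 2 * inner ℝ w (eTan r t x y) := by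
    rw [hsq]
    field_simp at h4
    rw [hsq] at h4
    linarith
  exact mul_left_cancel₀ (pow_ne_zero 2 hA) h5

end Components

/-! ### A surface of rotation -/

/-- A surface swept out by rotating the filament of a one-soliton solution. -/
noncomputable def sol : ℝ → ℝ → ℝ → E3 := fun _ x y =>
  !₂[x - 8 / 5 * Real.tanh x, 8 / 5 * sech x * Real.cos (y - x / 2),
    8 / 5 * sech x * Real.sin (y - x / 2)]

section Soliton

variable {t x y : ℝ}

theorem hasDerivAt_phase_x : HasDerivAt (fun s : ℝ => y - s / 2) (-(1 / 2)) x := by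
  simpa using ((hasDerivAt_id x).div_const 2).const_sub y

theorem hasDerivAt_phase_y : HasDerivAt (fun s : ℝ => s - x / 2) 1 y :=
  (hasDerivAt_id y).sub_const (x / 2)

theorem eTan_sol : eTan sol = fun _ x y => !₂[1 - 8 / 5 * sech x ^ 2,
    8 / 5 * (sech x * (- Real.tanh x * Real.cos (y - x / 2) + Real.sin (y - x / 2) / 2)),
    8 / 5 * (sech x * (- Real.tanh x * Real.sin (y - x / 2) - Real.cos (y - x / 2) / 2))] := by
  funext t x y
  have hs := (hasDerivAt_sech x).const_mul (8 / 5)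
  refine (hasDerivAt_E3
    (((hasDerivAt_id x).sub ((hasDerivAt_tanh x).const_mul (8 / 5))).congr_deriv rfl)
    ((hs.mul hasDerivAt_phase_x.cos).congr_deriv ?_)
    ((hs.mul hasDerivAt_phase_x.sin).congr_deriv ?_)).deriv <;> ring

theorem dy_sol : dy sol = fun _ x y => !₂[0, -(8 / 5 * sech x * Real.sin (y - x / 2)),
    8 / 5 * sech x * Real.cos (y - x / 2)] := by
  funext t x y
  refine (hasDerivAt_E3 (hasDerivAt_const _ _)
    ((hasDerivAt_phase_y.cos.const_mul _).congr_deriv ?_)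
    ((hasDerivAt_phase_y.sin.const_mul _).congr_deriv ?_)).deriv <;> ring

theorem dy_dy_sol : dy (dy sol) t x y = cross !₂[1, 0, 0] (dy sol t x y) := by
  have h : dy (dy sol) t x y = !₂[0, -(8 / 5 * sech x * Real.cos (y - x / 2)),
      -(8 / 5 * sech x * Real.sin (y - x / 2))] := by
    rw [dy_sol]
    refine (hasDerivAt_E3 (hasDerivAt_const _ _)
      ((hasDerivAt_phase_y.sin.const_mul _).neg.congr_deriv ?_)
      ((hasDerivAt_phase_y.cos.const_mul _).congr_deriv ?_)).deriv <;> ring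
  rw [h, dy_sol]
  ext i
  fin_cases i <;> simp [cross]

theorem dy_eTan_sol : dy (eTan sol) t x y = cross !₂[1, 0, 0] (eTan sol t x y) := by
  have hc := (hasDerivAt_phase_y (x := x) (y := y)).cos
  have hn := (hasDerivAt_phase_y (x := x) (y := y)).sin
  have h : dy (eTan sol) t x y = !₂[0,
      8 / 5 * (sech x * (Real.tanh x * Real.sin (y - x / 2) + Real.cos (y - x / 2) / 2)),
      8 / 5 * (sech x * (- Real.tanh x * Real.cos (y - x / 2) + Real.sin (y - x / 2) / 2))] := by
    rw [eTan_sol]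
    refine (hasDerivAt_E3 (hasDerivAt_const _ _)
      (((((hc.const_mul _).add (hn.div_const 2)).const_mul _).const_mul _).congr_deriv ?_)
      (((((hn.const_mul _).sub (hc.div_const 2)).const_mul _).const_mul _).congr_deriv
        ?_)).deriv <;> ring
  rw [h, eTan_sol]
  ext i
  fin_cases i <;> simp [cross]
  ring

theorem dx_eTan_sol : dx (eTan sol) = fun _ x y => !₂[16 / 5 * sech x ^ 2 * Real.tanh x,
    8 / 5 * (sech x * ((3 / 4 - 2 * sech x ^ 2) * Real.cos (y - x / 2)
      - Real.tanh x * Real.sin (y - x / 2))),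
    8 / 5 * (sech x * ((3 / 4 - 2 * sech x ^ 2) * Real.sin (y - x / 2)
      + Real.tanh x * Real.cos (y - x / 2)))] := by
  funext t x y
  have hs := hasDerivAt_sech x
  have ht := (hasDerivAt_tanh x).neg
  have hc := (hasDerivAt_phase_x (x := x) (y := y)).cos
  have hn := (hasDerivAt_phase_x (x := x) (y := y)).sin
  rw [eTan_sol]
  refine (hasDerivAt_E3 ((((hs.pow 2).const_mul (8 / 5)).const_sub 1).congr_deriv ?_)
    (((hs.mul ((ht.mul hc).add (hn.div_const 2))).const_mul (8 / 5)).congr_deriv ?_)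
    (((hs.mul ((ht.mul hn).sub (hc.div_const 2))).const_mul (8 / 5)).congr_deriv ?_)).deriv
  · simp only [Nat.cast_ofNat, Nat.add_one_sub_one, pow_one]
    ring
  · simp only [Pi.neg_apply, Pi.mul_apply, Pi.add_apply]
    linear_combination (8 / 5 * sech x * Real.cos (y - x / 2)) * sech_sq x
  · simp only [Pi.neg_apply, Pi.mul_apply, Pi.sub_apply]
    linear_combination (8 / 5 * sech x * Real.sin (y - x / 2)) * sech_sq x

/-- The Frenet equation of a filament with curvature `2 sech x` and constant torsion. As `e∥ ∧` acts
as multiplication by `i` on normal components, it gives the logarithmic derivative of `α + iβ`. -/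
theorem dx_dx_eTan_sol : dx (dx (eTan sol)) t x y = (- Real.tanh x) • dx (eTan sol) t x y
    + (-(1 / 2) : ℝ) • cross (eTan sol t x y) (dx (eTan sol) t x y)
    + (-(4 * sech x ^ 2)) • eTan sol t x y := by
  have hs := hasDerivAt_sech x
  have ht := hasDerivAt_tanh x
  have hc := (hasDerivAt_phase_x (x := x) (y := y)).cos
  have hn := (hasDerivAt_phase_x (x := x) (y := y)).sin
  have hk := ((hs.pow 2).const_mul 2).const_sub (3 / 4)
  have h1 := sech_sq x
  have h2 := Real.cos_sq_add_sin_sq (y - x / 2)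
  have h : dx (dx (eTan sol)) t x y = !₂[
      16 / 5 * (sech x ^ 2 * sech x ^ 2 - 2 * sech x ^ 2 * Real.tanh x ^ 2),
      8 / 5 * (-(sech x * Real.tanh x) * ((3 / 4 - 2 * sech x ^ 2) * Real.cos (y - x / 2)
        - Real.tanh x * Real.sin (y - x / 2)) + sech x * (4 * sech x ^ 2 * Real.tanh x *
        Real.cos (y - x / 2) + (3 / 4 - 2 * sech x ^ 2) * Real.sin (y - x / 2) / 2
        - sech x ^ 2 * Real.sin (y - x / 2) + Real.tanh x * Real.cos (y - x / 2) / 2)),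
      8 / 5 * (-(sech x * Real.tanh x) * ((3 / 4 - 2 * sech x ^ 2) * Real.sin (y - x / 2)
        + Real.tanh x * Real.cos (y - x / 2)) + sech x * (4 * sech x ^ 2 * Real.tanh x *
        Real.sin (y - x / 2) - (3 / 4 - 2 * sech x ^ 2) * Real.cos (y - x / 2) / 2
        + sech x ^ 2 * Real.cos (y - x / 2) + Real.tanh x * Real.sin (y - x / 2) / 2))] := by
    rw [dx_eTan_sol]
    refine (hasDerivAt_E3 ((((hs.pow 2).const_mul (16 / 5)).mul ht).congr_deriv ?_)
      (((hs.mul ((hk.mul hc).sub (ht.mul hn))).const_mul (8 / 5)).congr_deriv ?_)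
      (((hs.mul ((hk.mul hn).add (ht.mul hc))).const_mul (8 / 5)).congr_deriv ?_)).deriv
    all_goals
      simp only [Pi.mul_apply, Pi.add_apply, Pi.sub_apply, Pi.pow_apply, Nat.cast_ofNat,
        Nat.add_one_sub_one, pow_one]
      ring
  rw [h, dx_eTan_sol, eTan_sol]
  ext i
  fin_cases i <;> simp [cross] <;> grind

theorem dy_eTan_sol_eq : dy (eTan sol) t x y = (-(2 / 5) : ℝ) • dx (eTan sol) t x y
    + (-(4 / 5 * Real.tanh x)) • cross (eTan sol t x y) (dx (eTan sol) t x y) := by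
  have h1 := sech_sq x
  have h2 := Real.cos_sq_add_sin_sq (y - x / 2)
  rw [dy_eTan_sol, dx_eTan_sol, eTan_sol]
  ext i
  fin_cases i <;> simp [cross] <;> grind

theorem inner_dx_eTan_sol :
    inner ℝ (dx (eTan sol) t x y) (dx (eTan sol) t x y) = 4 * sech x ^ 2 := by
  have h1 := sech_sq x
  have h2 := Real.cos_sq_add_sin_sq (y - x / 2)
  rw [dx_eTan_sol, inner_E3]
  simp
  grind

theorem inner_eTan_sol : inner ℝ (eTan sol t x y) (eTan sol t x y) = 1 := by
  have h1 := sech_sq x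
  have h2 := Real.cos_sq_add_sin_sq (y - x / 2)
  rw [eTan_sol, inner_E3]
  simp
  grind

theorem isSurface_sol : IsSurface (univ ×ˢ univ) sol where
  isOpen := isOpen_univ.prod isOpen_univ
  smooth := by
    refine contDiffOn_euclidean.2 fun i => ContDiff.contDiffOn ?_
    have h1 : ContDiff ℝ ∞ fun p : ℝ × ℝ × ℝ => sech p.2.1 := contDiff_sech.comp (by fun_prop)
    have h2 : ContDiff ℝ ∞ fun p : ℝ × ℝ × ℝ => Real.tanh p.2.1 := contDiff_tanh.comp (by fun_prop)
    fin_cases i <;> simp [sol] <;> fun_prop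
  unit t x y _ := by
    have h : ‖eTan sol t x y‖ ^ 2 = 1 := by
      rw [← real_inner_self_eq_norm_sq, inner_eTan_sol]
    exact (pow_eq_one_iff_of_nonneg (norm_nonneg _) two_ne_zero).1 h
  regular t x y _ h0 := by
    have h : inner ℝ (nrm sol t x y) (nrm sol t x y) = 0 := by rw [h0, inner_zero_left]
    have h1 := sech_pos x
    have h2 := sech_le_one x
    have h3 := Real.cos_sq_add_sin_sq (y - x / 2)
    have h4 : inner ℝ (dy sol t x y) (dy sol t x y) = 64 / 25 * sech x ^ 2 := by
      rw [dy_sol, inner_E3]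
      simp
      linear_combination 64 / 25 * sech x ^ 2 * h3
    have h5 : inner ℝ (eTan sol t x y) (dy sol t x y) = -(32 / 25) * sech x ^ 2 := by
      rw [eTan_sol, dy_sol, inner_E3]
      simp
      linear_combination -(32 / 25) * sech x ^ 2 * h3
    rw [nrm, inner_cross_cross, show dx sol t x y = eTan sol t x y from rfl, inner_eTan_sol,
      h4, h5] at h
    have h6 : 0 < 1 - 16 / 25 * sech x ^ 2 := by nlinarith
    have h7 : 0 < 64 / 25 * sech x ^ 2 * (1 - 16 / 25 * sech x ^ 2) := by positivity
    linarith

theorem sigma_sol : sigma sol t x y = 1 - 8 / 5 * sech x ^ 2 := by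
  rw [isSurface_sol.sigma_of_rotation (by trivial) dy_eTan_sol dy_dy_sol (by
    rw [dy_sol, inner_E3]
    simp), eTan_sol, inner_E3]
  simp

theorem dx_kap_sol : dx (kap sol) t x y =
    (-(Complex.I / 2) - Real.tanh x - Complex.I * gam sol t x y) * kap sol t x y := by
  have hp : (t, x, y) ∈ (univ ×ˢ univ : Set (ℝ × ℝ × ℝ)) := by trivial
  have h : dx (kap sol) t x y = _ := isSurface_sol.pd_frK_comp hp .x .x
  have h1 : pd .x (pd .x (eTan sol)) t x y = _ := dx_dx_eTan_sol
  rw [h, h1, comp_add, comp_add, comp_smul, comp_smul, comp_smul, isSurface_sol.comp_cross hp,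
    comp_tan]
  change _ - Complex.I * gam sol t x y * kap sol t x y = _
  change _ * kap sol t x y + _ * (_ * kap sol t x y) + _ - _ = _
  push_cast
  ring

theorem frK_y_sol : frK .y sol t x y =
    (-(2 / 5) - Complex.I * (4 / 5 * (Real.tanh x : ℂ))) * kap sol t x y := by
  have hp : (t, x, y) ∈ (univ ×ˢ univ : Set (ℝ × ℝ × ℝ)) := by trivial
  have h1 : pd .y (eTan sol) t x y = _ := dy_eTan_sol_eq
  rw [frK_eq_comp, h1, comp_add, comp_smul, comp_smul, isSurface_sol.comp_cross hp]
  change _ * kap sol t x y + _ * (_ * kap sol t x y) = _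
  push_cast
  ring

theorem conj_kap_mul_kap_sol :
    (starRingEnd ℂ) (kap sol t x y) * kap sol t x y = (4 * sech x ^ 2 : ℝ) := by
  rw [isSurface_sol.conj_kap_mul_kap (by trivial), inner_dx_eTan_sol]

end Soliton

end SurfaceFlow

namespace SurfaceFlow

/-! ### The hierarchy of the surface of rotation -/

section SolitonHierarchy

variable {t x y : ℝ}

theorem hasPd_tanh : HasPd .x (fun _ x _ => (Real.tanh x : ℂ)) ((sech x ^ 2 : ℝ) : ℂ) t x y :=
  (hasDerivAt_tanh x).ofReal_comp

theorem hasPd_sech_sq (c : ℝ) : HasPd .x (fun _ x _ => c * sech x ^ 2)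
    (c * (- 2 * sech x ^ 2 * Real.tanh x)) t x y := by
  refine HasDerivAt.congr_deriv (((hasDerivAt_sech x).pow 2).const_mul c) ?_
  simp only [Nat.cast_ofNat, Nat.add_one_sub_one, pow_one]
  ring

theorem smoothOn_sech_sq {Ω : Set (ℝ × ℝ × ℝ)} (c : ℝ) :
    SmoothOn Ω (fun _ x _ => c * sech x ^ 2) := by
  have h : ContDiff ℝ ∞ fun p : ℝ × ℝ × ℝ => sech p.2.1 := contDiff_sech.comp (by fun_prop)
  exact (contDiff_const.mul (h.pow 2)).contDiffOn

theorem hasPd_kap_sol (i : Dir) : HasPd i (kap sol) (pd i (kap sol) t x y) t x y :=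
  isSurface_sol.smooth_kap.hasPd isSurface_sol.isOpen (by trivial) i

/-- The curvatures are invariant under rotation about the axis. This is obtained from the `(x,y)`
structure equation, with `K_y` and `σ` already explicit. -/
theorem dy_kap_sol : dy (kap sol) t x y = 0 := by
  have hp : (t, x, y) ∈ (univ ×ˢ univ : Set (ℝ × ℝ × ℝ)) := by trivial
  have h := isSurface_sol.pd_frK_sub hp .x .y
  have h1 : pd .x (frK .y sol) t x y = _ :=
    (pd_congr isSurface_sol.isOpen (fun _ _ _ _ => frK_y_sol) hp .x).trans
      (((HasPd.const (-(2 / 5) : ℂ)).sub ((HasPd.const Complex.I).mul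
        ((HasPd.const (4 / 5 : ℂ)).mul hasPd_tanh))).mul (hasPd_kap_sol .x)).pd_eq
  have h2 : pd .x (kap sol) t x y = _ := dx_kap_sol
  have h3 : frG .y sol t x y = _ := sigma_sol
  have h4 := sech_sq x
  rw [h1, h2, frK_y_sol, h3, h4] at h
  change dy (kap sol) t x y - _ = -(_ * _ * kap sol t x y) + _ * (gam sol t x y : ℂ) * _ at h
  push_cast at h
  linear_combination h + (2 / 5 * kap sol t x y * Complex.tanh x) * Complex.I_sq

theorem dy_gam_sol : dy (gam sol) t x y = 0 := by
  have hp : (t, x, y) ∈ (univ ×ˢ univ : Set (ℝ × ℝ × ℝ)) := by trivial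
  have h := isSurface_sol.pd_frG_sub' hp .x .y
  have h1 : pd .x (frG .y sol) t x y = _ :=
    (pd_congr isSurface_sol.isOpen (fun _ _ _ _ => sigma_sol) hp .x).trans
      ((HasPd.const (1 : ℝ)).sub (hasPd_sech_sq (8 / 5))).pd_eq
  have h2 : (starRingEnd ℂ) (frK .x sol t x y) * frK .y sol t x y =
      (-(2 / 5) - Complex.I * (4 / 5 * (Real.tanh x : ℂ))) * (4 * sech x ^ 2 : ℝ) := by
    rw [← conj_kap_mul_kap_sol (t := t) (y := y), frK_y_sol]
    change (starRingEnd ℂ) (kap sol t x y) * _ = _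
    ring
  rw [h1, h2, Complex.im_mul_ofReal] at h
  change dy (gam sol) t x y - _ = _ at h
  simp [Complex.tanh_ofReal_re] at h
  linarith

/-- The surface is stationary, so independence of `t` is definitional and only `y` requires an
argument. -/
theorem kap_sol_eq (t x y : ℝ) : kap sol t x y = kap sol 0 x 0 :=
  is_const_of_deriv_eq_zero (f := fun y => kap sol t x y)
    (fun _ => (HasDerivAt.differentiableAt (hasPd_kap_sol .y))) (fun _ => dy_kap_sol) y 0

theorem gam_sol_eq (t x y : ℝ) : gam sol t x y = gam sol 0 x 0 :=
  is_const_of_deriv_eq_zero (f := fun y => gam sol t x y)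
    (fun _ => (HasDerivAt.differentiableAt
      ((isSurface_sol.smooth_frG .x).hasPd isSurface_sol.isOpen (by trivial) .y)))
    (fun _ => dy_gam_sol) y 0

/-- An angle of the surface of rotation. -/
noncomputable def solAngle : ℝ → ℝ → ℝ → ℝ := fun _ x y => -(∫ s in (0 : ℝ)..x, gam sol 0 s 0) - y

theorem contDiff_gam_sol : ContDiff ℝ ∞ (fun x => gam sol 0 x 0) := by
  have h : ContDiff ℝ ∞ (fun p : ℝ × ℝ × ℝ => gam sol p.1 p.2.1 p.2.2) := by
    rw [← contDiffOn_univ, ← univ_prod_univ]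
    exact isSurface_sol.smooth_frG .x
  exact h.comp (f := fun x : ℝ => ((0 : ℝ), x, (0 : ℝ))) (by fun_prop)

theorem hasDerivAt_integral_gam_sol (x : ℝ) :
    HasDerivAt (fun x => ∫ s in (0 : ℝ)..x, gam sol 0 s 0) (gam sol 0 x 0) x :=
  (contDiff_gam_sol.continuous.integral_hasStrictDerivAt 0 x).hasDerivAt

theorem isAngle_sol : IsAngle (univ ×ˢ univ) sol solAngle where
  smooth := by
    have h : ContDiff ℝ ∞ (fun x => ∫ s in (0 : ℝ)..x, gam sol 0 s 0) := by
      refine contDiff_infty_iff_deriv.2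
        ⟨fun x => (hasDerivAt_integral_gam_sol x).differentiableAt, ?_⟩
      rw [funext fun x => (hasDerivAt_integral_gam_sol x).deriv]
      exact contDiff_gam_sol
    have h1 : ContDiff ℝ ∞ (fun p : ℝ × ℝ × ℝ => ∫ s in (0 : ℝ)..p.2.1, gam sol 0 s 0) :=
      h.comp (f := fun p : ℝ × ℝ × ℝ => p.2.1) (by fun_prop)
    exact (h1.neg.sub (by fun_prop)).contDiffOn
  eq t x y _ := by
    have h : dx solAngle t x y = _ := ((hasDerivAt_integral_gam_sol x).neg.sub_const y).deriv
    rw [h, neg_neg, gam_sol_eq]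

theorem dy_solAngle : dy solAngle t x y = -1 := ((hasDerivAt_id y).const_sub _).deriv

/-- The coefficients of the hierarchy of the surface of rotation. -/
noncomputable def solCoef : ℕ → ℝ × ℝ
  | 0 => (4 / 5, 4 / 5)
  | k + 1 => (5 / 4 * (solCoef k).2, (solCoef k).2 - (solCoef k).1)

/-- The antiderivatives of the hierarchy of the surface of rotation. -/
noncomputable def solA (k : ℕ) : ℝ → ℝ → ℝ → ℝ := fun _ x _ => -2 * (solCoef k).2 * sech x ^ 2

/-- Put `L = -i/2 - tanh x`, the logarithmic `x`-derivative of `u`. The identity `L² + sech² x = 5/4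
- iL` keeps the span of `1` and `L` invariant under the recursion and produces the linear rule for
the coefficients; `solA` is the antiderivative that vanishes at both ends. -/
theorem hier_sol (k : ℕ) : ∀ t x y, hier sol solA k t x y =
    (Complex.I * (solCoef k).1 + (solCoef k).2 * (-(Complex.I / 2) - (Real.tanh x : ℂ)))
      * kap sol t x y := by
  induction k with
  | zero =>
    intro t x y
    rw [hier_zero, frK_y_sol]
    simp only [solCoef]
    push_cast
    linear_combination (4 / 5 * Complex.tanh x * kap sol t x y) * Complex.I_sq
  | succ k ih =>
    intro t x y
    have h : dx (hier sol solA k) t x y = _ :=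
      (pd_congr isSurface_sol.isOpen (fun t x y _ => ih t x y) (by trivial) .x).trans
        (((HasPd.const (Complex.I * (solCoef k).1)).add ((HasPd.const ((solCoef k).2 : ℂ)).mul
          ((HasPd.const (-(Complex.I / 2))).sub hasPd_tanh))).mul (hasPd_kap_sol .x)).pd_eq
    have h2 : pd .x (kap sol) t x y = _ := dx_kap_sol
    rw [hier_succ, h, ih, h2, solA, sech_sq]
    simp only [solCoef]
    push_cast
    linear_combination (kap sol t x y * (- gam sol t x y * (Complex.I * (solCoef k).1
      + (solCoef k).2 * (-(Complex.I / 2) - Complex.tanh x))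
      + (solCoef k).1 * (-(Complex.I / 2) - Complex.tanh x)
      + (solCoef k).2 * (Complex.I / 4 + Complex.tanh x))) * Complex.I_sq

theorem isHierarchy_sol (N : ℕ) : IsHierarchy (univ ×ˢ univ) sol solA N := fun k _ => by
  refine ⟨smoothOn_sech_sq _, fun t x y _ => ?_⟩
  have h : dx (solA k) t x y = _ := (hasPd_sech_sq (t := t) (x := x) (y := y) _).pd_eq
  have h1 : (starRingEnd ℂ) (kap sol t x y) * hier sol solA k t x y =
      (Complex.I * (solCoef k).1 + (solCoef k).2 * (-(Complex.I / 2) - (Real.tanh x : ℂ)))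
        * (4 * sech x ^ 2 : ℝ) := by
    rw [hier_sol, ← conj_kap_mul_kap_sol (t := t) (y := y)]
    ring
  rw [h, pairing_eq, h1, Complex.re_mul_ofReal]
  simp [Complex.tanh_ofReal_re]
  ring

theorem dx_covU_sol : dx (covU sol solAngle) t x y =
    (-(Complex.I / 2) - (Real.tanh x : ℂ)) * covU sol solAngle t x y := by
  have h : dx (covU sol solAngle) t x y = _ := pd_gauge isSurface_sol.isOpen isAngle_sol.smooth
    isSurface_sol.smooth_kap (by trivial) .x
  have h1 : pd .x (kap sol) t x y = _ := dx_kap_sol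
  have h2 : pd .x solAngle t x y = - gam sol t x y := by
    rw [isAngle_sol.eq t x y (by trivial), neg_neg]
    rfl
  rw [h, h1, h2, covU]
  push_cast
  ring

theorem dy_covU_sol : dy (covU sol solAngle) t x y = Complex.I * covU sol solAngle t x y := by
  have h : dy (covU sol solAngle) t x y = _ := pd_gauge isSurface_sol.isOpen isAngle_sol.smooth
    isSurface_sol.smooth_kap (by trivial) .y
  have h1 : pd .y (kap sol) t x y = _ := dy_kap_sol
  have h2 : pd .y solAngle t x y = _ := dy_solAngle
  rw [h, h1, h2, covU]
  push_cast
  ring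

theorem norm_covU_sol : ‖covU sol solAngle t x y‖ = 2 * sech x := by
  have h : (starRingEnd ℂ) (covU sol solAngle t x y) * covU sol solAngle t x y = _ :=
    (conj_gauge_mul_gauge (kap sol) (kap sol)).trans conj_kap_mul_kap_sol
  rw [Complex.conj_mul'] at h
  have h1 : ‖covU sol solAngle t x y‖ ^ 2 = (2 * sech x) ^ 2 := by
    rw [mul_pow]
    norm_num
    exact_mod_cast h
  exact (pow_left_inj₀ (norm_nonneg _) (by have := sech_pos x; positivity) two_ne_zero).1 h1

theorem hasPd_covU_sol (i : Dir) :
    HasPd i (covU sol solAngle) (pd i (covU sol solAngle) t x y) t x y :=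
  SmoothOn.hasPd (isAngle_sol.smooth.gauge isSurface_sol.smooth_kap) isSurface_sol.isOpen
    (by trivial) i

theorem covU_sol_periodic (t x y : ℝ) :
    covU sol solAngle t x (y + 2 * Real.pi) = covU sol solAngle t x y := by
  rw [covU, covU, kap_sol_eq t x (y + 2 * Real.pi), kap_sol_eq t x y]
  congr 1
  have h : -(Complex.I * (solAngle t x (y + 2 * Real.pi) : ℂ)) =
      -(Complex.I * (solAngle t x y : ℂ)) + 2 * Real.pi * Complex.I := by
    simp only [solAngle]
    push_cast
    ring
  rw [h]
  exact Complex.exp_periodic _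

theorem dy_iterate_covU_sol (l : ℕ) : dy^[l] (covU sol solAngle) =
    fun t x y => Complex.I ^ l * covU sol solAngle t x y := by
  induction l with
  | zero => simp
  | succ l ih =>
    rw [Function.iterate_succ_apply', ih]
    funext t x y
    have h : dy (fun t x y => Complex.I ^ l * covU sol solAngle t x y) t x y = _ :=
      ((HasPd.const (Complex.I ^ l)).mul (hasPd_covU_sol .y)).pd_eq
    rw [h, show pd .y (covU sol solAngle) t x y = _ from dy_covU_sol]
    ring

/-- Both `∂_x u / u` and `∂_x tanh` are polynomials in `tanh x`. As `tanh` is bounded, every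
derivative decays like `sech`. -/
theorem dx_iterate_covU_sol (c : ℂ) (j : ℕ) : ∃ P : Polynomial ℂ,
    dx^[j] (fun t x y => c * covU sol solAngle t x y) =
      fun t x y => P.eval (Real.tanh x : ℂ) * covU sol solAngle t x y := by
  induction j with
  | zero => exact ⟨Polynomial.C c, by simp⟩
  | succ j ih =>
    obtain ⟨P, hP⟩ := ih
    refine ⟨P.derivative * (1 - Polynomial.X ^ 2)
      + P * (Polynomial.C (-(Complex.I / 2)) - Polynomial.X), ?_⟩
    rw [Function.iterate_succ_apply', hP]
    funext t x y
    have h1 : HasPd .x (fun _ x _ => P.eval (Real.tanh x : ℂ)) _ t x y :=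
      HasDerivAt.comp x (P.hasDerivAt _) (hasDerivAt_tanh x).ofReal_comp
    have h : dx (fun t x y => P.eval (Real.tanh x : ℂ) * covU sol solAngle t x y) t x y = _ :=
      (h1.mul (hasPd_covU_sol .x)).pd_eq
    rw [h, show pd .x (covU sol solAngle) t x y = _ from dx_covU_sol, sech_sq]
    simp
    ring

theorem boundaryCond_sol : BoundaryCond univ (Ioc 0 (2 * Real.pi)) (covU sol solAngle) := by
  refine Or.inr ⟨2 * Real.pi, by positivity, rfl, fun t _ x y => covU_sol_periodic t x y,
    fun K _ _ N j l => ?_⟩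
  rw [dy_iterate_covU_sol]
  obtain ⟨P, hP⟩ := dx_iterate_covU_sol (Complex.I ^ l) j
  obtain ⟨C, hC⟩ := exists_pow_mul_sech_le N
  obtain ⟨M, hM⟩ := (isCompact_Icc (a := (-1 : ℝ)) (b := 1)).exists_bound_of_continuousOn
    (f := fun z : ℝ => P.eval (z : ℂ)) (by fun_prop)
  refine ⟨M * (2 * C), fun t _ x y => ?_⟩
  have h1 := hM (Real.tanh x) ⟨(Real.neg_one_lt_tanh x).le, (Real.tanh_lt_one x).le⟩
  have h2 := sech_pos x
  rw [hP, norm_mul, norm_covU_sol]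
  calc (1 + |x|) ^ N * (‖P.eval (Real.tanh x : ℂ)‖ * (2 * sech x))
      = ‖P.eval (Real.tanh x : ℂ)‖ * (2 * ((1 + |x|) ^ N * sech x)) := by ring
    _ ≤ M * (2 * C) := mul_le_mul h1 (by linarith [hC x]) (by positivity)
        ((norm_nonneg _).trans h1)

theorem exists_sech_sq_le : ∃ C, ∀ x : ℝ, sech x ^ 2 ≤ C * (1 + x ^ 2)⁻¹ := by
  obtain ⟨C, hC⟩ := exists_pow_mul_sech_le 2
  refine ⟨C, fun x => ?_⟩
  have h1 := sech_pos x
  have h2 := sech_le_one x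
  have h3 := abs_nonneg x
  rw [← div_eq_mul_inv, le_div_iff₀ (by positivity)]
  refine le_trans ?_ (hC x)
  rw [mul_comm]
  have h4 : 1 + x ^ 2 ≤ (1 + |x|) ^ 2 := by nlinarith [sq_abs x]
  exact mul_le_mul h4 (by nlinarith) (by positivity) (by positivity)

theorem isGlobal_sol : IsGlobal univ (Ioc 0 (2 * Real.pi)) sol solA solAngle where
  surface := isSurface_sol
  hierarchy := isHierarchy_sol
  skew k t _ y := by
    obtain ⟨C, hC⟩ := exists_sech_sq_le
    refine Skew.of_le (C := |-2 * (solCoef k).2| * C) fun x => ?_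
    rw [solA, abs_mul, abs_of_nonneg (sq_nonneg (sech x)), mul_assoc]
    exact mul_le_mul_of_nonneg_left (hC x) (abs_nonneg _)
  angle := isAngle_sol
  adapted t x y _ := by
    -- The slope `-1` of the angle in `y` cancels the limit `1` of `σ`, so that `a 0` tends to zero
    -- at both ends; it also makes `u` proportional to `e^{iy}`, hence the period `2π`.
    rw [sigma_sol, dy_solAngle, solA]
    simp only [solCoef]
    ring
  boundary := boundaryCond_sol

/-- With powers of `2` cleared, the second coefficient is multiplied by `2` modulo `5` at each step,
so it never vanishes. The start is at index two because the coefficient of index one is zero. -/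
theorem solCoef_add_two (k : ℕ) : ∃ p q : ℤ, ¬ (5 : ℤ) ∣ q ∧
    (solCoef (k + 2)).1 = 5 * p / 2 ^ (k + 2) ∧ (solCoef (k + 2)).2 = q / 2 ^ (k + 1) := by
  induction k with
  | zero => exact ⟨0, -2, by norm_num, by norm_num [solCoef], by norm_num [solCoef]⟩
  | succ k ih =>
    obtain ⟨p, q, h, h1, h2⟩ := ih
    refine ⟨q, 2 * q - 5 * p, by omega, ?_, ?_⟩
    · rw [show k + 1 + 2 = (k + 2) + 1 by ring, solCoef, h2]
      field_simp
      ring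
    · rw [show k + 1 + 2 = (k + 2) + 1 by ring, solCoef, h1, h2]
      push_cast
      field_simp
      ring

theorem total_solA_ne_zero {k : ℕ} (hk : 2 ≤ k) : total (Ioc 0 (2 * Real.pi)) (solA k) 0 ≠ 0 := by
  obtain ⟨C, hC⟩ := exists_sech_sq_le
  have hi : Integrable (fun x => sech x ^ 2) :=
    (integrable_inv_one_add_sq.const_mul C).mono'
      (contDiff_sech.continuous.pow 2).aestronglyMeasurable (ae_of_all _ fun x => by
        rw [Real.norm_of_nonneg (sq_nonneg _)]
        exact hC x)
  have hpos : 0 < ∫ x, sech x ^ 2 := by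
    rw [integral_pos_iff_support_of_nonneg (fun x => sq_nonneg _) hi]
    have : Function.support (fun x => sech x ^ 2) = univ :=
      eq_univ_of_forall fun x => pow_ne_zero 2 (sech_pos x).ne'
    rw [this]
    simp
  have hB : (solCoef k).2 ≠ 0 := by
    obtain ⟨j, rfl⟩ := Nat.exists_eq_add_of_le' hk
    obtain ⟨p, q, h, -, h2⟩ := solCoef_add_two j
    rw [h2]
    refine div_ne_zero (Int.cast_ne_zero.2 ?_) (by positivity)
    rintro rfl
    exact h (dvd_zero 5)
  have hpi := Real.pi_pos
  simp only [total, solA, setIntegral_const, smul_eq_mul, integral_const_mul,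
    Real.volume_real_Ioc_of_le (show (0 : ℝ) ≤ 2 * Real.pi by positivity), sub_zero]
  have := hpos.ne'
  positivity

end SolitonHierarchy

end SurfaceFlow

/-! ### Assembly of the theorem. -/

open SurfaceFlow in
theorem mainTheorem7 :
    -- the flow vector fields do not stretch the x-lines, and the bottom relation of the hierarchy
    (∀ (Ω : Set (ℝ × ℝ × ℝ)) (r : ℝ → ℝ → ℝ → E3) (a : ℕ → ℝ → ℝ → ℝ → ℝ) (n : ℕ), 1 ≤ n →
      IsSurface Ω r → IsHierarchy Ω r a n →
      (∀ t x y, (t, x, y) ∈ Ω →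
        inner ℝ (dx r t x y) (dx (velocity r a (n - 1)) t x y) = 0) ∧
      (∀ ψ : ℝ → ℝ → ℝ → ℝ, IsAngle Ω r ψ → IsAdapted Ω r a ψ →
        ∀ t x y, (t, x, y) ∈ Ω →
          hier r a 1 t x y =
            (dy (alpha r) t x y + beta r t x y * dy ψ t x y : ℝ) +
              Complex.I * (dy (beta r) t x y - alpha r t x y * dy ψ t x y : ℝ))) ∧
    -- every flow: x-lines keep their arclength, area law, evolution of α, β, ψ
    (∀ (n : ℕ), 1 ≤ n → ∀ (Ω : Set (ℝ × ℝ × ℝ)) (r : ℝ → ℝ → ℝ → E3)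
      (a : ℕ → ℝ → ℝ → ℝ → ℝ), IsFlow n Ω r a →
      (∀ t x y, (t, x, y) ∈ Ω → dt (fun t x y => ‖dx r t x y‖) t x y = 0) ∧
      (∀ t x y, (t, x, y) ∈ Ω →
        tanX r a (n - 1) t x y • dx r t x y + tanY r a (n - 1) t x y • dy r t x y
          = tangential r a (n - 1) t x y ∧
        dt (area r) t x y = expansion r a n t x y * area r t x y
          + (dx (fun t x y => area r t x y * tanX r a (n - 1) t x y) t x y
            + dy (fun t x y => area r t x y * tanY r a (n - 1) t x y) t x y)) ∧
      (∀ t x y, (t, x, y) ∈ Ω →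
        ((dt (alpha r) t x y : ℝ) : ℂ) + Complex.I * ((dt (beta r) t x y : ℝ) : ℂ) =
          dx (fun t x y => (a (n - 1) t x y : ℂ) * kap r t x y) t x y
          - D1 r (D1 r (hier r a (n - 1))) t x y
          - kapPerp r t x y * ((D2 r (hier r a (n - 1)) t x y).im : ℂ)) ∧
      (∀ ψ : ℝ → ℝ → ℝ → ℝ, IsAngle Ω r ψ →
        ∃ an : ℝ → ℝ → ℝ → ℝ,
          IsAntiderivX Ω an (fun t x y => - pairing r (hier r a n) t x y) ∧
          ∀ t x y, (t, x, y) ∈ Ω →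
            dt ψ t x y = a (n - 1) t x y * dx ψ t x y + an t x y
              + (D2 r (hier r a (n - 1)) t x y).im)) ∧
    -- no transverse direction is kept unstretched by the hierarchy
    (∀ (n : ℕ), 1 ≤ n → ∃ (Ω : Set (ℝ × ℝ × ℝ)) (r : ℝ → ℝ → ℝ → E3)
      (a : ℕ → ℝ → ℝ → ℝ → ℝ), Ω.Nonempty ∧ IsFlow n Ω r a ∧
      ∀ t x y, (t, x, y) ∈ Ω → ∀ ξ η : ℝ, η ≠ 0 →
        dt (fun t x y => ‖ξ • dx r t x y + η • dy r t x y‖) t x y ≠ 0) ∧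
    -- constants of motion of every flow
    (∀ (n : ℕ), 1 ≤ n → ∀ (T Y : Set ℝ) (r : ℝ → ℝ → ℝ → E3) (a : ℕ → ℝ → ℝ → ℝ → ℝ)
      (ψ : ℝ → ℝ → ℝ → ℝ), IsFlow n (T ×ˢ Set.univ) r a → IsGlobal T Y r a ψ →
      (∃ c : ℝ → ℝ, ∀ t ∈ T, ∀ x y : ℝ,
        dt ψ t x y = a (n - 1) t x y * dx ψ t x y + a n t x y
          + (D2 r (hier r a (n - 1)) t x y).im + c t) ∧
      (∀ k : ℕ, 2 ≤ k → ∀ t ∈ T,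
        Converges Y (a k) t ∧ HasDerivAt (total Y (a k)) 0 t) ∧
      (∀ t ∈ T,
        Converges Y (density2 r ψ) t ∧ total Y (a 2) t = total Y (density2 r ψ) t ∧
        Converges Y (density3 r a ψ) t ∧ total Y (a 3) t = total Y (density3 r a ψ) t)) ∧
    -- they are nontrivial
    (∀ k : ℕ, 2 ≤ k → ∃ (Y : Set ℝ) (r : ℝ → ℝ → ℝ → E3) (a : ℕ → ℝ → ℝ → ℝ → ℝ)
      (ψ : ℝ → ℝ → ℝ → ℝ), IsGlobal Set.univ Y r a ψ ∧ total Y (a k) 0 ≠ 0) := by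
  refine ⟨fun Ω r a n hn hS hH => ?_, fun n hn Ω r a hF => ?_,
    fun n hn => exists_flow_stretching n hn, fun n hn T Y r a ψ hF hG => ?_,
    fun k hk => ⟨_, _, _, _, isGlobal_sol, total_solA_ne_zero hk⟩⟩
  · refine ⟨fun t x y hp => inner_tan_dx_velocity hS hH (by omega) hp,
      fun ψ hψ hA t x y hp => ?_⟩
    have h : dy (kap r) t x y = _ := hS.pd_frK hp .x .y
    rw [hier_one hS hA hp, h]
    change ((dy (alpha r) t x y : ℝ) : ℂ) + Complex.I * ((dy (beta r) t x y : ℝ) : ℂ) - _ = _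
    rw [kap]
    push_cast
    linear_combination (-((dy ψ t x y : ℝ) : ℂ) * beta r t x y) * Complex.I_sq
  · obtain ⟨m, rfl⟩ := Nat.exists_eq_add_of_le' hn
    refine ⟨fun t x y hp => hF.dt_norm_dx hp,
      fun t x y hp => ⟨hF.surface.tanX_smul_add_tanY_smul m hp, hF.dt_area hp⟩,
      fun t x y hp => hF.dt_kap hp,
      fun ψ hψ => ⟨_, hF.antideriv_rotation hψ, fun t x y hp => hF.dt_psi hψ hp⟩⟩
  · obtain ⟨m, rfl⟩ := Nat.exists_eq_add_of_le' hn
    refine ⟨hG.exists_rotation hF, fun k hk t ht => ?_, fun t ht => hG.densities ht⟩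
    -- Conservation holds from index one on, where the shifted hierarchy begins.
    obtain ⟨j, rfl⟩ := Nat.exists_eq_add_of_le' (show 1 ≤ k by omega)
    exact ⟨hG.converges j ht, hG.hasDerivAt_total hF j ht⟩
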